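/- Let $d\ge 2$ and consider the kernel $K_0(r)=r^{-d}$. For a configuration $u:\mathbb R^d\to\{0,1\}$ with autocorrelation function $$C_u(z)=\lim_{R\to\infty}\frac1{(2R)^d}\int_{[-R,R]^d}u(x+z)\,u(x)\,dx,$$ define the energy $$\mathcal E_0(u)=\int_{\mathbb R^d}\frac{C_u(z)-C_u(0)-\big(z\cdot\nabla C_u(0)\big)\chi_{B_1}(z)}{|z|}\,K_0(|z|)\,dz,$$ where, $C_u$ being even with a conical singularity at $0$, $z\cdot\nabla C_u(0)$ denotes the one-sided directional derivative $\lim_{t\to0+}\frac{C_u(tz)-C_u(0)}{t}$; for a set $\Omega$ write $\mathcal E_0(\Omega)=\mathcal E_0(\chi_\Omega)$. For $\lambda\in(0,1)$ let $e_S(\lambda)$ be the minimum of $\mathcal E_0(\Omega)$ over the stripe configurations $$\Omega=\bigcup_{j\in\mathbb Z}\big(j(d_0+d_1),\,j(d_0+d_1)+d_0\big)\times\mathbb R^{d-1},\qquad d_0,d_1>0,\quad \frac{d_0}{d_0+d_1}=\lambda.$$ For a Bravais lattice $\Lambda_0\subset\mathbb R^d$ (the $\mathbb Z$-span of a basis of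 $\mathbb R^d$) whose periodicity cell has volume $|\Lambda_0|=1$, let $e_{B,\Lambda_0}(\lambda)$ be the minimum of $\mathcal E_0(\Omega)$ over the lattice ball configurations $\Omega=\bigcup_{q\in\Lambda}B_\rho(q)$ with $\Lambda=a\Lambda_0$, $a>0$, $0<\rho\le\frac12\min\{|p-q|:p,q\in\Lambda,\ p\ne q\}$ and volume fraction $|B_\rho|/|\Lambda|=\lambda$ (and $e_{B,\Lambda_0}(\lambda)=+\infty$ if no such configuration exists). Then: (i) For every $d\ge2$ and every Bravais lattice $\Lambda_0\subset\mathbb R^d$ with $|\Lambda_0|=1$ there is $\lambda_0=\lambda_0(d,\Lambda_0)>0$ such that for all $0<\lambda<\lambda_0$ both minima are attained and $e_{B,\Lambda_0}(\lambda)<e_S(\lambda)$. (ii) Let $d=2$. There is $\delta_0>0$ such that for every Bravais lattice $\Lambda_0\subset\mathbb R^2$ with $|\Lambda_0|=1$ and every $\lambda$ with $|\lambda-\frac12|<\delta_0$, the minimum defining $e_S(\lambda)$ is attained, the minimum defining $e_{B,\Lambda_0}(\lambda)$ is attained whenever there is an admissible ball configuration, and $e_S(\lambda)<e_{B,\Lambda_0}(\lambda)$.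 -/

import Mathlib

open Filter Topology MeasureTheory
open scoped Pointwise ENNReal

namespace StripesBalls

noncomputable section

/-- Euclidean `d`-space. -/
abbrev Space (d : ℕ) : Type := EuclideanSpace ℝ (Fin d)

/-- The cube `[-R, R]^d`. -/
def cube (d : ℕ) (R : ℝ) : Set (Space d) :=
  {x | ∀ i, x i ∈ Set.Icc (-R) R}

/-- The autocorrelation function of a configuration `u`, i.e. the limit as `R → ∞` of the mean
value over `[-R, R]^d` of `x ↦ u (x + z) u (x)`. -/
def autocorrelation {d : ℕ} (u : Space d → ℝ) (z : Space d) : ℝ :=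
  limUnder atTop fun R : ℝ => ⨍ x in cube d R, u (x + z) * u x

/-- The one-sided directional derivative of `C` at the origin in direction `z`. For an
autocorrelation function, which is even and has a conical singularity at the origin, this is the
meaning of the term `z · ∇C(0)`. -/
def originSlope {d : ℕ} (C : Space d → ℝ) (z : Space d) : ℝ :=
  derivWithin (fun t : ℝ => C (t • z)) (Set.Ici 0) 0

/-- The integrand `(C(z) - C(0) - z · ∇C(0) χ_{B_1}(z)) K(|z|) / |z|` of the energy. -/
def energyDensity {d : ℕ} (K : ℝ → ℝ) (C : Space d → ℝ) (z : Space d) : ℝ :=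
  (C z - C 0 - (Metric.ball (0 : Space d) 1).indicator (originSlope C) z) / ‖z‖ * K ‖z‖

/-- The energy of a configuration `u` for the kernel `K`: the integral over `ℝ^d` of the energy
density of its autocorrelation function, as an extended real number (integral of the positive part
minus integral of the negative part). -/
def energy {d : ℕ} (K : ℝ → ℝ) (u : Space d → ℝ) : EReal :=
  ((∫⁻ z, ENNReal.ofReal (energyDensity K (autocorrelation u) z) : ℝ≥0∞) : EReal) -
    ((∫⁻ z, ENNReal.ofReal (-energyDensity K (autocorrelation u) z) : ℝ≥0∞) : EReal)

/-- The kernel `r ↦ r^{-d}`. -/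
def kernel (d : ℕ) (r : ℝ) : ℝ := (r ^ d)⁻¹

/-- The energy of (the characteristic function of) a set for the kernel `r ↦ r^{-d}`. -/
def setEnergy {d : ℕ} (Ω : Set (Space d)) : EReal :=
  energy (kernel d) (Ω.indicator fun _ => (1 : ℝ))

/-- Equally distributed stripes of width `d₀` and mutual distance `d₁`, orthogonal to the first
coordinate axis. -/
def stripes (d : ℕ) [NeZero d] (d₀ d₁ : ℝ) : Set (Space d) :=
  {x | ∃ j : ℤ, x 0 ∈ Set.Ioo (j * (d₀ + d₁)) (j * (d₀ + d₁) + d₀)}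

/-- The balls of radius `ρ` centred at the points of the lattice `Λ`. -/
def latticeBalls {d : ℕ} (Λ : Submodule ℤ (Space d)) (ρ : ℝ) : Set (Space d) :=
  ⋃ q ∈ Λ, Metric.ball q ρ

/-- The energies of all stripe configurations of volume fraction `lam`. -/
def stripeEnergies (d : ℕ) [NeZero d] (lam : ℝ) : Set EReal :=
  {e | ∃ d₀ d₁ : ℝ, 0 < d₀ ∧ 0 < d₁ ∧ d₀ / (d₀ + d₁) = lam ∧ e = setEnergy (stripes d d₀ d₁)}

/-- The energies of all configurations of volume fraction `lam` that consist of non-overlapping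
(possibly touching) balls of equal radius, centred at the points of a lattice `a Λ₀` with `a > 0`.
The volume fraction is the ratio of the volume of a ball and the volume of the periodicity cell. -/
def ballEnergies {d : ℕ} (Λ₀ : Submodule ℤ (Space d)) (lam : ℝ) : Set EReal :=
  {e | ∃ a ρ : ℝ, 0 < a ∧ 0 < ρ ∧
    (∀ p ∈ a • Λ₀, ∀ q ∈ a • Λ₀, p ≠ q → ρ ≤ dist p q / 2) ∧
    volume.real (Metric.ball (0 : Space d) ρ) / ZLattice.covolume (a • Λ₀) = lam ∧
    e = setEnergy (latticeBalls (a • Λ₀) ρ)}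

/-- The minimal energy of stripes of volume fraction `lam`. -/
def eS (d : ℕ) [NeZero d] (lam : ℝ) : EReal := sInf (stripeEnergies d lam)

/-- The minimal energy of balls of volume fraction `lam` on rescalings of the lattice `Λ₀`
(equal to `⊤` if there is no such configuration). -/
def eB {d : ℕ} (Λ₀ : Submodule ℤ (Space d)) (lam : ℝ) : EReal := sInf (ballEnergies Λ₀ lam)

end

end StripesBalls

/-! Write d = k + 1, ω = `ballVol k`, c = `capDefect k`. Dilating a periodic configuration by a
multiplies its energy by 1/a and, since the cut-off to the unit ball is not scale invariant, also
produces a logarithm: the energy at scale a is (E - S log a)/a, where S > 0 comes from the conical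
slope of the autocorrelation function. `isLeast_scale` minimizes this to -S exp(-1 - E/S). At fixed
volume fraction λ the scale is the only free parameter in both families, so the minima are attained
and only E/S has to be compared.

For stripes, integrating the kernel over hyperplanes leaves a one-dimensional regularized integral
H(λ) of the periodic overlap profile; c enters as the price of cutting off by a ball and not by a
slab (`energy_stripes`). For balls, polar coordinates give the self-interaction of one ball, in
which c appears again (`regIntegral_capTail`), and a nonnegative term X from pairs of distinct balls
(`energy_latticeBalls`). The minima are -2ω exp(c - 1 - H(λ)) and -2(k + 1)ωλ exp(-c - X/S).

Small λ: comparison with a single stripe gives H(λ) ≥ -1 - log λ, while X/S tends to 0 with the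
radius. Balls win as soon as 2c < log(k + 1), which is `two_mul_capDefect_lt_log`.

λ near 1/2 in the plane: H(1/2) is bounded by log π - 1 through Wallis' product, so stripes reach
-2e/π at λ = 1/2, and they win if X/S > log(4π) - 2 for every lattice. The lower bound for X has
three ingredients. The Bessel inequality for (1 + z)^(-3/2) bounds circle averages of an inverse
cube, so that the interaction of two discs at distance t is at least an explicit combination of
t^(-3), t^(-5), t^(-7) (`discInteraction_le_lintegral`). These lattice sums are Mellin transforms of
the theta function of the lattice. The theta function is bounded below, uniformly over lattices of
covolume 1, by a Cauchy–Schwarz inequality for periodizations (`sq_integral_le_tsum`) and a tangent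
line argument (`one_add_exp_le_tsum`). The resulting constant beats log(4π) - 2 by about 0.001, and
continuity in λ gives a neighbourhood of 1/2 that does not depend on the lattice. -/

namespace StripesBalls

/-! ### Autocorrelation functions of periodic configurations -/

/-- The mean values defining the autocorrelation function of `u` converge to `C`. -/
def HasAutocorrelation {d : ℕ} (u C : Space d → ℝ) : Prop :=
  ∀ z, Tendsto (fun R : ℝ => ⨍ x in cube d R, u (x + z) * u x) atTop (𝓝 (C z))

theorem HasAutocorrelation.eq {d : ℕ} {u C : Space d → ℝ} (h : HasAutocorrelation u C) :
    autocorrelation u = C :=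
  funext fun z => (h z).limUnder_eq

theorem cube_eq_preimage (d : ℕ) (R : ℝ) :
    cube d R = (WithLp.ofLp : Space d → Fin d → ℝ) ⁻¹' Set.Icc (fun _ => -R) (fun _ => R) := by
  ext x
  simp [cube, Set.mem_Icc, Pi.le_def, forall_and]

theorem measurableSet_cube (d : ℕ) (R : ℝ) : MeasurableSet (cube d R) := by
  rw [cube_eq_preimage]
  exact (PiLp.volume_preserving_ofLp (Fin d)).measurable measurableSet_Icc

theorem volume_cube (d : ℕ) (R : ℝ) : volume (cube d R) = ENNReal.ofReal (2 * R) ^ d := by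
  rw [cube_eq_preimage, (PiLp.volume_preserving_ofLp (Fin d)).measure_preimage
    measurableSet_Icc.nullMeasurableSet, Real.volume_Icc_pi]
  simp [two_mul]

theorem volume_real_cube (d : ℕ) {R : ℝ} (hR : 0 ≤ R) :
    volume.real (cube d R) = (2 * R) ^ d := by
  rw [measureReal_def, volume_cube, ENNReal.toReal_pow, ENNReal.toReal_ofReal (by positivity)]

theorem volume_cube_ne_top (d : ℕ) (R : ℝ) : volume (cube d R) ≠ ∞ := by
  rw [volume_cube]
  exact ENNReal.pow_ne_top ENNReal.ofReal_ne_top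

theorem smul_cube (d : ℕ) {a : ℝ} (ha : 0 < a) (R : ℝ) : a • cube d R = cube d (a * R) := by
  ext x
  rw [Set.mem_smul_set_iff_inv_smul_mem₀ ha.ne']
  simp only [cube, Set.mem_ofPred_eq, PiLp.smul_apply, smul_eq_mul, Set.mem_Icc]
  refine forall_congr' fun i => ?_
  rw [inv_mul_le_iff₀ ha, le_inv_mul_iff₀ ha, mul_neg]

theorem HasAutocorrelation.scale {d : ℕ} {u C : Space d → ℝ} (h : HasAutocorrelation u C)
    {a : ℝ} (ha : 0 < a) :
    HasAutocorrelation (fun x => u (a⁻¹ • x)) (fun z => C (a⁻¹ • z)) := by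
  intro z
  have key : ∀ R : ℝ, ⨍ x in cube d R, u (a⁻¹ • (x + z)) * u (a⁻¹ • x) =
      ⨍ x in cube d (a⁻¹ * R), u (x + a⁻¹ • z) * u x := by
    intro R
    have h1 := Measure.setIntegral_comp_smul_of_pos (volume : Measure (Space d))
      (fun y => u (y + a⁻¹ • z) * u y) (cube d R) (inv_pos.2 ha)
    simp only [smul_add]
    rw [setAverage_eq, setAverage_eq, h1, smul_cube d (inv_pos.2 ha), smul_smul]
    congr 1
    rw [measureReal_def, measureReal_def, volume_cube, volume_cube, ENNReal.toReal_pow,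
      ENNReal.toReal_pow, finrank_euclideanSpace_fin, ← mul_inv, ← mul_pow]
    congr 2
    rcases le_total 0 R with hR | hR
    · rw [ENNReal.toReal_ofReal (by positivity), ENNReal.toReal_ofReal (by positivity)]
      ring
    · rw [ENNReal.ofReal_of_nonpos (by linarith), ENNReal.ofReal_of_nonpos]
      · simp
      · have := mul_nonpos_of_nonneg_of_nonpos (inv_pos.2 ha).le hR
        linarith
  simp_rw [key]
  exact (h (a⁻¹ • z)).comp (tendsto_id.const_mul_atTop (inv_pos.2 ha))

theorem tendsto_cube_ratio (d : ℕ) (D : ℝ) :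
    Tendsto (fun R : ℝ => ((2 * R) ^ d)⁻¹ * (2 * (R + D)) ^ d) atTop (𝓝 1) := by
  have h0 : Tendsto (fun R : ℝ => (1 + D * R⁻¹) ^ d) atTop (𝓝 ((1 + D * 0) ^ d)) :=
    ((tendsto_inv_atTop_zero.const_mul D).const_add 1).pow d
  rw [mul_zero, add_zero, one_pow] at h0
  refine h0.congr' ?_
  filter_upwards [eventually_gt_atTop 0] with R hR
  rw [← inv_pow, ← mul_pow]
  congr 1
  field_simp

/-- If the average of `v` over every translate of a boundedly supported probability measure is
`m`, then `m` is the limit of the mean values of `v` over large cubes. -/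
theorem tendsto_setAverage_cube {d : ℕ} {v : Space d → ℝ} (hv : Measurable v)
    (hv0 : ∀ x, 0 ≤ v x) (hv1 : ∀ x, v x ≤ 1) (μ : Measure (Space d)) [IsProbabilityMeasure μ]
    {D m : ℝ} (hD : ∀ᵐ y ∂μ, ‖y‖ ≤ D) (hm : ∀ x, ∫ y, v (x + y) ∂μ = m) :
    Tendsto (fun R : ℝ => ⨍ x in cube d R, v x) atTop (𝓝 m) := by
  have hD0 : 0 ≤ D := by
    obtain ⟨y, hy⟩ := hD.exists
    exact (norm_nonneg y).trans hy
  have hfin : ∀ R, Fact (volume (cube d R) < ∞) := fun R => ⟨(volume_cube_ne_top d R).lt_top⟩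
  have hint : ∀ R, IntegrableOn v (cube d R) := fun R => by
    have := hfin R
    refine Integrable.of_bound hv.aestronglyMeasurable 1 (ae_of_all _ fun x => ?_)
    rw [Real.norm_of_nonneg (hv0 x)]
    exact hv1 x
  have hint2 : ∀ y R, IntegrableOn (fun x => v (x + y)) (cube d R) := fun y R => by
    have := hfin R
    refine Integrable.of_bound (Measurable.aestronglyMeasurable (by fun_prop)) 1 (ae_of_all _ fun x => ?_)
    rw [Real.norm_of_nonneg (hv0 _)]
    exact hv1 _
  -- By Fubini the μ-mean of the translated cube integrals is exactly the volume times m. A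
  -- translation by at most D moves the cube of half-side R - D into, and that of half-side R + D
  -- over, the cube of half-side R; since v ≥ 0 this sandwiches the integral.
  have swap : ∀ R, ∫ y, (∫ x in cube d R, v (x + y)) ∂μ = volume.real (cube d R) * m := by
    intro R
    have := hfin R
    rw [integral_integral_swap]
    · simp [hm]
    · refine Integrable.of_bound (Measurable.aestronglyMeasurable (by fun_prop)) 1 (ae_of_all _ fun x => ?_)
      simp only [Function.uncurry]
      rw [Real.norm_of_nonneg (hv0 _)]
      exact hv1 _
  have hint3 : ∀ R, Integrable (fun y => ∫ x in cube d R, v (x + y)) μ := by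
    intro R
    have := hfin R
    have h : Integrable (Function.uncurry fun y x => v (x + y))
        (μ.prod (volume.restrict (cube d R))) := by
      refine Integrable.of_bound (Measurable.aestronglyMeasurable (by fun_prop)) 1 (ae_of_all _ fun x => ?_)
      simp only [Function.uncurry]
      rw [Real.norm_of_nonneg (hv0 _)]
      exact hv1 _
    exact h.integral_prod_left
  have shift : ∀ y R R', (∀ x ∈ cube d R, x + y ∈ cube d R') →
      ∫ x in cube d R, v (x + y) ≤ ∫ x in cube d R', v x := by
    intro y R R' h
    rw [← integral_indicator (measurableSet_cube d R), ← integral_indicator (measurableSet_cube d R'),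
      ← integral_add_right_eq_self ((cube d R').indicator v) y]
    refine integral_mono ((hint2 y R).integrable_indicator (measurableSet_cube d R))
      (((hint R').integrable_indicator (measurableSet_cube d R')).comp_add_right y) fun x => ?_
    by_cases hx : x ∈ cube d R
    · simp [hx, h x hx]
    · simp only [hx, not_false_eq_true, Set.indicator_of_notMem]
      exact Set.indicator_nonneg (fun x _ => hv0 x) _
  have shift' : ∀ y R R', (∀ x, x + y ∈ cube d R' → x ∈ cube d R) →
      ∫ x in cube d R', v x ≤ ∫ x in cube d R, v (x + y) := by
    intro y R R' h
    rw [← integral_indicator (measurableSet_cube d R), ← integral_indicator (measurableSet_cube d R'),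
      ← integral_add_right_eq_self ((cube d R').indicator v) y]
    refine integral_mono
      (((hint R').integrable_indicator (measurableSet_cube d R')).comp_add_right y)
      ((hint2 y R).integrable_indicator (measurableSet_cube d R)) fun x => ?_
    by_cases hx : x + y ∈ cube d R'
    · simp [hx, h x hx]
    · simp only [hx, not_false_eq_true, Set.indicator_of_notMem]
      exact Set.indicator_nonneg (fun x _ => hv0 _) _
  have hcoord : ∀ y : Space d, ‖y‖ ≤ D → ∀ i, |y i| ≤ D := fun y hy i =>
    (PiLp.norm_apply_le y i).trans hy
  have lower : ∀ R, volume.real (cube d (R + -D)) * m ≤ ∫ x in cube d R, v x := by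
    intro R
    rw [← swap]
    calc _ ≤ ∫ _, (∫ x in cube d R, v x) ∂μ := by
          refine integral_mono_ae (hint3 _) (integrable_const _) ?_
          filter_upwards [hD] with y hy
          refine shift y _ _ fun x hx i => ?_
          have h1 := hx i
          have h2 := abs_le.1 (hcoord y hy i)
          simp only [Set.mem_Icc, PiLp.add_apply] at h1 ⊢
          constructor <;> linarith
      _ = _ := by simp
  have upper : ∀ R, ∫ x in cube d R, v x ≤ volume.real (cube d (R + D)) * m := by
    intro R
    rw [← swap]
    calc _ = ∫ _, (∫ x in cube d R, v x) ∂μ := by simp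
      _ ≤ _ := by
          refine integral_mono_ae (integrable_const _) (hint3 _) ?_
          filter_upwards [hD] with y hy
          refine shift' y _ _ fun x hx i => ?_
          have h1 := hx i
          have h2 := abs_le.1 (hcoord y hy i)
          simp only [Set.mem_Icc, PiLp.add_apply] at h1 ⊢
          constructor <;> linarith
  have hlim : ∀ D : ℝ, Tendsto (fun R : ℝ => ((2 * R) ^ d)⁻¹ * ((2 * (R + D)) ^ d * m)) atTop
      (𝓝 m) := fun D => by
    simpa [mul_assoc] using (tendsto_cube_ratio d D).mul_const m
  refine tendsto_of_tendsto_of_tendsto_of_le_of_le' (hlim (-D)) (hlim D) ?_ ?_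
  · filter_upwards [eventually_gt_atTop D] with R hR
    have hR0 : 0 < R := by linarith
    rw [setAverage_eq, smul_eq_mul, volume_real_cube d (by linarith),
      ← volume_real_cube d (R := R + -D) (by linarith)]
    exact mul_le_mul_of_nonneg_left (lower R) (by positivity)
  · filter_upwards [eventually_gt_atTop D] with R hR
    have hR0 : 0 < R := by linarith
    rw [setAverage_eq, smul_eq_mul, volume_real_cube d (by linarith),
      ← volume_real_cube d (R := R + D) (by linarith)]
    exact mul_le_mul_of_nonneg_left (upper R) (by positivity)

/-! ### One-dimensional regularized integrals -/

/-- The integrand of the one-dimensional regularized integral of `φ`, where `κ` is minus the slope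
of `φ` at the origin. -/
noncomputable def regDensity (φ : ℝ → ℝ) (κ s : ℝ) : ℝ :=
  (φ s - φ 0 + (Set.Iio (1 : ℝ)).indicator (fun s => κ * s) s) / s ^ 2

/-- The one-dimensional regularized integral of `φ`. -/
noncomputable def regIntegral (φ : ℝ → ℝ) (κ : ℝ) : ℝ := ∫ s in Set.Ioi 0, regDensity φ κ s

/-- The source of every log a in the energies: moving the cut-off of the linear term from 1 to a
costs the integral of 1/s between them. -/
theorem integral_log_cutoff {a : ℝ} (ha : 0 < a) :
    IntegrableOn (fun s : ℝ => ((Set.Iio a).indicator 1 s - (Set.Iio (1 : ℝ)).indicator 1 s) * s⁻¹)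
      (Set.Ioi 0) ∧
    ∫ s in Set.Ioi (0 : ℝ), ((Set.Iio a).indicator 1 s - (Set.Iio (1 : ℝ)).indicator 1 s) * s⁻¹ =
      Real.log a := by
  have h1 : ∀ x y : ℝ, 0 < x → 0 < y → IntegrableOn (fun s : ℝ => s⁻¹) (Set.Ico x y) := by
    intro x y hx hy
    refine (ContinuousOn.integrableOn_Icc ?_).mono_set Set.Ico_subset_Icc_self
    exact continuousOn_id.inv₀ fun z hz => (hx.trans_le hz.1).ne'
  have heq : Set.EqOn
      (fun s : ℝ => ((Set.Iio a).indicator 1 s - (Set.Iio (1 : ℝ)).indicator 1 s) * s⁻¹)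
      (fun s => (Set.Ico 1 a).indicator (fun s => s⁻¹) s - (Set.Ico a 1).indicator (fun s => s⁻¹) s)
      (Set.Ioi 0) := by
    intro s _
    by_cases h1 : s < a <;> by_cases h2 : s < 1 <;>
      simp [h1, h2, not_le.2, not_lt.1, Set.indicator]
  have i1 := ((h1 1 a one_pos ha).integrable_indicator measurableSet_Ico).integrableOn (s := Set.Ioi 0)
  have i2 := ((h1 a 1 ha one_pos).integrable_indicator measurableSet_Ico).integrableOn (s := Set.Ioi 0)
  refine ⟨(integrableOn_congr_fun heq measurableSet_Ioi).2 (i1.sub i2), ?_⟩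
  rw [setIntegral_congr_fun measurableSet_Ioi heq, integral_sub i1 i2,
    setIntegral_indicator measurableSet_Ico, setIntegral_indicator measurableSet_Ico,
    Set.inter_eq_self_of_subset_right
      (show Set.Ico 1 a ⊆ Set.Ioi 0 from fun s hs => one_pos.trans_le hs.1),
    Set.inter_eq_self_of_subset_right
      (show Set.Ico a 1 ⊆ Set.Ioi 0 from fun s hs => ha.trans_le hs.1),
    integral_Ico_eq_integral_Ioc, integral_Ico_eq_integral_Ioc]
  change ∫ s in (1 : ℝ)..a, s⁻¹ = _
  rw [integral_inv_of_pos one_pos ha, div_one]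

/-- Scaling of the regularized integral. -/
theorem regIntegral_scale {φ : ℝ → ℝ} {κ : ℝ} (h : IntegrableOn (regDensity φ κ) (Set.Ioi 0))
    {a : ℝ} (ha : 0 < a) :
    IntegrableOn (regDensity (fun s => φ (a⁻¹ * s)) (κ * a⁻¹)) (Set.Ioi 0) ∧
    regIntegral (fun s => φ (a⁻¹ * s)) (κ * a⁻¹) = a⁻¹ * (regIntegral φ κ - κ * Real.log a) := by
  obtain ⟨c1, c2⟩ := integral_log_cutoff (inv_pos.2 ha)
  have heq : Set.EqOn (fun s => regDensity (fun s => φ (a⁻¹ * s)) (κ * a⁻¹) (a * s))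
      (fun s => (a⁻¹) ^ 2 * (regDensity φ κ s + κ * (((Set.Iio a⁻¹).indicator 1 s -
        (Set.Iio (1 : ℝ)).indicator 1 s) * s⁻¹))) (Set.Ioi 0) := by
    intro s hs
    have hs : 0 < s := hs
    have e1 : a⁻¹ * (a * s) = s := by field_simp
    have e2 : a * s < 1 ↔ s < a⁻¹ := by rw [lt_inv_comm₀ hs ha, ← one_div, lt_div_iff₀ hs]
    simp only [regDensity, e1, mul_zero, Set.indicator, Set.mem_Iio, e2, Pi.one_apply]
    by_cases h1 : s < a⁻¹ <;> by_cases h2 : s < 1 <;> simp only [h1, h2, if_true, if_false] <;>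
      field_simp <;> ring
  have hint : IntegrableOn (fun s => (a⁻¹) ^ 2 * (regDensity φ κ s +
      κ * (((Set.Iio a⁻¹).indicator 1 s - (Set.Iio (1 : ℝ)).indicator 1 s) * s⁻¹))) (Set.Ioi 0) :=
    (h.add (c1.const_mul κ)).const_mul _
  have hint' := (integrableOn_congr_fun heq measurableSet_Ioi).2 hint
  refine ⟨?_, ?_⟩
  · rw [integrableOn_Ioi_comp_mul_left_iff _ _ ha, mul_zero] at hint'
    exact hint'
  · have h2 := integral_comp_mul_left_Ioi (regDensity (fun s => φ (a⁻¹ * s)) (κ * a⁻¹)) 0 ha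
    rw [mul_zero, setIntegral_congr_fun measurableSet_Ioi heq, integral_const_mul,
      integral_add h (c1.const_mul κ), integral_const_mul, c2, Real.log_inv, smul_eq_mul] at h2
    unfold regIntegral
    rw [← mul_right_inj' (inv_ne_zero ha.ne'), ← h2]
    ring

theorem regDensity_const_mul (φ : ℝ → ℝ) (κ c s : ℝ) :
    regDensity (fun s => c * φ s) (c * κ) s = c * regDensity φ κ s := by
  unfold regDensity Set.indicator
  split_ifs <;> ring

theorem regIntegral_const_mul (φ : ℝ → ℝ) (κ c : ℝ) :
    regIntegral (fun s => c * φ s) (c * κ) = c * regIntegral φ κ := by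
  simp only [regIntegral, regDensity_const_mul, integral_const_mul]

theorem integral_inv_sq_Ioi {a : ℝ} (ha : 0 < a) :
    IntegrableOn (fun s : ℝ => (s ^ 2)⁻¹) (Set.Ioi a) ∧ ∫ s in Set.Ioi a, (s ^ 2)⁻¹ = a⁻¹ := by
  have h : Set.EqOn (fun s : ℝ => s ^ (-2 : ℝ)) (fun s => (s ^ 2)⁻¹) (Set.Ioi a) := by
    intro s hs
    have hs : 0 < s := ha.trans hs
    simp only
    rw [Real.rpow_neg hs.le, Real.rpow_two]
  constructor
  · exact (integrableOn_congr_fun h measurableSet_Ioi).1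
      (integrableOn_Ioi_rpow_of_lt (by norm_num) ha)
  · rw [← setIntegral_congr_fun measurableSet_Ioi h, integral_Ioi_rpow_of_lt (by norm_num) ha]
    norm_num
    rw [Real.rpow_neg ha.le, Real.rpow_one]

/-- The hinge is the overlap profile of one isolated stripe; rescaled, it is the comparison function
for small volume fraction. -/
theorem regIntegral_hinge :
    IntegrableOn (regDensity (fun s => max (1 - s) 0) 1) (Set.Ioi 0) ∧
    regIntegral (fun s => max (1 - s) 0) 1 = -1 := by
  obtain ⟨c1, c2⟩ := integral_inv_sq_Ioi one_pos
  have heq : Set.EqOn (regDensity (fun s => max (1 - s) 0) 1)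
      (fun s => (Set.Ici (1 : ℝ)).indicator (fun s => -(s ^ 2)⁻¹) s) (Set.Ioi 0) := by
    intro s hs
    rcases lt_or_ge s 1 with h | h
    · simp [regDensity, h, h.le]
    · simp [regDensity, h, not_lt.2 h, neg_div]
  have i1 : IntegrableOn (fun s : ℝ => -(s ^ 2)⁻¹) (Set.Ici 1) := by
    rw [integrableOn_Ici_iff_integrableOn_Ioi]
    exact c1.neg
  refine ⟨(integrableOn_congr_fun heq measurableSet_Ioi).2
    (i1.integrable_indicator measurableSet_Ici).integrableOn, ?_⟩
  rw [regIntegral, setIntegral_congr_fun measurableSet_Ioi heq,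
    setIntegral_indicator measurableSet_Ici,
    Set.inter_eq_self_of_subset_right
      (Set.Ici_subset_Ioi.2 (one_pos : (0 : ℝ) < 1)),
    integral_Ici_eq_integral_Ioi,
    integral_neg, c2, inv_one]

/-! ### Powers of the height of a spherical cap -/

/-- The `k`-th power of the radius of the slice of the unit ball at height `t`. -/
noncomputable def capPow (k : ℕ) (t : ℝ) : ℝ := √(1 - t ^ 2) ^ k

/-- The integral of `capPow k` over `[s, 1]`. -/
noncomputable def capTail (k : ℕ) (s : ℝ) : ℝ := ∫ t in s..1, capPow k t

/-- The integral over `[0, 1]` of `(1 - capPow k s) / s`. -/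
noncomputable def capDefect (k : ℕ) : ℝ := ∫ s in (0 : ℝ)..1, (1 - capPow k s) * s⁻¹

theorem continuous_capPow (k : ℕ) : Continuous (capPow k) := by
  unfold capPow
  fun_prop

theorem capPow_nonneg (k : ℕ) (t : ℝ) : 0 ≤ capPow k t := by
  unfold capPow
  positivity

theorem capPow_le_one (k : ℕ) (t : ℝ) : capPow k t ≤ 1 := by
  refine pow_le_one₀ (Real.sqrt_nonneg _) ?_
  refine Real.sqrt_le_one.2 ?_
  nlinarith [sq_nonneg t]

theorem capPow_of_one_le {k : ℕ} (hk : k ≠ 0) {t : ℝ} (ht : 1 ≤ t) : capPow k t = 0 := by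
  rw [capPow, Real.sqrt_eq_zero_of_nonpos (by nlinarith), zero_pow hk]

/-- Bernoulli's inequality for the k-th power of √(1 - t²) ≥ 1 - t². The quadratic bound removes the
singularity of (1 - `capPow k s`)/s at 0. -/
theorem one_sub_capPow_le (k : ℕ) (t : ℝ) : 1 - capPow k t ≤ k * t ^ 2 := by
  have h1 : -t ^ 2 ≤ √(1 - t ^ 2) - 1 := by
    rcases le_total (t ^ 2) 1 with h | h
    · have : 1 - t ^ 2 ≤ √(1 - t ^ 2) := by
        apply Real.le_sqrt_of_sq_le
        nlinarith [sq_nonneg t]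
      linarith
    · linarith [Real.sqrt_nonneg (1 - t ^ 2)]
  have h2 := one_add_mul_le_pow (a := √(1 - t ^ 2) - 1)
    (by linarith [Real.sqrt_nonneg (1 - t ^ 2)]) k
  rw [add_sub_cancel] at h2
  unfold capPow
  have : (k : ℝ) * -t ^ 2 ≤ k * (√(1 - t ^ 2) - 1) := by gcongr
  linarith

/-- A function that is continuous off the origin and dominated by `c * |s|` is continuous. -/
theorem continuous_of_abs_le {f : ℝ → ℝ} {c : ℝ} (hf : ∀ s, |f s| ≤ c * |s|)
    (hc : ∀ s, s ≠ 0 → ContinuousAt f s) : Continuous f := by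
  refine continuous_iff_continuousAt.2 fun s => ?_
  rcases eq_or_ne s 0 with rfl | h
  · have h0 : f 0 = 0 := by simpa using hf 0
    rw [ContinuousAt, h0]
    refine squeeze_zero_norm (a := fun s => c * |s|) hf ?_
    have : Continuous fun s : ℝ => c * |s| := by fun_prop
    simpa using this.tendsto 0
  · exact hc s h

theorem continuous_capDefect_density (k : ℕ) : Continuous fun s => (1 - capPow k s) * s⁻¹ := by
  refine continuous_of_abs_le (c := k) (fun s => ?_) fun s hs => ?_
  · rw [abs_mul, abs_inv, abs_of_nonneg (sub_nonneg.2 (capPow_le_one k s))]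
    rcases eq_or_ne s 0 with rfl | h
    · simp
    · rw [mul_inv_le_iff₀ (abs_pos.2 h), mul_assoc, abs_mul_abs_self, ← pow_two]
      exact one_sub_capPow_le k s
  · exact ((continuous_const.sub (continuous_capPow k)).continuousAt).mul (continuousAt_inv₀ hs)

theorem intervalIntegrable_capPow (k : ℕ) (a b : ℝ) : IntervalIntegrable (capPow k) volume a b :=
  (continuous_capPow k).intervalIntegrable a b

theorem capTail_zero_sub (k : ℕ) (s : ℝ) : capTail k 0 - capTail k s = ∫ t in (0 : ℝ)..s, capPow k t := by
  have := intervalIntegral.integral_add_adjacent_intervals (intervalIntegrable_capPow k 0 s)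
    (intervalIntegrable_capPow k s 1)
  unfold capTail
  linarith

theorem capTail_of_one_le {k : ℕ} (hk : k ≠ 0) {s : ℝ} (hs : 1 ≤ s) : capTail k s = 0 := by
  unfold capTail
  rw [intervalIntegral.integral_symm, intervalIntegral.integral_congr (g := fun _ => 0)]
  · simp
  · intro t ht
    rw [Set.uIcc_of_le hs] at ht
    exact capPow_of_one_le hk ht.1

theorem continuous_capTail (k : ℕ) : Continuous (capTail k) := by
  have : capTail k = fun s => capTail k 0 - ∫ t in (0 : ℝ)..s, capPow k t := by
    ext s
    rw [← capTail_zero_sub]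
    ring
  rw [this]
  exact continuous_const.sub
    (intervalIntegral.continuous_primitive (fun a b => intervalIntegrable_capPow k a b) 0)

theorem capTail_nonneg {k : ℕ} (hk : k ≠ 0) (s : ℝ) : 0 ≤ capTail k s := by
  rcases le_total s 1 with h | h
  · exact intervalIntegral.integral_nonneg h fun t _ => capPow_nonneg k t
  · rw [capTail_of_one_le hk h]

theorem capTail_antitone {k : ℕ} : Antitone (capTail k) := by
  intro s t hst
  have : capTail k s - capTail k t = ∫ x in s..t, capPow k x := by
    have := intervalIntegral.integral_add_adjacent_intervals (intervalIntegrable_capPow k s t)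
      (intervalIntegrable_capPow k t 1)
    unfold capTail
    linarith
  have h := intervalIntegral.integral_nonneg (μ := volume) hst fun x _ => capPow_nonneg k x
  linarith

theorem abs_integral_one_sub_capPow_le (k : ℕ) (s : ℝ) :
    |∫ t in (0 : ℝ)..s, (1 - capPow k t)| ≤ k * |s| ^ 3 := by
  have h := intervalIntegral.norm_integral_le_of_norm_le_const (a := 0) (b := s)
    (f := fun t => 1 - capPow k t) (C := k * |s| ^ 2) fun t ht => by
      rw [Real.norm_of_nonneg (sub_nonneg.2 (capPow_le_one k t))]
      refine (one_sub_capPow_le k t).trans ?_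
      have : |t| ≤ |s| := by
        rcases le_total 0 s with h | h
        · rw [Set.uIoc_of_le h] at ht
          rw [abs_of_pos ht.1, abs_of_nonneg h]
          exact ht.2
        · rw [Set.uIoc_of_ge h] at ht
          rw [abs_of_nonpos ht.2, abs_of_nonpos h]
          linarith [ht.1]
      rw [← sq_abs t]
      gcongr
  rw [sub_zero, Real.norm_eq_abs] at h
  linarith [h]

/-- On (0, 1) the numerator is D(s), the integral of 1 - `capPow k` over [0, s], which is cubically
small. Integrating the derivative of D(s)/s turns the integral of D/s² into `capDefect k` - D(1).
Since D(1) = 1 - `capTail k 0`, the tail over s ≥ 1, equal to -`capTail k 0`, cancels the remaining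
constant. -/
theorem regIntegral_capTail {k : ℕ} (hk : k ≠ 0) :
    IntegrableOn (regDensity (capTail k) 1) (Set.Ioi 0) ∧
    regIntegral (capTail k) 1 = capDefect k - 1 := by
  obtain ⟨c1, c2⟩ := integral_inv_sq_Ioi one_pos
  set D : ℝ → ℝ := fun s => ∫ t in (0 : ℝ)..s, (1 - capPow k t) with hD
  have hDeq : ∀ s, D s = s - (capTail k 0 - capTail k s) := fun s => by
    rw [capTail_zero_sub, hD]
    simp only
    rw [intervalIntegral.integral_sub (by simp) (intervalIntegrable_capPow k _ _)]
    simp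
  have hDb : ∀ s, |D s| ≤ k * |s| ^ 3 := abs_integral_one_sub_capPow_le k
  have hDderiv : ∀ s, HasDerivAt D (1 - capPow k s) s := fun s =>
    intervalIntegral.integral_hasDerivAt_right
      ((continuous_const.sub (continuous_capPow k)).intervalIntegrable _ _)
      ((continuous_const.sub (continuous_capPow k)).stronglyMeasurableAtFilter _ _)
      (continuous_const.sub (continuous_capPow k)).continuousAt
  have hDcont : Continuous D := continuous_iff_continuousAt.2 fun s => (hDderiv s).continuousAt
  have hcont2 : Continuous fun s => D s * (s ^ 2)⁻¹ := by
    refine continuous_of_abs_le (c := k) (fun s => ?_) fun s hs => ?_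
    · rcases eq_or_ne s 0 with rfl | h
      · simp
      · rw [abs_mul, abs_inv, abs_pow, mul_inv_le_iff₀ (pow_pos (abs_pos.2 h) 2)]
        calc _ ≤ _ := hDb s
          _ = _ := by ring
    · exact hDcont.continuousAt.mul ((continuousAt_id.pow 2).inv₀ (pow_ne_zero 2 hs))
  have heq : Set.EqOn (regDensity (capTail k) 1) (fun s =>
      (Set.Iio (1 : ℝ)).indicator (fun s => D s * (s ^ 2)⁻¹) s +
      (Set.Ici (1 : ℝ)).indicator (fun s => -capTail k 0 * (s ^ 2)⁻¹) s) (Set.Ioi 0) := by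
    intro s hs
    rcases lt_or_ge s 1 with h | h
    · simp only [regDensity, Set.indicator, Set.mem_Iio, h, Set.mem_Ici, not_le.2 h, if_true,
        if_false, hDeq]
      rw [div_eq_mul_inv]
      ring
    · simp only [regDensity, Set.indicator, Set.mem_Iio, h, Set.mem_Ici, not_lt.2 h, if_true,
        if_false, capTail_of_one_le hk h]
      rw [div_eq_mul_inv]
      ring
  have i1 : IntegrableOn ((Set.Iio (1 : ℝ)).indicator (fun s => D s * (s ^ 2)⁻¹)) (Set.Ioi 0) := by
    rw [IntegrableOn, integrable_indicator_iff measurableSet_Iio, IntegrableOn,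
      Measure.restrict_restrict measurableSet_Iio, Set.inter_comm, Set.Ioi_inter_Iio]
    exact (hcont2.integrableOn_Icc (a := 0) (b := 1)).mono_set Set.Ioo_subset_Icc_self
  have i2 : IntegrableOn ((Set.Ici (1 : ℝ)).indicator (fun s => -capTail k 0 * (s ^ 2)⁻¹))
      (Set.Ioi 0) := by
    refine (IntegrableOn.integrable_indicator ?_ measurableSet_Ici).integrableOn
    rw [integrableOn_Ici_iff_integrableOn_Ioi]
    exact c1.const_mul _
  refine ⟨(integrableOn_congr_fun heq measurableSet_Ioi).2 (i1.add i2), ?_⟩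
  rw [regIntegral, setIntegral_congr_fun measurableSet_Ioi heq, integral_add i1 i2,
    setIntegral_indicator measurableSet_Iio, setIntegral_indicator measurableSet_Ici,
    Set.inter_eq_self_of_subset_right (Set.Ici_subset_Ioi.2 (one_pos : (0 : ℝ) < 1)),
    Set.Ioi_inter_Iio, integral_Ici_eq_integral_Ioi, ← integral_Ioc_eq_integral_Ioo,
    integral_const_mul, c2, ← intervalIntegral.integral_of_le zero_le_one]
  -- The lower boundary term D 0 * 0⁻¹ is harmless because inversion sends 0 to 0, which is also the
  -- limit of D(s)/s.
  have hftc : ∫ s in (0 : ℝ)..1, ((1 - capPow k s) * s⁻¹ - D s * (s ^ 2)⁻¹) =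
      D 1 * 1⁻¹ - D 0 * 0⁻¹ := by
    refine intervalIntegral.integral_eq_sub_of_hasDerivAt_of_le zero_le_one
      (f := fun s => D s * s⁻¹) (Continuous.continuousOn ?_) (fun s hs => ?_)
      ((continuous_capDefect_density k).sub hcont2 |>.intervalIntegrable _ _)
    · have : (fun s => D s * s⁻¹) = fun s => D s * (s ^ 2)⁻¹ * s := by
        ext s
        rcases eq_or_ne s 0 with rfl | h
        · simp
        · field_simp
      rw [this]
      exact hcont2.mul continuous_id
    · have := (hDderiv s).mul (hasDerivAt_inv hs.1.ne')
      refine this.congr_deriv ?_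
      ring
  rw [intervalIntegral.integral_sub ((continuous_capDefect_density k).intervalIntegrable _ _)
    (hcont2.intervalIntegrable _ _), hDeq 1, capTail_of_one_le hk le_rfl, inv_zero, mul_zero] at hftc
  change capDefect k - _ = _ at hftc
  linarith

theorem hasDerivAt_sqrt_one_sub_sq {s : ℝ} (hs : s ∈ Set.Ioo (0 : ℝ) 1) :
    HasDerivAt (fun s : ℝ => √(1 - s ^ 2)) (-s / √(1 - s ^ 2)) s := by
  have h1 : 0 < 1 - s ^ 2 := by nlinarith [hs.1, hs.2]
  have h2 : HasDerivAt (fun s : ℝ => 1 - s ^ 2) (-(2 * s)) s := by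
    simpa using (hasDerivAt_pow 2 s).const_sub 1
  refine (h2.sqrt h1.ne').congr_deriv ?_
  rw [neg_div, neg_div, mul_div_mul_left _ _ two_ne_zero]

theorem capDefect_one : capDefect 1 = 1 - Real.log 2 := by
  have h := intervalIntegral.integral_eq_sub_of_hasDerivAt_of_le (a := 0) (b := 1) zero_le_one
    -- Primitive of (1 - √(1 - s²))/s, free of a singularity at 0.
    (f := fun s => Real.log (1 + √(1 - s ^ 2)) - √(1 - s ^ 2))
    (f' := fun s => (1 - capPow 1 s) * s⁻¹) (Continuous.continuousOn ?_) (fun s hs => ?_)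
    ((continuous_capDefect_density 1).intervalIntegrable _ _)
  · rw [capDefect, h]
    norm_num
  · refine Continuous.sub (Continuous.log (by fun_prop) fun s => ?_) (by fun_prop)
    have := Real.sqrt_nonneg (1 - s ^ 2)
    positivity
  · have h1 : 0 < 1 - s ^ 2 := by nlinarith [hs.1, hs.2]
    have h2 := hasDerivAt_sqrt_one_sub_sq hs
    have h3 := Real.sqrt_pos.2 h1
    refine (((h2.const_add 1).log (by positivity)).sub h2).congr_deriv ?_
    have h4 := Real.sq_sqrt h1.le
    have h0 := hs.1.ne'
    rw [capPow, pow_one]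
    generalize √(1 - s ^ 2) = c at *
    field_simp
    linear_combination c * h4

/-- With r = √(1 - s²) one has r^k - r^(k+2) = s² r^k, so the difference is the integral of s r^k
over [0, 1], which has the primitive -r^(k+2)/(k + 2). -/
theorem capDefect_add_two (k : ℕ) : capDefect (k + 2) = capDefect k + 1 / (k + 2) := by
  have h := intervalIntegral.integral_eq_sub_of_hasDerivAt_of_le (a := 0) (b := 1) zero_le_one
    (f := fun s => -(√(1 - s ^ 2) ^ (k + 2)) / (k + 2))
    (f' := fun s => s * capPow k s) (Continuous.continuousOn ?_) (fun s hs => ?_)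
    ((continuous_id.mul (continuous_capPow k)).intervalIntegrable _ _)
  · have h2 : ∫ s in (0 : ℝ)..1, s * capPow k s = capDefect (k + 2) - capDefect k := by
      unfold capDefect
      rw [← intervalIntegral.integral_sub ((continuous_capDefect_density _).intervalIntegrable _ _)
        ((continuous_capDefect_density _).intervalIntegrable _ _)]
      refine intervalIntegral.integral_congr fun s hs => ?_
      rw [Set.uIcc_of_le zero_le_one] at hs
      have h1 : 0 ≤ 1 - s ^ 2 := by nlinarith [hs.1, hs.2]
      have h4 := Real.sq_sqrt h1
      rcases eq_or_ne s 0 with rfl | h0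
      · simp
      · simp only [capPow, pow_add, h4]
        field_simp
        ring
    rw [h2] at h
    simp only [one_pow, sub_self, Real.sqrt_zero] at h
    norm_num at h
    rw [neg_div, neg_neg] at h
    linarith
  · fun_prop
  · have h1 : 0 < 1 - s ^ 2 := by nlinarith [hs.1, hs.2]
    have h3 := Real.sqrt_pos.2 h1
    refine (((hasDerivAt_sqrt_one_sub_sq hs).pow (k + 2)).neg.div_const _).congr_deriv ?_
    rw [capPow]
    push_cast
    have : (k : ℝ) + 2 ≠ 0 := by positivity
    field_simp
    ring

theorem capDefect_zero : capDefect 0 = 0 := by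
  simp [capDefect, capPow]

/-- The strict inequality that makes balls win at small volume fraction, by induction in steps of
two. The base cases are 2 - 2 log 2 < log 2 and 1 < log 3. In the step the left side grows by 2/(k +
3) and the right side by log(1 + x) with x = 2/(k + 2), and log(1 + x) ≥ 2x/(x + 2) = 2/(k + 3). -/
theorem two_mul_capDefect_lt_log : ∀ k : ℕ, 2 * capDefect (k + 1) < Real.log (k + 1 + 1)
  | 0 => by
    rw [zero_add, capDefect_one]
    norm_num
    linarith [Real.log_two_gt_d9]
  | 1 => by
    have h := capDefect_add_two 0
    rw [capDefect_zero] at h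
    rw [show 1 + 1 = 0 + 2 from rfl, h, Real.lt_log_iff_exp_lt (by positivity)]
    have := Real.exp_one_lt_d9
    norm_num
    linarith
  | k + 2 => by
    have ih := two_mul_capDefect_lt_log k
    have h := capDefect_add_two (k + 1)
    rw [show k + 2 + 1 = k + 1 + 2 from rfl, h]
    have h1 := Real.le_log_one_add_of_nonneg (x := 2 / ((k : ℝ) + 1 + 1)) (by positivity)
    have h2 : 1 + 2 / ((k : ℝ) + 1 + 1) = (k + 1 + 1 + 2) / (k + 1 + 1) := by field_simp
    rw [h2, Real.log_div (by positivity) (by positivity)] at h1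
    have h3 : 2 * (2 / ((k : ℝ) + 1 + 1)) / (2 / (k + 1 + 1) + 2) = 2 * (1 / (k + 1 + 2)) := by
      field_simp
      ring
    rw [h3] at h1
    push_cast
    rw [show (k : ℝ) + 2 + 1 + 1 = k + 1 + 1 + 2 by ring]
    linarith

/-! ### Slicing Euclidean space orthogonally to the first axis -/

/-- The volume of the unit ball. -/
noncomputable def ballVol (k : ℕ) : ℝ := volume.real (Metric.ball (0 : Space k) 1)

theorem ballVol_pos (k : ℕ) : 0 < ballVol k :=
  ENNReal.toReal_pos (Metric.measure_ball_pos _ _ one_pos).ne' measure_ball_lt_top.ne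

theorem ballVol_one : ballVol 1 = 2 := by
  rw [ballVol, measureReal_def, EuclideanSpace.volume_ball]
  simp only [Fintype.card_fin, ENNReal.ofReal_one, one_mul, pow_one, Nat.cast_one]
  rw [Real.Gamma_add_one (by norm_num), Real.Gamma_one_half_eq, ENNReal.toReal_ofReal (by positivity)]
  have := Real.sqrt_ne_zero'.2 Real.pi_pos
  field_simp

theorem ballVol_two : ballVol 2 = Real.pi := by
  rw [ballVol, measureReal_def, EuclideanSpace.volume_ball_fin_two]
  simp [Real.pi_pos.le]

theorem nontrivial_space {k : ℕ} (hk : k ≠ 0) : Nontrivial (Space k) := by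
  obtain ⟨m, rfl⟩ := Nat.exists_eq_succ_of_ne_zero hk
  infer_instance

theorem volume_real_ball {k : ℕ} (hk : k ≠ 0) (x : Space k) {r : ℝ} (hr : 0 ≤ r) :
    volume.real (Metric.ball x r) = r ^ k * ballVol k := by
  have := nontrivial_space hk
  rw [measureReal_def, Measure.addHaar_ball _ _ hr, ENNReal.toReal_mul,
    ENNReal.toReal_ofReal (by positivity), finrank_euclideanSpace_fin]
  rfl

/-- The coordinates of a vector other than the first one. -/
noncomputable def tailVec {k : ℕ} (x : Space (k + 1)) : Space k := WithLp.toLp 2 fun i => x i.succ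

theorem norm_sq_eq_tailVec {k : ℕ} (x : Space (k + 1)) : ‖x‖ ^ 2 = x 0 ^ 2 + ‖tailVec x‖ ^ 2 := by
  simp [EuclideanSpace.norm_sq_eq, Fin.sum_univ_succ, tailVec]

theorem norm_eq_tailVec {k : ℕ} (x : Space (k + 1)) : ‖x‖ = √(x 0 ^ 2 + ‖tailVec x‖ ^ 2) := by
  rw [← norm_sq_eq_tailVec, Real.sqrt_sq (norm_nonneg x)]

theorem measurePreserving_slice (k : ℕ) :
    MeasurePreserving (fun x : Space (k + 1) => (x 0, tailVec x)) volume
      ((volume : Measure ℝ).prod (volume : Measure (Space k))) := by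
  have h1 := (volume_preserving_piFinSuccAbove (fun _ : Fin (k + 1) => ℝ) 0).comp
    (PiLp.volume_preserving_ofLp (Fin (k + 1)))
  have h2 := ((MeasurePreserving.id (volume : Measure ℝ)).prod (PiLp.volume_preserving_toLp (Fin k))).comp h1
  exact h2

theorem integral_slice {k : ℕ} {g : ℝ × Space k → ℝ}
    (hg : Integrable g ((volume : Measure ℝ).prod (volume : Measure (Space k)))) :
    Integrable (fun x : Space (k + 1) => g (x 0, tailVec x)) ∧
    ∫ x : Space (k + 1), g (x 0, tailVec x) = ∫ s, ∫ y, g (s, y) := by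
  have hmp := measurePreserving_slice k
  refine ⟨(hmp.integrable_comp hg.aestronglyMeasurable).2 hg, ?_⟩
  rw [← integral_prod _ hg, ← hmp.map_eq, integral_map hmp.measurable.aemeasurable]
  rw [hmp.map_eq]
  exact hg.aestronglyMeasurable

theorem measurable_sliceKernel (k n : ℕ) :
    Measurable fun p : ℝ × Space k => (√(p.1 ^ 2 + ‖p.2‖ ^ 2) ^ n)⁻¹ := by
  fun_prop

/-- In polar coordinates of the slice at height s the kernel has this closed primitive, so integrals
over the whole slice and over its part inside the unit ball are both elementary. -/
theorem hasDerivAt_sliceKernel {k : ℕ} (hk : k ≠ 0) {s : ℝ} (hs : s ≠ 0) (r : ℝ) :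
    HasDerivAt (fun r => (r / √(s ^ 2 + r ^ 2)) ^ k / (k * s ^ 2))
      (r ^ (k - 1) * (√(s ^ 2 + r ^ 2) ^ (k + 2))⁻¹) r := by
  have h1 : 0 < s ^ 2 + r ^ 2 := by positivity
  have h2 : HasDerivAt (fun r : ℝ => s ^ 2 + r ^ 2) (2 * r) r := by
    simpa using (hasDerivAt_pow 2 r).const_add (s ^ 2)
  have h3 := Real.sqrt_pos.2 h1
  have h4 := Real.sq_sqrt h1.le
  refine ((((hasDerivAt_id r).div (h2.sqrt h1.ne') h3.ne').pow k).div_const _).congr_deriv ?_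
  simp only [id, Pi.div_apply]
  generalize √(s ^ 2 + r ^ 2) = c at *
  obtain ⟨m, rfl⟩ : ∃ m, k = m + 1 := Nat.exists_eq_succ_of_ne_zero hk
  have : ((m + 1 : ℕ) : ℝ) ≠ 0 := by positivity
  have h5 : 1 * c - r * (2 * r / (2 * c)) = s ^ 2 / c := by
    field_simp
    linear_combination h4
  rw [h5, Nat.add_sub_cancel, div_pow]
  field_simp
  ring

/-- This reduces the interaction of layered configurations to the weight s^(-2) on the line. -/
theorem integral_sliceKernel {k : ℕ} (hk : k ≠ 0) {s : ℝ} (hs : s ≠ 0) :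
    Integrable (fun y : Space k => (√(s ^ 2 + ‖y‖ ^ 2) ^ (k + 2))⁻¹) ∧
    ∫ y : Space k, (√(s ^ 2 + ‖y‖ ^ 2) ^ (k + 2))⁻¹ = ballVol k / s ^ 2 := by
  have := nontrivial_space hk
  have hcont : ContinuousWithinAt (fun r => (r / √(s ^ 2 + r ^ 2)) ^ k / (k * s ^ 2)) (Set.Ici 0) 0 :=
    (hasDerivAt_sliceKernel hk hs 0).continuousAt.continuousWithinAt
  have hlim : Tendsto (fun r : ℝ => (r / √(s ^ 2 + r ^ 2)) ^ k / (k * s ^ 2)) atTop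
      (𝓝 (1 / (k * s ^ 2))) := by
    have h0 : Tendsto (fun r : ℝ => (1 / √(s ^ 2 * (r⁻¹) ^ 2 + 1)) ^ k / (k * s ^ 2)) atTop
        (𝓝 ((1 / √(s ^ 2 * 0 ^ 2 + 1)) ^ k / (k * s ^ 2))) := by
      refine Tendsto.div_const (Tendsto.pow (Tendsto.div tendsto_const_nhds ?_ (by simp)) _) _
      exact (((tendsto_inv_atTop_zero.pow 2).const_mul _).add_const 1).sqrt
    have e : (1 / √(s ^ 2 * (0 : ℝ) ^ 2 + 1)) ^ k / (k * s ^ 2) = 1 / (k * s ^ 2) := by simp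
    rw [e] at h0
    refine h0.congr' ?_
    filter_upwards [eventually_gt_atTop 0] with r hr
    congr 2
    have : s ^ 2 + r ^ 2 = (s ^ 2 * r⁻¹ ^ 2 + 1) * r ^ 2 := by field_simp
    rw [this, Real.sqrt_mul (by positivity), Real.sqrt_sq hr.le]
    have := Real.sqrt_pos.2 (show 0 < s ^ 2 * r⁻¹ ^ 2 + 1 by positivity)
    field_simp
  have hnn : ∀ r ∈ Set.Ioi (0 : ℝ), 0 ≤ r ^ (k - 1) * (√(s ^ 2 + r ^ 2) ^ (k + 2))⁻¹ := by
    intro r hr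
    have : (0 : ℝ) < r := hr
    positivity
  constructor
  · refine (integrable_fun_norm_addHaar volume
      (f := fun r : ℝ => (√(s ^ 2 + r ^ 2) ^ (k + 2))⁻¹)).2 ?_
    simp only [finrank_euclideanSpace_fin, smul_eq_mul]
    exact integrableOn_Ioi_deriv_of_nonneg hcont
      (fun r _ => hasDerivAt_sliceKernel hk hs r) hnn hlim
  · have h := integral_fun_norm_addHaar (volume : Measure (Space k))
      (fun r : ℝ => (√(s ^ 2 + r ^ 2) ^ (k + 2))⁻¹)
    simp only [finrank_euclideanSpace_fin, smul_eq_mul, nsmul_eq_mul] at h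
    rw [h, integral_Ioi_of_hasDerivAt_of_nonneg hcont
      (fun r _ => hasDerivAt_sliceKernel hk hs r) hnn hlim]
    have : (k : ℝ) ≠ 0 := by exact_mod_cast hk
    change k * (ballVol k * _) = _
    rw [zero_div, zero_pow hk, zero_div, sub_zero]
    field_simp

theorem setIntegral_sliceKernel {k : ℕ} (hk : k ≠ 0) {s : ℝ} (hs : s ≠ 0) :
    ∫ y : Space k, (Set.Iio (1 : ℝ)).indicator (fun r => (r ^ (k + 2))⁻¹) √(s ^ 2 + ‖y‖ ^ 2) =
      ballVol k * capPow k s / s ^ 2 := by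
  have := nontrivial_space hk
  have h := integral_fun_norm_addHaar (volume : Measure (Space k))
      (fun r : ℝ => (Set.Iio (1 : ℝ)).indicator (fun r => (r ^ (k + 2))⁻¹) √(s ^ 2 + r ^ 2))
  simp only [finrank_euclideanSpace_fin, smul_eq_mul, nsmul_eq_mul] at h
  rw [h]
  set T := √(1 - s ^ 2) with hT
  have hT0 : 0 ≤ T := Real.sqrt_nonneg _
  have heq : Set.EqOn (fun r : ℝ => r ^ (k - 1) *
      (Set.Iio (1 : ℝ)).indicator (fun r => (r ^ (k + 2))⁻¹) √(s ^ 2 + r ^ 2))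
      ((Set.Iio T).indicator fun r => r ^ (k - 1) * (√(s ^ 2 + r ^ 2) ^ (k + 2))⁻¹) (Set.Ioi 0) := by
    intro r hr
    have hr : 0 < r := hr
    have e : √(s ^ 2 + r ^ 2) < 1 ↔ r < T := by
      rw [hT, Real.lt_sqrt hr.le, Real.sqrt_lt' one_pos, one_pow]
      constructor <;> intro h <;> linarith
    by_cases h : r < T <;> simp [Set.indicator, e, h]
  rw [setIntegral_congr_fun measurableSet_Ioi heq, setIntegral_indicator measurableSet_Iio,
    Set.Ioi_inter_Iio, ← integral_Ioc_eq_integral_Ioo, ← intervalIntegral.integral_of_le hT0,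
    intervalIntegral.integral_eq_sub_of_hasDerivAt (fun r _ => hasDerivAt_sliceKernel hk hs r)]
  · have hk' : (k : ℝ) ≠ 0 := by exact_mod_cast hk
    change k * (ballVol k * _) = _
    -- Inside the unit ball the slice ends at radius T with s² + T² = 1. For s² ≥ 1 the square root
    -- truncates T to 0 and the quotient vanishes as well.
    have e2 : (T / √(s ^ 2 + T ^ 2)) ^ k = capPow k s := by
      rw [capPow, ← hT]
      rcases le_total (s ^ 2) 1 with h1 | h1
      · rw [hT, Real.sq_sqrt (by linarith), add_sub_cancel, Real.sqrt_one, div_one]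
      · have : T = 0 := Real.sqrt_eq_zero_of_nonpos (by linarith)
        rw [this, zero_div]
    rw [e2, zero_div, zero_pow hk, zero_div, sub_zero]
    field_simp
  · refine Continuous.intervalIntegrable ?_ _ _
    refine (continuous_pow _).mul (Continuous.inv₀ (by fun_prop) fun r => ?_)
    have := Real.sqrt_pos.2 (show 0 < s ^ 2 + r ^ 2 by positivity)
    positivity

theorem ae_ne_zero : ∀ᵐ s : ℝ, s ≠ 0 := by
  simp [ae_iff, measure_singleton]

/-- Integration of a function of the first coordinate against the kernel. -/
theorem integral_first_coord {k : ℕ} (hk : k ≠ 0) {f : ℝ → ℝ} (hf : Measurable f)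
    (hint : Integrable fun s => f s / s ^ 2) :
    Integrable (fun z : Space (k + 1) => f (z 0) * (‖z‖ ^ (k + 2))⁻¹) ∧
    ∫ z : Space (k + 1), f (z 0) * (‖z‖ ^ (k + 2))⁻¹ = ballVol k * ∫ s, f s / s ^ 2 := by
  have hg : Integrable (fun p : ℝ × Space k => f p.1 * (√(p.1 ^ 2 + ‖p.2‖ ^ 2) ^ (k + 2))⁻¹)
      ((volume : Measure ℝ).prod (volume : Measure (Space k))) := by
    have hm : Measurable fun p : ℝ × Space k => f p.1 * (√(p.1 ^ 2 + ‖p.2‖ ^ 2) ^ (k + 2))⁻¹ :=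
      (hf.comp measurable_fst).mul (measurable_sliceKernel k (k + 2))
    rw [integrable_prod_iff hm.aestronglyMeasurable]
    constructor
    · filter_upwards [ae_ne_zero] with s hs
      exact (integral_sliceKernel hk hs).1.const_mul _
    · refine (hint.norm.const_mul (ballVol k)).congr ?_
      filter_upwards [ae_ne_zero] with s hs
      simp only [norm_mul, norm_inv, norm_pow, integral_const_mul, norm_div,
        Real.norm_of_nonneg (Real.sqrt_nonneg _)]
      rw [(integral_sliceKernel hk hs).2, Real.norm_eq_abs s, sq_abs]
      ring
  obtain ⟨h1, h2⟩ := integral_slice hg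
  simp only [← norm_eq_tailVec] at h1 h2
  refine ⟨h1, ?_⟩
  rw [h2, ← integral_const_mul]
  refine integral_congr_ae ?_
  filter_upwards [ae_ne_zero] with s hs
  rw [integral_const_mul, (integral_sliceKernel hk hs).2]
  ring

/-- The effect of replacing the cut-off to the slab `|z₀| < 1` by the one to the unit ball. -/
theorem integral_cutoff_defect {k : ℕ} (hk : k ≠ 0) :
    Integrable (fun z : Space (k + 1) => |z 0| * ((Set.Iio (1 : ℝ)).indicator 1 |z 0| -
      (Set.Iio (1 : ℝ)).indicator 1 ‖z‖) * (‖z‖ ^ (k + 2))⁻¹) ∧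
    ∫ z : Space (k + 1), |z 0| * ((Set.Iio (1 : ℝ)).indicator 1 |z 0| -
      (Set.Iio (1 : ℝ)).indicator 1 ‖z‖) * (‖z‖ ^ (k + 2))⁻¹ = 2 * ballVol k * capDefect k := by
  set g : ℝ × Space k → ℝ := fun p => |p.1| * ((Set.Iio (1 : ℝ)).indicator 1 |p.1| -
      (Set.Iio (1 : ℝ)).indicator 1 √(p.1 ^ 2 + ‖p.2‖ ^ 2)) * (√(p.1 ^ 2 + ‖p.2‖ ^ 2) ^ (k + 2))⁻¹
    with hgdef
  have hind : Measurable ((Set.Iio (1 : ℝ)).indicator (1 : ℝ → ℝ)) :=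
    measurable_one.indicator measurableSet_Iio
  have hgm : Measurable g := by
    refine ((by fun_prop : Measurable fun p : ℝ × Space k => |p.1|).mul
      ((hind.comp (by fun_prop)).sub (hind.comp (by fun_prop)))).mul (measurable_sliceKernel k _)
  have hle : ∀ (s : ℝ) (y : Space k), |s| ≤ √(s ^ 2 + ‖y‖ ^ 2) := fun s y =>
    Real.abs_le_sqrt (by nlinarith [sq_nonneg ‖y‖])
  have hg0 : ∀ p, 0 ≤ g p := by
    rintro ⟨s, y⟩
    have h1 := hle s y
    refine mul_nonneg (mul_nonneg (abs_nonneg _) ?_) (by positivity)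
    by_cases h2 : √(s ^ 2 + ‖y‖ ^ 2) < 1
    · simp [Set.indicator, h2, h1.trans_lt h2]
    · simp only [Set.indicator, Set.mem_Iio, h2, if_false, sub_zero]
      split_ifs <;> simp
  have hcut : ∀ s : ℝ, s ≠ 0 → Integrable (fun y : Space k =>
      (Set.Iio (1 : ℝ)).indicator (fun r => (r ^ (k + 2))⁻¹) √(s ^ 2 + ‖y‖ ^ 2)) := by
    intro s hs
    refine (integral_sliceKernel hk hs).1.mono' ?_ (ae_of_all _ fun y => ?_)
    · refine Measurable.aestronglyMeasurable ?_
      exact (Measurable.indicator (by fun_prop) measurableSet_Iio).comp (by fun_prop)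
    · simp only [Set.indicator]
      split_ifs
      · rw [Real.norm_of_nonneg (by positivity)]
      · rw [norm_zero]
        positivity
  have hgs : ∀ (s : ℝ) (y : Space k), g (s, y) = |s| * (Set.Iio (1 : ℝ)).indicator 1 |s| *
      (√(s ^ 2 + ‖y‖ ^ 2) ^ (k + 2))⁻¹ -
      |s| * (Set.Iio (1 : ℝ)).indicator (fun r => (r ^ (k + 2))⁻¹) √(s ^ 2 + ‖y‖ ^ 2) := by
    intro s y
    simp only [hgdef, Set.indicator, Pi.one_apply]
    split_ifs <;> ring
  have hi : ∀ s : ℝ, s ≠ 0 → Integrable (fun y => g (s, y)) := fun s hs => by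
    simp only [hgs]
    exact ((integral_sliceKernel hk hs).1.const_mul _).sub ((hcut s hs).const_mul _)
  have hval : ∀ s : ℝ, s ≠ 0 → ∫ y, g (s, y) =
      ballVol k * (Set.Ioo (-1 : ℝ) 1).indicator (fun s => (1 - capPow k |s|) * |s|⁻¹) s := by
    intro s hs
    simp only [hgs]
    rw [integral_sub ((integral_sliceKernel hk hs).1.const_mul _) ((hcut s hs).const_mul _),
      integral_const_mul, integral_const_mul, (integral_sliceKernel hk hs).2,
      setIntegral_sliceKernel hk hs]
    have e1 : capPow k |s| = capPow k s := by simp [capPow]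
    have e2 := sq_abs s
    have e3 := abs_pos.2 hs
    by_cases h : |s| < 1
    · simp only [Set.indicator, Set.mem_Iio, h, if_true, Set.mem_Ioo, abs_lt.1 h, e1, ← e2,
        Pi.one_apply, and_self]
      field_simp
    · have h' : ¬ (-1 < s ∧ s < 1) := fun hh => h (abs_lt.2 hh)
      rw [← e1, capPow_of_one_le hk (not_lt.1 h)]
      simp [Set.indicator, h, h']
  have hII : Integrable ((Set.Ioo (-1 : ℝ) 1).indicator (fun s => (1 - capPow k |s|) * |s|⁻¹)) := by
    rw [integrable_indicator_iff measurableSet_Ioo]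
    exact (((continuous_capDefect_density k).comp continuous_abs).integrableOn_Icc).mono_set
      Set.Ioo_subset_Icc_self
  have hg : Integrable g ((volume : Measure ℝ).prod (volume : Measure (Space k))) := by
    rw [integrable_prod_iff hgm.aestronglyMeasurable]
    constructor
    · filter_upwards [ae_ne_zero] with s hs using hi s hs
    · refine (hII.const_mul (ballVol k)).congr ?_
      filter_upwards [ae_ne_zero] with s hs
      simp only [Real.norm_of_nonneg (hg0 _)]
      exact (hval s hs).symm
  obtain ⟨h1, h2⟩ := integral_slice hg
  simp only [hgdef, ← norm_eq_tailVec] at h1 h2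
  refine ⟨h1, ?_⟩
  rw [h2]
  have h3 : ∫ s, ∫ y, g (s, y) =
      ∫ s, ballVol k * (Set.Ioo (-1 : ℝ) 1).indicator (fun s => (1 - capPow k |s|) * |s|⁻¹) s := by
    refine integral_congr_ae ?_
    filter_upwards [ae_ne_zero] with s hs using hval s hs
  change ∫ s, ∫ y, g (s, y) = _
  rw [h3, integral_const_mul, integral_indicator measurableSet_Ioo]
  have h4 : ∫ s in Set.Ioo (-1 : ℝ) 1, (1 - capPow k |s|) * |s|⁻¹ = 2 * capDefect k := by
    rw [← integral_Ioc_eq_integral_Ioo, ← intervalIntegral.integral_of_le (by norm_num)]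
    have hc : Continuous fun s : ℝ => (1 - capPow k |s|) * |s|⁻¹ :=
      (continuous_capDefect_density k).comp continuous_abs
    rw [← intervalIntegral.integral_add_adjacent_intervals (b := 0) (hc.intervalIntegrable _ _)
      (hc.intervalIntegrable _ _)]
    have e5 : ∫ s in (0 : ℝ)..1, (1 - capPow k |s|) * |s|⁻¹ = capDefect k := by
      refine intervalIntegral.integral_congr fun s hs => ?_
      rw [Set.uIcc_of_le zero_le_one] at hs
      simp only [abs_of_nonneg hs.1]
    have e6 : ∫ s in (-1 : ℝ)..0, (1 - capPow k |s|) * |s|⁻¹ =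
        ∫ s in (0 : ℝ)..1, (1 - capPow k |s|) * |s|⁻¹ := by
      have := intervalIntegral.integral_comp_neg (a := 0) (b := 1)
        (fun s : ℝ => (1 - capPow k |s|) * |s|⁻¹)
      simp only [abs_neg, neg_zero] at this
      exact this.symm
    rw [e6, e5, two_mul]
  rw [h4]
  ring

/-! ### The energy of stripes -/

/-- Integrability excludes the form ⊤ - ⊤ in the extended-real definition, so that the Bochner
integral can be used from here on. -/
theorem energy_of_integrable {d : ℕ} {K : ℝ → ℝ} {u C : Space d → ℝ}
    (h : HasAutocorrelation u C) (hi : Integrable (energyDensity K C)) :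
    energy K u = ((∫ z, energyDensity K C z : ℝ) : EReal) := by
  have h1 := hi.lintegral_lt_top
  have h2 : ∫⁻ z, ENNReal.ofReal (-energyDensity K C z) < ∞ := hi.neg.lintegral_lt_top
  rw [energy, h.eq, integral_eq_lintegral_pos_part_sub_lintegral_neg_part hi, EReal.coe_sub,
    EReal.coe_ennreal_toReal h1.ne, EReal.coe_ennreal_toReal h2.ne]

theorem originSlope_scale {d : ℕ} (C : Space d → ℝ) (a : ℝ) (z : Space d) :
    originSlope (fun z => C (a⁻¹ • z)) z = originSlope C (a⁻¹ • z) := by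
  unfold originSlope
  simp only [smul_comm a⁻¹]

/-- The autocorrelation function of the stripes of period `1` and width `lam` on the line. -/
noncomputable def stripeProfile (lam s : ℝ) : ℝ :=
  max (lam - Int.fract s) 0 + max (lam - 1 + Int.fract s) 0

theorem integral_indicator_Ioo_unit {a b : ℝ} (ha : 0 ≤ a) (hb : b ≤ 1) :
    IntervalIntegrable ((Set.Ioo a b).indicator (1 : ℝ → ℝ)) volume 0 1 ∧
    ∫ t in (0 : ℝ)..1, (Set.Ioo a b).indicator (1 : ℝ → ℝ) t = max (b - a) 0 := by
  have hs : Set.Ioo a b ⊆ Set.Ioc 0 1 := fun x hx => ⟨ha.trans_lt hx.1, hx.2.le.trans hb⟩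
  constructor
  · rw [intervalIntegrable_iff_integrableOn_Ioc_of_le zero_le_one]
    exact ((integrableOn_const (by simp)).integrable_indicator measurableSet_Ioo).integrableOn
  · rw [intervalIntegral.integral_of_le zero_le_one, setIntegral_indicator measurableSet_Ioo,
      Set.inter_eq_self_of_subset_right hs]
    simp [Real.volume_real_Ioo]

theorem stripes_indicator {k : ℕ} {lam : ℝ} (h1 : lam < 1) (x : Space (k + 1)) :
    (stripes (k + 1) lam (1 - lam)).indicator (fun _ => (1 : ℝ)) x =
      (Set.Ioo 0 lam).indicator 1 (Int.fract (x 0)) := by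
  have : x ∈ stripes (k + 1) lam (1 - lam) ↔ Int.fract (x 0) ∈ Set.Ioo 0 lam := by
    simp only [stripes, add_sub_cancel, mul_one, Set.mem_ofPred_eq, Set.mem_Ioo]
    constructor
    · rintro ⟨j, hj1, hj2⟩
      have : ⌊x 0⌋ = j := Int.floor_eq_iff.2 ⟨hj1.le, by linarith⟩
      rw [Int.fract, this]
      constructor <;> linarith
    · rintro ⟨hj1, hj2⟩
      rw [Int.fract] at hj1 hj2
      exact ⟨⌊x 0⌋, by linarith, by linarith⟩
  by_cases h : x ∈ stripes (k + 1) lam (1 - lam)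
  · simp [h, this.1 h]
  · simp [h, mt this.2 h]

/-- On the circle of length 1 an arc meets its translate in up to two arcs: one without and one with
passage through the base point. They give the two hinge terms of the profile. -/
theorem integral_stripe_overlap {lam : ℝ} (h1 : lam < 1) (s : ℝ) :
    ∫ t in (0 : ℝ)..1, (Set.Ioo 0 lam).indicator (1 : ℝ → ℝ) (Int.fract (t + s)) *
      (Set.Ioo 0 lam).indicator 1 (Int.fract t) = stripeProfile lam s := by
  obtain ⟨i1, e1⟩ := integral_indicator_Ioo_unit (a := 0) (b := lam - Int.fract s) le_rfl
    (by linarith [Int.fract_nonneg s])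
  obtain ⟨i2, e2⟩ := integral_indicator_Ioo_unit (a := 1 - Int.fract s) (b := lam)
    (by linarith [Int.fract_lt_one s]) h1.le
  rw [stripeProfile, show lam - 1 + Int.fract s = lam - (1 - Int.fract s) by ring, ← e2]
  rw [sub_zero] at e1
  rw [← e1, ← intervalIntegral.integral_add i1 i2]
  refine intervalIntegral.integral_congr_ae ?_
  have hne : ∀ᵐ t : ℝ, t ≠ 1 := by simp [ae_iff, measure_singleton]
  filter_upwards [hne] with t ht1 ht
  rw [Set.uIoc_of_le zero_le_one] at ht
  have ht1' : t < 1 := lt_of_le_of_ne ht.2 ht1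
  have hft : Int.fract t = t := Int.fract_eq_self.2 ⟨ht.1.le, ht1'⟩
  have hf : Int.fract (t + s) = Int.fract (t + Int.fract s) := by
    rw [Int.fract_eq_fract]
    exact ⟨⌊s⌋, by rw [Int.fract]; ring⟩
  have hs0 := Int.fract_nonneg s
  have hs1 := Int.fract_lt_one s
  rw [hf, hft]
  generalize Int.fract s = f at *
  rcases lt_or_ge (t + f) 1 with h | h
  · rw [Int.fract_eq_self.2 ⟨by linarith [ht.1], h⟩]
    have m2 : ¬ (1 - f < t ∧ t < lam) := fun hh => by linarith [hh.1]
    by_cases m1 : t + f < lam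
    · have : t < lam - f := by linarith
      have : t < lam := by linarith
      have : 0 < t + f := by linarith [ht.1]
      simp [Set.indicator, *]
      linarith
    · have : ¬ t < lam - f := by linarith
      simp [Set.indicator, *]
  · have : Int.fract (t + f) = t + f - 1 := by
      rw [Int.fract_eq_iff]
      exact ⟨by linarith, by linarith, 1, by push_cast; ring⟩
    rw [this]
    have m1 : ¬ (0 < t ∧ t < lam - f) := fun hh => by linarith [hh.2]
    by_cases m2 : t < lam
    · by_cases m3 : 1 - f < t
      · have : 0 < t + f - 1 := by linarith
        have : t + f - 1 < lam := by linarith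
        simp [Set.indicator, *]
        exact ht.1
      · have : ¬ 0 < t + f - 1 := by linarith
        simp [Set.indicator, *]
    · simp [Set.indicator, *]

theorem hasAutocorrelation_stripes {k : ℕ} {lam : ℝ} (h1 : lam < 1) :
    HasAutocorrelation ((stripes (k + 1) lam (1 - lam)).indicator fun _ => (1 : ℝ))
      (fun z => stripeProfile lam (z 0)) := by
  intro z
  set F : ℝ → ℝ := fun t => (Set.Ioo 0 lam).indicator (1 : ℝ → ℝ) (Int.fract (t + z 0)) *
      (Set.Ioo 0 lam).indicator 1 (Int.fract t) with hF
  have hFm : Measurable F :=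
    ((measurable_one.indicator measurableSet_Ioo).comp (by fun_prop)).mul
      ((measurable_one.indicator measurableSet_Ioo).comp (by fun_prop))
  have hFper : Function.Periodic F 1 := fun t => by
    simp only [hF]
    rw [add_right_comm, Int.fract_add_one, Int.fract_add_one]
  have hind : ∀ t : ℝ, 0 ≤ (Set.Ioo 0 lam).indicator (1 : ℝ → ℝ) t ∧
      (Set.Ioo 0 lam).indicator (1 : ℝ → ℝ) t ≤ 1 := fun t => by
    unfold Set.indicator
    split_ifs <;> simp
  have hv : ∀ x : Space (k + 1), (stripes (k + 1) lam (1 - lam)).indicator (fun _ => (1 : ℝ)) (x + z) *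
      (stripes (k + 1) lam (1 - lam)).indicator (fun _ => (1 : ℝ)) x = F (x 0) := fun x => by
    rw [stripes_indicator h1, stripes_indicator h1, PiLp.add_apply]
  simp only [hv]
  have hline : Measurable fun t : ℝ => (EuclideanSpace.single (0 : Fin (k + 1)) t) := by
    have : (fun t : ℝ => (EuclideanSpace.single (0 : Fin (k + 1)) t)) =
        fun t => t • EuclideanSpace.single (0 : Fin (k + 1)) (1 : ℝ) := by
      ext t i
      simp
    rw [this]
    fun_prop
  have hcoord : Measurable fun x : Space (k + 1) => x 0 := by fun_prop
  have hprob : IsProbabilityMeasure ((volume : Measure ℝ).restrict (Set.Ioc 0 1)) :=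
    ⟨by simp⟩
  have : IsProbabilityMeasure (((volume : Measure ℝ).restrict (Set.Ioc 0 1)).map
      fun t : ℝ => (EuclideanSpace.single (0 : Fin (k + 1)) t)) :=
    Measure.isProbabilityMeasure_map hline.aemeasurable
  -- Only the first coordinate matters, so the averaging measure is the uniform one on a unit
  -- segment of the first axis.
  refine tendsto_setAverage_cube (v := fun x : Space (k + 1) => F (x 0)) (hFm.comp hcoord)
    (fun x => mul_nonneg (hind _).1 (hind _).1)
    (fun x => mul_le_one₀ (hind _).2 (hind _).1 (hind _).2)
    (((volume : Measure ℝ).restrict (Set.Ioc 0 1)).map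
      fun t : ℝ => (EuclideanSpace.single (0 : Fin (k + 1)) t)) (D := 1) ?_ ?_
  · rw [ae_map_iff hline.aemeasurable (measurableSet_le measurable_norm measurable_const)]
    filter_upwards [ae_restrict_mem measurableSet_Ioc] with t ht
    simpa [abs_of_pos ht.1] using ht.2
  · intro x
    rw [integral_map hline.aemeasurable]
    · simp only [PiLp.add_apply, PiLp.single_apply, if_true]
      rw [← intervalIntegral.integral_of_le zero_le_one, ← integral_stripe_overlap h1,
        intervalIntegral.integral_comp_add_left F, add_zero]
      have := hFper.intervalIntegral_add_eq (x 0) 0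
      rw [zero_add] at this
      exact this
    · exact (hFm.comp (hcoord.comp (measurable_const.add measurable_id))).aestronglyMeasurable

theorem stripeProfile_neg (lam s : ℝ) : stripeProfile lam (-s) = stripeProfile lam s := by
  unfold stripeProfile
  by_cases h : Int.fract s = 0
  · have : Int.fract (-s) = 0 := by rwa [Int.fract_neg_eq_zero]
    rw [h, this]
  · rw [Int.fract_neg h, show lam - (1 - Int.fract s) = lam - 1 + Int.fract s by ring,
      show lam - 1 + (1 - Int.fract s) = lam - Int.fract s by ring, add_comm]

theorem stripeProfile_abs (lam s : ℝ) : stripeProfile lam |s| = stripeProfile lam s := by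
  rcases abs_choice s with h | h <;> rw [h]
  exact stripeProfile_neg lam s

theorem measurable_stripeProfile (lam : ℝ) : Measurable (stripeProfile lam) := by
  unfold stripeProfile
  fun_prop

theorem stripeProfile_nonneg (lam s : ℝ) : 0 ≤ stripeProfile lam s :=
  add_nonneg (le_max_right _ _) (le_max_right _ _)

theorem stripeProfile_zero {lam : ℝ} (h0 : 0 < lam) (h1 : lam < 1) :
    stripeProfile lam 0 = lam := by
  rw [stripeProfile, Int.fract_zero, max_eq_left (by linarith), max_eq_right (by linarith)]
  ring

theorem stripeProfile_le {lam : ℝ} (h0 : 0 < lam) (h1 : lam < 1) (s : ℝ) :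
    stripeProfile lam s ≤ lam := by
  have hs0 := Int.fract_nonneg s
  have hs1 := Int.fract_lt_one s
  unfold stripeProfile
  rcases max_cases (lam - Int.fract s) 0 with h | h <;>
    rcases max_cases (lam - 1 + Int.fract s) 0 with h' | h' <;> linarith

theorem max_le_stripeProfile (lam : ℝ) {s : ℝ} (hs : 0 ≤ s) :
    max (lam - s) 0 ≤ stripeProfile lam s := by
  have h1 : Int.fract s ≤ s := by
    have : (0 : ℝ) ≤ ⌊s⌋ := by exact_mod_cast Int.floor_nonneg.2 hs
    rw [Int.fract]
    linarith
  unfold stripeProfile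
  have h2 : max (lam - s) 0 ≤ max (lam - Int.fract s) 0 := max_le_max_right _ (by linarith)
  linarith [le_max_right (lam - 1 + Int.fract s) 0]

theorem stripeProfile_of_lt {lam s : ℝ} (hs : 0 ≤ s) (hs1 : s < lam) (hs2 : s < 1 - lam) :
    stripeProfile lam s = lam - s := by
  rw [stripeProfile, Int.fract_eq_self.2 ⟨hs, by linarith⟩, max_eq_left (by linarith),
    max_eq_right (by linarith), add_zero]

theorem originSlope_stripeProfile {k : ℕ} {lam : ℝ} (h0 : 0 < lam) (h1 : lam < 1)
    (z : Space (k + 1)) :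
    originSlope (fun z : Space (k + 1) => stripeProfile lam (z 0)) z = -|z 0| := by
  unfold originSlope
  have hd : HasDerivWithinAt (fun t : ℝ => lam - t * |z 0|) (-|z 0|) (Set.Ici 0) 0 := by
    simpa using (((hasDerivAt_id (0 : ℝ)).mul_const |z 0|).const_sub lam).hasDerivWithinAt
  refine HasDerivWithinAt.derivWithin (hd.congr_of_eventuallyEq ?_ ?_) (uniqueDiffOn_Ici 0 0 (by simp))
  · have hc : Tendsto (fun t : ℝ => t * |z 0|) (𝓝[Set.Ici 0] 0) (𝓝 0) := by
      have : Continuous fun t : ℝ => t * |z 0| := by fun_prop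
      simpa using (this.tendsto 0).mono_left nhdsWithin_le_nhds
    filter_upwards [hc.eventually_lt_const h0, hc.eventually_lt_const (sub_pos.2 h1),
      self_mem_nhdsWithin] with t ht1 ht2 ht
    have ht : 0 ≤ t := ht
    rw [← stripeProfile_abs, PiLp.smul_apply, smul_eq_mul, abs_mul, abs_of_nonneg ht]
    exact stripeProfile_of_lt (by positivity) ht1 ht2
  · simp [stripeProfile_zero h0 h1]

/-- The profile is exactly lam - s for s below min(lam, 1 - lam), so the density vanishes there;
beyond, its numerator is bounded by 2. -/
theorem integrableOn_regDensity_stripeProfile {lam : ℝ} (h0 : 0 < lam) (h1 : lam < 1) :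
    IntegrableOn (regDensity (stripeProfile lam) 1) (Set.Ioi 0) := by
  set m := min lam (1 - lam) with hm
  have hm0 : 0 < m := lt_min h0 (by linarith)
  have hdom : IntegrableOn ((Set.Ici m).indicator fun s : ℝ => 2 * (s ^ 2)⁻¹) (Set.Ioi 0) := by
    refine (IntegrableOn.integrable_indicator ?_ measurableSet_Ici).integrableOn
    rw [integrableOn_Ici_iff_integrableOn_Ioi]
    exact (integral_inv_sq_Ioi hm0).1.const_mul 2
  refine Integrable.mono' hdom ?_ ?_
  · refine Measurable.aestronglyMeasurable ?_
    unfold regDensity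
    refine (((measurable_stripeProfile lam).sub_const _).add ?_).div (by fun_prop)
    exact Measurable.indicator (by fun_prop) measurableSet_Iio
  · refine (ae_restrict_iff' measurableSet_Ioi).2 (ae_of_all _ fun s hs => ?_)
    have hs : 0 < s := hs
    rcases lt_or_ge s m with h | h
    · have h2 : s < lam := h.trans_le (min_le_left _ _)
      have h3 : s < 1 - lam := h.trans_le (min_le_right _ _)
      have h4 : s < 1 := by linarith
      simp [regDensity, stripeProfile_zero h0 h1, stripeProfile_of_lt hs.le h2 h3, h4,
        Set.indicator, not_le.2 h]
    · have e1 := stripeProfile_le h0 h1 s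
      have e2 := stripeProfile_nonneg lam s
      simp only [regDensity, stripeProfile_zero h0 h1, Set.indicator, Set.mem_Ici, h, if_true,
        Set.mem_Iio, Real.norm_eq_abs, abs_div, abs_of_pos (pow_pos hs 2), ← div_eq_mul_inv]
      gcongr
      split_ifs with h5
      · rw [abs_le]
        constructor <;> linarith
      · rw [abs_le]
        constructor <;> linarith

theorem integral_comp_abs' {f : ℝ → ℝ} (hf : IntegrableOn f (Set.Ioi 0)) :
    Integrable (fun s => f |s|) ∧ ∫ s, f |s| = 2 * ∫ s in Set.Ioi 0, f s := by
  constructor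
  · have := (integrable_fun_norm_addHaar (volume : Measure ℝ) (f := f)).2 (by simpa using hf)
    simpa using this
  · exact integral_comp_abs

/-- The density splits into a function of the first coordinate, regularized on the slab |z₀| < 1,
minus the cut-off correction. The slope 1/a of the rescaled profile multiplies the correction and
produces the logarithm. -/
theorem energy_stripes {k : ℕ} (hk : k ≠ 0) {lam : ℝ} (h0 : 0 < lam) (h1 : lam < 1) {a : ℝ}
    (ha : 0 < a) :
    setEnergy (stripes (k + 1) (a * lam) (a * (1 - lam))) =
      ((a⁻¹ * (2 * ballVol k * (regIntegral (stripeProfile lam) 1 - capDefect k) -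
        2 * ballVol k * Real.log a) : ℝ) : EReal) := by
  have hau := (hasAutocorrelation_stripes (k := k) h1).scale ha
  have hset : (fun x : Space (k + 1) =>
      (stripes (k + 1) lam (1 - lam)).indicator (fun _ => (1 : ℝ)) (a⁻¹ • x)) =
      (stripes (k + 1) (a * lam) (a * (1 - lam))).indicator fun _ => (1 : ℝ) := by
    ext x
    refine Set.indicator_eq_indicator ?_ rfl
    simp only [stripes, Set.mem_ofPred_eq, PiLp.smul_apply, smul_eq_mul, Set.mem_Ioo,
      lt_inv_mul_iff₀ ha, inv_mul_lt_iff₀ ha]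
    refine exists_congr fun j => ?_
    rw [show a * (j * (lam + (1 - lam))) = j * (a * lam + a * (1 - lam)) by ring,
      show a * (j * (lam + (1 - lam)) + lam) = j * (a * lam + a * (1 - lam)) + a * lam by ring]
  rw [hset] at hau
  set C : Space (k + 1) → ℝ := fun z => stripeProfile lam ((a⁻¹ • z) 0) with hC
  have hslope : ∀ z, originSlope C z = -(a⁻¹ * |z 0|) := fun z => by
    rw [hC, originSlope_scale (fun z : Space (k + 1) => stripeProfile lam (z 0)),
      originSlope_stripeProfile h0 h1, PiLp.smul_apply, smul_eq_mul, abs_mul,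
      abs_of_pos (inv_pos.2 ha)]
  obtain ⟨r1, r2⟩ := regIntegral_scale (integrableOn_regDensity_stripeProfile h0 h1) ha
  obtain ⟨s1, s2⟩ := integral_comp_abs' r1
  rw [one_mul] at r2 s1 s2
  set f : ℝ → ℝ := fun s => stripeProfile lam (a⁻¹ * |s|) - stripeProfile lam 0 +
    (Set.Iio (1 : ℝ)).indicator (fun s => a⁻¹ * s) |s| with hf
  have hfm : Measurable f := by
    refine (((measurable_stripeProfile lam).comp (by fun_prop)).sub_const _).add ?_
    exact (Measurable.indicator (by fun_prop) measurableSet_Iio).comp (by fun_prop)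
  have hfr : (fun s => f s / s ^ 2) =
      fun s => regDensity (fun s => stripeProfile lam (a⁻¹ * s)) a⁻¹ |s| := by
    ext s
    simp only [hf, regDensity, sq_abs, mul_zero]
  obtain ⟨f1, f2⟩ := integral_first_coord hk hfm (by rw [hfr]; exact s1)
  obtain ⟨c1, c2⟩ := integral_cutoff_defect hk
  have hdens : energyDensity (kernel (k + 1)) C = fun z => f (z 0) * (‖z‖ ^ (k + 2))⁻¹ -
      a⁻¹ * (|z 0| * ((Set.Iio (1 : ℝ)).indicator 1 |z 0| -
      (Set.Iio (1 : ℝ)).indicator 1 ‖z‖) * (‖z‖ ^ (k + 2))⁻¹) := by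
    ext z
    have e1 : C z = stripeProfile lam (a⁻¹ * |z 0|) := by
      rw [hC]
      simp only [PiLp.smul_apply, smul_eq_mul]
      rw [← stripeProfile_abs, abs_mul, abs_of_pos (inv_pos.2 ha)]
    have e2 : C 0 = stripeProfile lam 0 := by simp [hC]
    have e3 : (Metric.ball (0 : Space (k + 1)) 1).indicator (originSlope C) z =
        -(a⁻¹ * |z 0|) * (Set.Iio (1 : ℝ)).indicator 1 ‖z‖ := by
      simp only [Set.indicator, mem_ball_zero_iff, Set.mem_Iio, hslope, Pi.one_apply]
      split_ifs <;> simp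
    have e4 : (Set.Iio (1 : ℝ)).indicator (fun s => a⁻¹ * s) |z 0| =
        a⁻¹ * |z 0| * (Set.Iio (1 : ℝ)).indicator 1 |z 0| := by
      simp only [Set.indicator, Pi.one_apply]
      split_ifs <;> simp
    rw [energyDensity, e1, e2, e3, kernel, hf]
    simp only [e4]
    rw [div_eq_mul_inv, show (‖z‖ ^ (k + 2))⁻¹ = ‖z‖⁻¹ * (‖z‖ ^ (k + 1))⁻¹ by
      rw [← mul_inv, ← pow_succ']]
    ring
  have hi : Integrable (energyDensity (kernel (k + 1)) C) := by
    rw [hdens]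
    exact f1.sub (c1.const_mul _)
  rw [setEnergy, energy_of_integrable hau hi, hdens, integral_sub f1 (c1.const_mul _),
    integral_const_mul, c2, f2, hfr, s2]
  change ((ballVol k * (2 * regIntegral (fun s => stripeProfile lam (a⁻¹ * s)) a⁻¹) - _ : ℝ) : EReal)
    = _
  rw [r2]
  congr 1
  ring

/-! ### Overlaps of balls -/

/-- The volume of the intersection of two balls of radius `ρ` whose centres differ by `z`. -/
noncomputable def overlap {d : ℕ} (ρ : ℝ) (z : Space d) : ℝ :=
  volume.real (Metric.ball (0 : Space d) ρ ∩ Metric.ball z ρ)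

theorem overlap_smul {d : ℕ} {ρ : ℝ} (hρ : 0 < ρ) (z : Space d) :
    overlap ρ z = ρ ^ d * overlap 1 (ρ⁻¹ • z) := by
  have h1 : Metric.ball (0 : Space d) ρ ∩ Metric.ball z ρ =
      ρ • (Metric.ball (0 : Space d) 1 ∩ Metric.ball (ρ⁻¹ • z) 1) := by
    rw [Set.smul_set_inter₀ hρ.ne', smul_ball hρ.ne', smul_ball hρ.ne', smul_zero,
      smul_inv_smul₀ hρ.ne', Real.norm_of_nonneg hρ.le, mul_one]
  rw [overlap, h1, measureReal_def, Measure.addHaar_smul, ENNReal.toReal_mul,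
    finrank_euclideanSpace_fin, ENNReal.toReal_ofReal (abs_nonneg _), abs_of_pos (pow_pos hρ d)]
  rfl

theorem overlap_eq_of_norm_eq {d : ℕ} (ρ : ℝ) {z w : Space d} (h : ‖z‖ = ‖w‖) :
    overlap ρ z = overlap ρ w := by
  set L := (ℝ ∙ (z - w))ᗮ.reflection with hL
  have hLz : L z = w := Submodule.reflection_sub h
  have h1 : Metric.ball (0 : Space d) ρ ∩ Metric.ball z ρ =
      L ⁻¹' (Metric.ball (0 : Space d) ρ ∩ Metric.ball w ρ) := by
    rw [Set.preimage_inter, ← hLz]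
    congr 1
    · rw [LinearIsometryEquiv.preimage_ball, map_zero]
    · rw [LinearIsometryEquiv.preimage_ball, LinearIsometryEquiv.symm_apply_apply]
  rw [overlap, h1, measureReal_def,
    L.measurePreserving.measure_preimage
      (Metric.isOpen_ball.inter Metric.isOpen_ball).measurableSet.nullMeasurableSet]
  rfl

theorem integrable_capPow {k : ℕ} (hk : k ≠ 0) : Integrable (capPow k) := by
  refine (continuous_capPow k).integrable_of_hasCompactSupport
    (HasCompactSupport.intro (isCompact_Icc (a := -1) (b := 1)) fun x hx => ?_)
  rw [Set.mem_Icc, ← abs_le, not_le] at hx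
  rw [← capPow_of_one_le hk hx.le, capPow, capPow, sq_abs]

theorem integral_Ioi_capPow {k : ℕ} (hk : k ≠ 0) (t : ℝ) :
    ∫ s in Set.Ioi t, capPow k s = capTail k t := by
  rcases le_total t 1 with h | h
  · rw [capTail, intervalIntegral.integral_of_le h]
    refine setIntegral_eq_of_subset_of_forall_sdiff_eq_zero measurableSet_Ioi
      Set.Ioc_subset_Ioi_self fun s hs => ?_
    refine capPow_of_one_le hk (le_of_not_ge fun h' => hs.2 ⟨hs.1, h'⟩)
  · rw [capTail_of_one_le hk h]
    exact setIntegral_eq_zero_of_forall_eq_zero fun s hs => capPow_of_one_le hk (h.trans (le_of_lt hs))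

/-- The centres are at heights 0 and 2t. At height s the farther one is decisive, at axial distance
max(|s|, |s - 2t|) = t + |s - t|, so the slice of the lens is a ball of radius √(1 - (t + |s -
t|)²). -/
theorem overlap_one_single {k : ℕ} (hk : k ≠ 0) {t : ℝ} (ht : 0 ≤ t) :
    overlap 1 (EuclideanSpace.single (0 : Fin (k + 1)) (2 * t)) = 2 * ballVol k * capTail k t := by
  set S : Set (ℝ × Space k) := {p | p.1 ^ 2 + ‖p.2‖ ^ 2 < 1 ∧ (p.1 - 2 * t) ^ 2 + ‖p.2‖ ^ 2 < 1}
    with hS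
  have hSm : MeasurableSet S := by
    have m1 : Measurable fun p : ℝ × Space k => p.1 ^ 2 + ‖p.2‖ ^ 2 := by fun_prop
    have m2 : Measurable fun p : ℝ × Space k => (p.1 - 2 * t) ^ 2 + ‖p.2‖ ^ 2 := by fun_prop
    exact (measurableSet_lt m1 measurable_const).inter (measurableSet_lt m2 measurable_const)
  have hpre : Metric.ball (0 : Space (k + 1)) 1 ∩
      Metric.ball (EuclideanSpace.single (0 : Fin (k + 1)) (2 * t)) 1 =
      (fun x : Space (k + 1) => (x 0, tailVec x)) ⁻¹' S := by
    ext x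
    have e1 : tailVec (x - EuclideanSpace.single (0 : Fin (k + 1)) (2 * t)) = tailVec x := by
      ext i
      simp [tailVec]
    rw [Set.mem_inter_iff, mem_ball_zero_iff, mem_ball_iff_norm, ← sq_lt_one_iff₀ (norm_nonneg _),
      ← sq_lt_one_iff₀ (norm_nonneg _), norm_sq_eq_tailVec, norm_sq_eq_tailVec, e1]
    simp [hS]
  have hslice : ∀ s : ℝ, volume (Prod.mk s ⁻¹' S) =
      ENNReal.ofReal (ballVol k * capPow k (t + |s - t|)) := by
    intro s
    have h1 : Prod.mk s ⁻¹' S = Metric.ball (0 : Space k) √(1 - (t + |s - t|) ^ 2) := by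
      ext y
      rw [mem_ball_zero_iff, Real.lt_sqrt (norm_nonneg y), Set.mem_preimage, hS, Set.mem_ofPred_eq]
      rcases abs_cases (s - t) with h | h
      · rw [h.1]
        constructor
        · intro h'
          nlinarith [h'.1]
        · intro h'
          constructor <;> nlinarith
      · rw [h.1]
        constructor
        · intro h'
          nlinarith [h'.2]
        · intro h'
          constructor <;> nlinarith
    rw [h1, ← ENNReal.ofReal_toReal (a := volume _) measure_ball_lt_top.ne, ← measureReal_def,
      volume_real_ball hk _ (Real.sqrt_nonneg _), capPow, mul_comm]
  have hint0 : Integrable (fun s => capPow k (t + |s|)) ∧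
      ∫ s, capPow k (t + |s|) = 2 * ∫ s in Set.Ioi 0, capPow k (t + s) := by
    refine integral_comp_abs' (f := fun s => capPow k (t + s)) ?_
    exact ((integrable_capPow hk).comp_add_left t).integrableOn
  have hint : Integrable (fun s => capPow k (t + |s - t|)) := hint0.1.comp_sub_right t
  have hval : ∫ s, capPow k (t + |s - t|) = 2 * capTail k t := by
    rw [integral_sub_right_eq_self (fun s => capPow k (t + |s|)) t, hint0.2,
      ← integral_Ioi_capPow hk]
    congr 1
    have := (measurePreserving_add_left volume t).setIntegral_preimage_emb
      (measurableEmbedding_addLeft t) (capPow k) (Set.Ioi t)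
    rw [← this]
    congr 2
    ext s
    simp
  rw [overlap, hpre, measureReal_def, (measurePreserving_slice k).measure_preimage
    hSm.nullMeasurableSet, Measure.prod_apply hSm]
  simp_rw [hslice]
  rw [← ofReal_integral_eq_lintegral_ofReal (hint.const_mul _)
    (ae_of_all _ fun s => mul_nonneg (ballVol_pos k).le (capPow_nonneg k _)), integral_const_mul, hval,
    ENNReal.toReal_ofReal]
  · ring
  · exact mul_nonneg (ballVol_pos k).le (mul_nonneg two_pos.le (capTail_nonneg hk t))

theorem overlap_eq {k : ℕ} (hk : k ≠ 0) {ρ : ℝ} (hρ : 0 < ρ) (z : Space (k + 1)) :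
    overlap ρ z = 2 * ρ * (ballVol k * ρ ^ k) * capTail k (‖z‖ / (2 * ρ)) := by
  rw [overlap_smul hρ, overlap_eq_of_norm_eq 1
    (w := EuclideanSpace.single (0 : Fin (k + 1)) (2 * (‖z‖ / (2 * ρ)))), overlap_one_single hk (by positivity)]
  · ring
  · rw [norm_smul, norm_inv, Real.norm_of_nonneg hρ.le, PiLp.norm_single, Real.norm_of_nonneg (by positivity)]
    field_simp

/-- The lens of two balls overlapping to depth of order ε has volume O(ε^(3/2)); this is what makes
touching balls admissible below. -/
theorem capTail_le {k : ℕ} (hk : k ≠ 0) {ε : ℝ} (h0 : 0 ≤ ε) (h1 : ε ≤ 1) :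
    capTail k (1 - ε) ≤ ε * √(2 * ε) := by
  have h := intervalIntegral.integral_mono_on (a := 1 - ε) (b := 1) (by linarith)
    (intervalIntegrable_capPow k _ _) (intervalIntegrable_const (c := √(2 * ε))) fun t ht => ?_
  · rw [intervalIntegral.integral_const, smul_eq_mul, sub_sub_cancel] at h
    exact h
  · rw [capPow]
    have h2 : √(1 - t ^ 2) ≤ 1 := Real.sqrt_le_one.2 (by nlinarith [sq_nonneg t])
    refine (pow_le_of_le_one (Real.sqrt_nonneg _) h2 hk).trans (Real.sqrt_le_sqrt ?_)
    nlinarith [ht.1, ht.2]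

/-! ### The autocorrelation function of lattice balls -/

theorem exists_isAddFundamentalDomain {d : ℕ} (Λ : Submodule ℤ (Space d)) [DiscreteTopology Λ]
    [IsZLattice ℝ Λ] : ∃ F : Set (Space d), IsAddFundamentalDomain Λ F volume ∧
      MeasurableSet F ∧ ∃ D, ∀ x ∈ F, ‖x‖ ≤ D := by
  have : Module.Free ℤ Λ := ZLattice.module_free ℝ Λ
  have : Module.Finite ℤ Λ := ZLattice.module_finite ℝ Λ
  set b := Module.Free.chooseBasis ℤ Λ
  refine ⟨_, ZLattice.isAddFundamentalDomain b volume, ZSpan.fundamentalDomain_measurableSet _, ?_⟩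
  exact (ZSpan.fundamentalDomain_isBounded (b.ofZLatticeBasis ℝ)).exists_norm_le

/-- The balls of radius `ρ` centred at the non-zero points of the lattice `Λ`. -/
def puncturedBalls {d : ℕ} (Λ : Submodule ℤ (Space d)) (ρ : ℝ) : Set (Space d) :=
  ⋃ q ∈ (Λ : Set (Space d)) \ {0}, Metric.ball q ρ

/-- The contribution of distinct balls to the autocorrelation function of lattice balls. -/
noncomputable def crossOverlap {d : ℕ} (Λ : Submodule ℤ (Space d)) (ρ : ℝ) (z : Space d) : ℝ :=
  volume.real (Metric.ball (0 : Space d) ρ ∩ {y | y + z ∈ puncturedBalls Λ ρ})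

theorem isOpen_puncturedBalls {d : ℕ} (Λ : Submodule ℤ (Space d)) (ρ : ℝ) :
    IsOpen (puncturedBalls Λ ρ) :=
  isOpen_biUnion fun _ _ => Metric.isOpen_ball

theorem isOpen_latticeBalls {d : ℕ} (Λ : Submodule ℤ (Space d)) (ρ : ℝ) :
    IsOpen (latticeBalls Λ ρ) :=
  isOpen_biUnion fun _ _ => Metric.isOpen_ball

theorem mem_latticeBalls {d : ℕ} {Λ : Submodule ℤ (Space d)} {ρ : ℝ} {x : Space d} :
    x ∈ latticeBalls Λ ρ ↔ ∃ q ∈ Λ, dist x q < ρ := by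
  simp [latticeBalls]

theorem mem_puncturedBalls {d : ℕ} {Λ : Submodule ℤ (Space d)} {ρ : ℝ} {x : Space d} :
    x ∈ puncturedBalls Λ ρ ↔ ∃ q ∈ Λ, q ≠ 0 ∧ dist x q < ρ := by
  simp [puncturedBalls, and_assoc]

theorem latticeBalls_eq {d : ℕ} (Λ : Submodule ℤ (Space d)) (ρ : ℝ) :
    latticeBalls Λ ρ = Metric.ball 0 ρ ∪ puncturedBalls Λ ρ := by
  ext x
  rw [Set.mem_union, mem_latticeBalls, mem_puncturedBalls, Metric.mem_ball]
  constructor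
  · rintro ⟨q, hq, h⟩
    rcases eq_or_ne q 0 with rfl | h0
    · exact Or.inl h
    · exact Or.inr ⟨q, hq, h0, h⟩
  · rintro (h | ⟨q, hq, _, h⟩)
    · exact ⟨0, Λ.zero_mem, h⟩
    · exact ⟨q, hq, h⟩

theorem add_mem_latticeBalls {d : ℕ} {Λ : Submodule ℤ (Space d)} {ρ : ℝ} {g : Space d} (hg : g ∈ Λ)
    (x : Space d) : g + x ∈ latticeBalls Λ ρ ↔ x ∈ latticeBalls Λ ρ := by
  rw [mem_latticeBalls, mem_latticeBalls]
  constructor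
  · rintro ⟨q, hq, h⟩
    refine ⟨q - g, Λ.sub_mem hq hg, ?_⟩
    rwa [dist_eq_norm, sub_sub_eq_add_sub, add_comm x g, ← dist_eq_norm]
  · rintro ⟨q, hq, h⟩
    exact ⟨g + q, Λ.add_mem hg hq, by rwa [dist_add_left]⟩

/-- The condition that the balls of radius `ρ` centred at the points of `Λ` do not overlap. -/
def IsPacking {d : ℕ} (Λ : Submodule ℤ (Space d)) (ρ : ℝ) : Prop :=
  ∀ p ∈ Λ, ∀ q ∈ Λ, p ≠ q → ρ ≤ dist p q / 2

theorem IsPacking.eq_of_dist_lt {d : ℕ} {Λ : Submodule ℤ (Space d)} {ρ : ℝ} (h : IsPacking Λ ρ)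
    {p q x : Space d} (hp : p ∈ Λ) (hq : q ∈ Λ) (hxp : dist x p < ρ) (hxq : dist x q < ρ) : p = q := by
  by_contra hne
  have h1 := h p hp q hq hne
  have h2 := dist_triangle_left p q x
  linarith

theorem IsPacking.two_mul_le_norm {d : ℕ} {Λ : Submodule ℤ (Space d)} {ρ : ℝ} (h : IsPacking Λ ρ)
    {q : Space d} (hq : q ∈ Λ) (h0 : q ≠ 0) : 2 * ρ ≤ ‖q‖ := by
  have := h q hq 0 Λ.zero_mem h0
  rw [dist_zero_right] at this
  linarith

theorem IsPacking.disjoint {d : ℕ} {Λ : Submodule ℤ (Space d)} {ρ : ℝ} (h : IsPacking Λ ρ) :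
    Disjoint (Metric.ball 0 ρ) (puncturedBalls Λ ρ) := by
  rw [Set.disjoint_left]
  intro x hx hx'
  obtain ⟨q, hq, h0, hxq⟩ := mem_puncturedBalls.1 hx'
  exact h0 (h.eq_of_dist_lt hq Λ.zero_mem hxq hx)

theorem volume_inter_latticeBalls {d : ℕ} {Λ : Submodule ℤ (Space d)} {ρ : ℝ} (h : IsPacking Λ ρ)
    (z : Space d) : volume.real (Metric.ball (0 : Space d) ρ ∩ {y | y + z ∈ latticeBalls Λ ρ}) =
      overlap ρ z + crossOverlap Λ ρ z := by
  have h1 : Metric.ball (0 : Space d) ρ ∩ {y | y + z ∈ latticeBalls Λ ρ} =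
      (Metric.ball (0 : Space d) ρ ∩ Metric.ball (-z) ρ) ∪
      (Metric.ball (0 : Space d) ρ ∩ {y | y + z ∈ puncturedBalls Λ ρ}) := by
    rw [← Set.inter_union_distrib_left, latticeBalls_eq]
    congr 1
    ext y
    simp [dist_eq_norm]
  have hm : MeasurableSet {y : Space d | y + z ∈ puncturedBalls Λ ρ} :=
    (measurable_add_const z) (isOpen_puncturedBalls Λ ρ).measurableSet
  rw [h1, measureReal_union _ (measurableSet_ball.inter hm)]
  · rw [overlap_eq_of_norm_eq ρ (norm_neg z).symm]
    rfl
  · rw [Set.disjoint_left]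
    rintro y ⟨_, hy⟩ ⟨_, hy'⟩
    refine Set.disjoint_left.1 h.disjoint ?_ hy'
    simpa [dist_eq_norm] using hy

/-- Unfolding over the cell: by the packing condition a point of the periodic set lies in exactly
one translate of the central ball, so the sum of the translated indicators is the periodic
indicator. -/
theorem lintegral_fundamentalDomain_latticeBalls {d : ℕ} {Λ : Submodule ℤ (Space d)}
    [DiscreteTopology Λ] [IsZLattice ℝ Λ] {ρ : ℝ} (h : IsPacking Λ ρ) {F : Set (Space d)}
    (hF : IsAddFundamentalDomain Λ F volume) (z x : Space d) :
    ∫⁻ y in F, (latticeBalls Λ ρ ∩ {y | y + z ∈ latticeBalls Λ ρ}).indicator 1 (x + y) =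
      volume (Metric.ball (0 : Space d) ρ ∩ {y | y + z ∈ latticeBalls Λ ρ}) := by
  have : VAddInvariantMeasure Λ (Space d) volume :=
    (inferInstance : VAddInvariantMeasure Λ.toAddSubgroup (Space d) volume)
  have : MeasurableConstVAdd Λ (Space d) :=
    (inferInstance : MeasurableConstVAdd Λ.toAddSubgroup (Space d))
  set A : Set (Space d) := Metric.ball (0 : Space d) ρ ∩ {y | y + z ∈ latticeBalls Λ ρ} with hA
  have hm : MeasurableSet A := measurableSet_ball.inter
    ((measurable_add_const z) (isOpen_latticeBalls Λ ρ).measurableSet)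
  have h1 : volume A = ∫⁻ y, A.indicator 1 (x + y) := by
    rw [lintegral_add_left_eq_self (A.indicator (1 : Space d → ℝ≥0∞)) x, lintegral_indicator_one hm]
  rw [h1, hF.lintegral_eq_tsum'', ← lintegral_tsum]
  · refine lintegral_congr fun y => ?_
    have hper : ∀ g : Λ, x + (g +ᵥ y) + z ∈ latticeBalls Λ ρ ↔ x + y + z ∈ latticeBalls Λ ρ := by
      intro g
      rw [← add_mem_latticeBalls g.2 (x + y + z)]
      congr! 1
      change x + ((g : Space d) + y) + z = _
      abel
    by_cases hy : x + y ∈ latticeBalls Λ ρ ∩ {y | y + z ∈ latticeBalls Λ ρ}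
    · rw [Set.indicator_of_mem hy]
      obtain ⟨q, hq, hyq⟩ := mem_latticeBalls.1 hy.1
      rw [tsum_eq_single (-⟨q, hq⟩ : Λ)]
      · refine (Set.indicator_of_mem (show x + ((-⟨q, hq⟩ : Λ) +ᵥ y) ∈ A from
          ⟨mem_ball_zero_iff.2 ?_, (hper _).2 hy.2⟩) (1 : Space d → ℝ≥0∞)).symm
        change ‖x + (-q + y)‖ < ρ
        rw [dist_eq_norm] at hyq
        convert! hyq using 2
        abel
      · intro g hg
        refine Set.indicator_of_notMem (fun hmem => hg ?_) _
        have h2 := hmem.1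
        rw [mem_ball_zero_iff] at h2
        have h3 : dist (x + y) (-(g : Space d)) < ρ := by
          rw [dist_eq_norm]
          convert! h2 using 2
          change _ = x + ((g : Space d) + y)
          abel
        have h4 := h.eq_of_dist_lt hq (Λ.neg_mem g.2) hyq h3
        ext1
        change (g : Space d) = -q
        rw [h4, neg_neg]
    · rw [Set.indicator_of_notMem hy, eq_comm, ENNReal.tsum_eq_zero]
      intro g
      refine Set.indicator_of_notMem (fun hmem => hy ⟨?_, (hper g).1 hmem.2⟩) _
      rw [← add_mem_latticeBalls g.2, mem_latticeBalls]
      refine ⟨0, Λ.zero_mem, ?_⟩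
      have h2 := hmem.1
      rw [mem_ball_zero_iff] at h2
      rw [dist_zero_right]
      convert! h2 using 2
      change _ = x + ((g : Space d) + y)
      abel
  · intro g
    have h5 : Measurable fun y : Space d => x + (g +ᵥ y) :=
      measurable_const.add (measurable_id.const_vadd g)
    exact ((measurable_one.indicator hm).comp h5).aemeasurable

theorem hasAutocorrelation_latticeBalls {d : ℕ} {Λ : Submodule ℤ (Space d)}
    [DiscreteTopology Λ] [IsZLattice ℝ Λ] (hcov : ZLattice.covolume Λ = 1) {ρ : ℝ}
    (h : IsPacking Λ ρ) :
    HasAutocorrelation ((latticeBalls Λ ρ).indicator fun _ => (1 : ℝ))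
      (fun z => overlap ρ z + crossOverlap Λ ρ z) := by
  intro z
  obtain ⟨F, hF, hFm, D, hD⟩ := exists_isAddFundamentalDomain Λ
  have hvol : volume F = 1 := by
    have := ZLattice.covolume_eq_measure_fundamentalDomain Λ volume hF
    rw [hcov, measureReal_def, eq_comm, ENNReal.toReal_eq_one_iff] at this
    exact this
  have hprob : IsProbabilityMeasure ((volume : Measure (Space d)).restrict F) :=
    ⟨by rw [Measure.restrict_apply_univ, hvol]⟩
  set B := latticeBalls Λ ρ ∩ {y | y + z ∈ latticeBalls Λ ρ} with hB
  have hBm : MeasurableSet B := (isOpen_latticeBalls Λ ρ).measurableSet.inter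
    ((measurable_add_const z) (isOpen_latticeBalls Λ ρ).measurableSet)
  have hv : ∀ x, (latticeBalls Λ ρ).indicator (fun _ => (1 : ℝ)) (x + z) *
      (latticeBalls Λ ρ).indicator (fun _ => (1 : ℝ)) x = B.indicator 1 x := by
    intro x
    by_cases h1 : x ∈ latticeBalls Λ ρ <;> by_cases h2 : x + z ∈ latticeBalls Λ ρ <;>
      simp [hB, Set.indicator, h1, h2]
  simp only [hv]
  refine tendsto_setAverage_cube (measurable_one.indicator hBm)
    (fun x => Set.indicator_nonneg (fun _ _ => zero_le_one) x)
    (fun x => Set.indicator_le_self' (fun _ _ => zero_le_one) x) (volume.restrict F) (D := D) ?_ ?_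
  · exact (ae_restrict_iff' hFm).2 (ae_of_all _ hD)
  · intro x
    have hnn : ∀ᵐ y ∂volume.restrict F, 0 ≤ B.indicator (1 : Space d → ℝ) (x + y) :=
      ae_of_all _ fun y => Set.indicator_nonneg (fun _ _ => zero_le_one) _
    rw [← volume_inter_latticeBalls h, measureReal_def,
      ← lintegral_fundamentalDomain_latticeBalls h hF z x,
      integral_eq_lintegral_of_nonneg_ae hnn]
    · congr 1
      refine lintegral_congr fun y => ?_
      rw [← hB]
      by_cases hy : x + y ∈ B <;> simp [hy]
    · exact ((measurable_one.indicator hBm).comp (measurable_const_add x)).aestronglyMeasurable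

/-! ### Rescaled lattices -/

theorem mem_smul_lattice {d : ℕ} {Λ : Submodule ℤ (Space d)} {a : ℝ} (ha : 0 < a) {x : Space d} :
    x ∈ a • Λ ↔ a⁻¹ • x ∈ Λ := by
  rw [← SetLike.mem_coe, Submodule.coe_pointwise_smul, Set.mem_smul_set_iff_inv_smul_mem₀ ha.ne']
  rfl

theorem covolume_smul {d : ℕ} (Λ : Submodule ℤ (Space d)) [DiscreteTopology Λ] [IsZLattice ℝ Λ]
    {a : ℝ} (ha : 0 < a) : ZLattice.covolume (a • Λ) = a ^ d * ZLattice.covolume Λ := by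
  set e : Space d ≃L[ℝ] Space d := ContinuousLinearEquiv.smulLeft (Units.mk0 a⁻¹ (inv_pos.2 ha).ne')
    with he
  have hex : ∀ x, e x = a⁻¹ • x := fun x => rfl
  have hΛ : a • Λ = ZLattice.comap ℝ Λ e.toLinearMap := by
    ext x
    rw [mem_smul_lattice ha]
    rfl
  -- The map x ↦ a⁻¹ x pushes Lebesgue measure to a ^ d times itself; this factor makes it measure
  -- preserving.
  set c : ℝ≥0∞ := ENNReal.ofReal (a ^ d)⁻¹ with hc
  have hc0 : c ≠ 0 := by
    rw [hc, Ne, ENNReal.ofReal_eq_zero, not_le]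
    positivity
  have hmap : Measure.map e (c • (volume : Measure (Space d))) = volume := by
    rw [Measure.map_smul]
    have : Measure.map (⇑e) (volume : Measure (Space d)) = Measure.map (a⁻¹ • ·) volume := rfl
    rw [this, Measure.map_addHaar_smul _ (inv_pos.2 ha).ne', smul_smul, finrank_euclideanSpace_fin,
      hc, ← ENNReal.ofReal_mul (by positivity), inv_pow, inv_inv, abs_of_pos (by positivity),
      inv_mul_cancel₀ (by positivity), ENNReal.ofReal_one, one_smul]
  have hν : Measure.IsAddHaarMeasure (c • (volume : Measure (Space d))) :=
    Measure.IsAddHaarMeasure.smul _ hc0 ENNReal.ofReal_ne_top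
  have hcov := ZLattice.covolume_comap Λ volume (c • (volume : Measure (Space d))) (e := e)
    ⟨e.continuous.measurable, hmap⟩
  rw [hΛ, ← hcov]
  obtain ⟨F, hF, -⟩ := exists_isAddFundamentalDomain (ZLattice.comap ℝ Λ e.toLinearMap)
  have hF' : IsAddFundamentalDomain (ZLattice.comap ℝ Λ e.toLinearMap) F
      (c • (volume : Measure (Space d))) := hF.mono (Measure.smul_absolutelyContinuous)
  rw [ZLattice.covolume_eq_measure_fundamentalDomain _ _ hF,
    ZLattice.covolume_eq_measure_fundamentalDomain _ _ hF', measureReal_ennreal_smul_apply, hc,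
    ENNReal.toReal_ofReal (by positivity), mul_inv_cancel_left₀ (by positivity)]

theorem isPacking_smul {d : ℕ} {Λ : Submodule ℤ (Space d)} {a : ℝ} (ha : 0 < a) {ρ : ℝ} :
    IsPacking (a • Λ) (a * ρ) ↔ IsPacking Λ ρ := by
  have key : ∀ p q : Space d, dist (a • p) (a • q) = a * dist p q := fun p q => by
    rw [dist_smul₀, Real.norm_of_nonneg ha.le]
  constructor
  · intro h p hp q hq hne
    have := h (a • p) (Submodule.smul_mem_pointwise_smul p a Λ hp) (a • q)
      (Submodule.smul_mem_pointwise_smul q a Λ hq) ((smul_right_injective _ ha.ne').ne hne)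
    rw [key, mul_div_assoc] at this
    exact le_of_mul_le_mul_left this ha
  · intro h p hp q hq hne
    have := h _ ((mem_smul_lattice ha).1 hp) _ ((mem_smul_lattice ha).1 hq)
      ((smul_right_injective _ (inv_pos.2 ha).ne').ne hne)
    calc a * ρ ≤ a * (dist (a⁻¹ • p) (a⁻¹ • q) / 2) := by gcongr
      _ = dist p q / 2 := by rw [← mul_div_assoc, ← key, smul_inv_smul₀ ha.ne', smul_inv_smul₀ ha.ne']

theorem mem_latticeBalls_smul {d : ℕ} {Λ : Submodule ℤ (Space d)} {a : ℝ} (ha : 0 < a) {ρ : ℝ}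
    {x : Space d} : x ∈ latticeBalls (a • Λ) (a * ρ) ↔ a⁻¹ • x ∈ latticeBalls Λ ρ := by
  rw [mem_latticeBalls, mem_latticeBalls]
  have key : ∀ q : Space d, dist x (a • q) < a * ρ ↔ dist (a⁻¹ • x) q < ρ := fun q => by
    rw [← mul_lt_mul_iff_right₀ ha (b := dist (a⁻¹ • x) q)]
    nth_rw 3 [← Real.norm_of_nonneg ha.le]
    rw [← dist_smul₀, smul_inv_smul₀ ha.ne']
  constructor
  · rintro ⟨q, hq, h⟩
    refine ⟨_, (mem_smul_lattice ha).1 hq, (key _).1 ?_⟩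
    rwa [smul_inv_smul₀ ha.ne']
  · rintro ⟨q, hq, h⟩
    exact ⟨a • q, Submodule.smul_mem_pointwise_smul q a Λ hq, (key q).2 h⟩

/-! ### Bounds for the cross overlap -/

theorem crossOverlap_nonneg {d : ℕ} (Λ : Submodule ℤ (Space d)) (ρ : ℝ) (z : Space d) :
    0 ≤ crossOverlap Λ ρ z := measureReal_nonneg

theorem crossOverlap_le {d : ℕ} (Λ : Submodule ℤ (Space d)) (ρ : ℝ) (z : Space d) :
    crossOverlap Λ ρ z ≤ volume.real (Metric.ball (0 : Space d) ρ) :=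
  measureReal_mono Set.inter_subset_left measure_ball_lt_top.ne

theorem measurable_crossOverlap {d : ℕ} (Λ : Submodule ℤ (Space d)) (ρ : ℝ) :
    Measurable (crossOverlap Λ ρ) := by
  have hS : MeasurableSet {p : Space d × Space d | p.2 ∈ Metric.ball (0 : Space d) ρ ∧
      p.2 + p.1 ∈ puncturedBalls Λ ρ} :=
    ((measurable_snd) measurableSet_ball).inter
      ((measurable_snd.add measurable_fst) (isOpen_puncturedBalls Λ ρ).measurableSet)
  exact (measurable_measure_prodMk_left hS).ennreal_toReal

theorem crossOverlap_eq_zero {d : ℕ} {Λ : Submodule ℤ (Space d)} {ρ m : ℝ}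
    (hm : ∀ q ∈ Λ, q ≠ 0 → m ≤ ‖q‖) {z : Space d} (hz : ‖z‖ ≤ m - 2 * ρ) :
    crossOverlap Λ ρ z = 0 := by
  have : Metric.ball (0 : Space d) ρ ∩ {y | y + z ∈ puncturedBalls Λ ρ} = ∅ := by
    rw [Set.eq_empty_iff_forall_notMem]
    rintro y ⟨hy, hy'⟩
    obtain ⟨q, hq, h0, hd⟩ := mem_puncturedBalls.1 hy'
    rw [mem_ball_zero_iff] at hy
    have h1 := hm q hq h0
    have h2 : ‖q‖ ≤ ‖y‖ + ‖z‖ + ‖(y + z) - q‖ := by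
      calc ‖q‖ = ‖y + z - (y + z - q)‖ := by rw [sub_sub_cancel]
        _ ≤ ‖y + z‖ + ‖y + z - q‖ := norm_sub_le _ _
        _ ≤ _ := by gcongr; exact norm_add_le _ _
    rw [dist_eq_norm] at hd
    linarith
  rw [crossOverlap, this, measureReal_empty]

/-- If balls touch, distinct balls overlap for arbitrarily small z, but only with volume
O(|z|^(3/2)). Hence the cross term does not change the slope at the origin and is integrable against
|z|^(-d-1) there. -/
theorem IsPacking.exists_crossOverlap_le {k : ℕ} (hk : k ≠ 0) {Λ : Submodule ℤ (Space (k + 1))}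
    [DiscreteTopology Λ] {ρ : ℝ} (hρ : 0 < ρ) (h : IsPacking Λ ρ) :
    ∃ c r : ℝ, 0 ≤ c ∧ 0 < r ∧ ∀ z, ‖z‖ ≤ r → crossOverlap Λ ρ z ≤ c * (‖z‖ * √‖z‖) := by
  have hfin : Set.Finite ((Λ : Set (Space (k + 1))) ∩ Metric.closedBall 0 (2 * ρ + 1)) := by
    have hcl : IsClosed (Λ.toAddSubgroup : Set (Space (k + 1))) :=
      AddSubgroup.isClosed_of_discrete (H := Λ.toAddSubgroup)
    have := Metric.finite_isBounded_inter_isClosed (K := Metric.closedBall (0 : Space (k + 1)) (2 * ρ + 1))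
      (s := (Λ : Set (Space (k + 1)))) (SetLike.isDiscrete_iff_discreteTopology.2 ‹_›) Metric.isBounded_closedBall hcl
    rwa [Set.inter_comm]
  set s := hfin.toFinset.erase 0 with hs
  set M := 2 * ρ * (ballVol k * ρ ^ k) with hM
  have hM0 : 0 ≤ M := by have := ballVol_pos k; positivity
  -- The constant is that of ε√(2ε) for ε = ‖z‖/(2ρ). The radius bound 2ρ gives ε ≤ 1; the bound 1
  -- ensures that only the finitely many centres in `s` contribute.
  refine ⟨s.card * (M * ((2 * ρ)⁻¹ * √(ρ⁻¹))), min 1 (2 * ρ), by positivity,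
    lt_min one_pos (by positivity), fun z hz => ?_⟩
  have hz1 : ‖z‖ ≤ 1 := hz.trans (min_le_left _ _)
  have hz2 : ‖z‖ ≤ 2 * ρ := hz.trans (min_le_right _ _)
  have hsub : Metric.ball (0 : Space (k + 1)) ρ ∩ {y | y + z ∈ puncturedBalls Λ ρ} ⊆
      ⋃ q ∈ s, Metric.ball (0 : Space (k + 1)) ρ ∩ Metric.ball (q - z) ρ := by
    rintro y ⟨hy, hy'⟩
    obtain ⟨q, hq, h0, hd⟩ := mem_puncturedBalls.1 hy'
    rw [dist_eq_norm] at hd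
    refine Set.mem_biUnion (x := q) ?_ ⟨hy, ?_⟩
    · rw [Finset.mem_coe, hs, Finset.mem_erase, Set.Finite.mem_toFinset, Set.mem_inter_iff, mem_closedBall_zero_iff]
      refine ⟨h0, hq, ?_⟩
      rw [mem_ball_zero_iff] at hy
      have h2 : ‖q‖ ≤ ‖y‖ + ‖z‖ + ‖(y + z) - q‖ := by
        calc ‖q‖ = ‖y + z - (y + z - q)‖ := by rw [sub_sub_cancel]
          _ ≤ ‖y + z‖ + ‖y + z - q‖ := norm_sub_le _ _
          _ ≤ _ := by gcongr; exact norm_add_le _ _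
      linarith
    · rw [mem_ball_iff_norm, sub_sub_eq_add_sub]
      exact hd
  calc crossOverlap Λ ρ z ≤ volume.real (⋃ q ∈ s, Metric.ball (0 : Space (k + 1)) ρ ∩ Metric.ball (q - z) ρ) := by
        refine measureReal_mono hsub (ne_top_of_le_ne_top
          (measure_ball_lt_top (μ := volume) (x := (0 : Space (k + 1))) (r := ρ)).ne (measure_mono ?_))
        exact Set.iUnion₂_subset fun _ _ => Set.inter_subset_left
    _ ≤ ∑ q ∈ s, overlap ρ (q - z) := measureReal_biUnion_finset_le _ _
    _ ≤ ∑ q ∈ s, M * ((2 * ρ)⁻¹ * √(ρ⁻¹)) * (‖z‖ * √‖z‖) := by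
        refine Finset.sum_le_sum fun q hq => ?_
        rw [hs, Finset.mem_erase, Set.Finite.mem_toFinset] at hq
        rw [overlap_eq hk hρ, mul_assoc M]
        refine mul_le_mul_of_nonneg_left ?_ hM0
        have hq2 := h.two_mul_le_norm hq.2.1 hq.1
        have hle : 1 - ‖z‖ / (2 * ρ) ≤ ‖q - z‖ / (2 * ρ) := by
          rw [le_div_iff₀ (by positivity), sub_mul, div_mul_cancel₀ _ (by positivity), one_mul]
          have := norm_sub_norm_le q z
          linarith
        refine (capTail_antitone hle).trans ((capTail_le hk (by positivity) ?_).trans_eq ?_)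
        · rw [div_le_one (by positivity)]
          exact hz2
        · rw [show 2 * (‖z‖ / (2 * ρ)) = ρ⁻¹ * ‖z‖ by field_simp, Real.sqrt_mul (by positivity)]
          ring
    _ = _ := by rw [Finset.sum_const, nsmul_eq_mul]; ring

/-! ### The energy of lattice balls -/

theorem integrable_norm_pow_inv {d : ℕ} (hd : d ≠ 0) {r : ℝ} (hr : 0 < r) :
    Integrable (fun z : Space d => (Set.Ioi r).indicator (fun s => (s ^ (d + 1))⁻¹) ‖z‖) ∧
    ∫ z : Space d, (Set.Ioi r).indicator (fun s => (s ^ (d + 1))⁻¹) ‖z‖ = d * ballVol d * r⁻¹ := by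
  have := nontrivial_space hd
  obtain ⟨h1, h2⟩ := integral_inv_sq_Ioi hr
  have e : ∀ y : ℝ, y ∈ Set.Ioi 0 → y ^ (d - 1) • (Set.Ioi r).indicator (fun s => (s ^ (d + 1))⁻¹) y =
      (Set.Ioi r).indicator (fun s => (s ^ 2)⁻¹) y := by
    intro y hy
    by_cases hyr : y ∈ Set.Ioi r
    · have hy0 : y ≠ 0 := (Set.mem_Ioi.1 hy).ne'
      rw [Set.indicator_of_mem hyr, Set.indicator_of_mem hyr, smul_eq_mul,
        show d + 1 = (d - 1) + 2 by omega, pow_add]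
      field_simp
    · rw [Set.indicator_of_notMem hyr, Set.indicator_of_notMem hyr, smul_zero]
  have hs : Set.Ioi r ∩ Set.Ioi 0 = Set.Ioi r := by
    rw [Set.Ioi_inter_Ioi, max_eq_left hr.le]
  constructor
  · rw [integrable_fun_norm_addHaar, finrank_euclideanSpace_fin,
      integrableOn_congr_fun e measurableSet_Ioi]
    rw [IntegrableOn, integrable_indicator_iff measurableSet_Ioi, IntegrableOn,
      Measure.restrict_restrict measurableSet_Ioi, hs]
    exact h1
  · rw [integral_fun_norm_addHaar, finrank_euclideanSpace_fin,
      setIntegral_congr_fun measurableSet_Ioi e, setIntegral_indicator measurableSet_Ioi,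
      Set.inter_comm, hs, h2]
    simp [ballVol, mul_assoc]

theorem integrable_norm_sqrt {d : ℕ} (hd : d ≠ 0) (r : ℝ) :
    Integrable (fun z : Space d =>
      (Set.Iic r).indicator (fun s => s * √s * (s ^ (d + 1))⁻¹) ‖z‖) := by
  have := nontrivial_space hd
  have e : ∀ y : ℝ, y ∈ Set.Ioi 0 →
      y ^ (d - 1) • (Set.Iic r).indicator (fun s => s * √s * (s ^ (d + 1))⁻¹) y =
      (Set.Iic r).indicator (fun s => s ^ (-(1 / 2) : ℝ)) y := by
    intro y hy
    by_cases hyr : y ∈ Set.Iic r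
    · have hy0 : 0 < y := Set.mem_Ioi.1 hy
      rw [Set.indicator_of_mem hyr, Set.indicator_of_mem hyr, smul_eq_mul,
        show d + 1 = (d - 1) + 2 by omega, pow_add, Real.rpow_neg hy0.le, ← Real.sqrt_eq_rpow]
      have := Real.sqrt_pos.2 hy0
      field_simp
      rw [Real.sq_sqrt hy0.le]
    · rw [Set.indicator_of_notMem hyr, Set.indicator_of_notMem hyr, smul_zero]
  rw [integrable_fun_norm_addHaar, finrank_euclideanSpace_fin,
      integrableOn_congr_fun e measurableSet_Ioi, IntegrableOn, integrable_indicator_iff measurableSet_Iic, IntegrableOn,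
      Measure.restrict_restrict measurableSet_Iic, Set.inter_comm, Set.Ioi_inter_Iic]
  rcases le_total 0 r with h | h
  · exact (intervalIntegrable_iff_integrableOn_Ioc_of_le h).1
      (intervalIntegral.intervalIntegrable_rpow' (by norm_num))
  · rw [Set.Ioc_eq_empty h.not_gt, Measure.restrict_empty]
    exact integrable_zero_measure

theorem IsPacking.integrable_crossOverlap {k : ℕ} (hk : k ≠ 0) {Λ : Submodule ℤ (Space (k + 1))}
    [DiscreteTopology Λ] {ρ : ℝ} (hρ : 0 < ρ) (h : IsPacking Λ ρ) :
    Integrable fun z : Space (k + 1) => crossOverlap Λ ρ z * (‖z‖ ^ (k + 2))⁻¹ := by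
  obtain ⟨c, r, hc, hr, hb⟩ := h.exists_crossOverlap_le hk hρ
  set V := volume.real (Metric.ball (0 : Space (k + 1)) ρ)
  refine Integrable.mono' (((integrable_norm_sqrt k.succ_ne_zero r).const_mul c).add
    ((integrable_norm_pow_inv k.succ_ne_zero hr).1.const_mul V))
    ((measurable_crossOverlap Λ ρ).mul (by fun_prop)).aestronglyMeasurable (ae_of_all _ fun z => ?_)
  have hn : 0 ≤ (‖z‖ ^ (k + 2))⁻¹ := by positivity
  rw [Real.norm_of_nonneg (mul_nonneg (crossOverlap_nonneg _ _ _) hn), Pi.add_apply]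
  rcases le_or_gt ‖z‖ r with hz | hz
  · rw [Set.indicator_of_mem (Set.mem_Iic.2 hz), Set.indicator_of_notMem (Set.notMem_Ioi.2 hz), mul_zero, add_zero,
      ← mul_assoc]
    exact mul_le_mul_of_nonneg_right (hb z hz) hn
  · rw [Set.indicator_of_notMem (Set.notMem_Iic.2 hz), Set.indicator_of_mem (Set.mem_Ioi.2 hz), mul_zero, zero_add]
    exact mul_le_mul_of_nonneg_right (crossOverlap_le _ _ _) hn

/-- The contribution of distinct balls to the energy of lattice balls. -/
noncomputable def crossIntegral {d : ℕ} (Λ : Submodule ℤ (Space d)) (ρ : ℝ) : ℝ :=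
  ∫ z, crossOverlap Λ ρ z * (‖z‖ ^ (d + 1))⁻¹

theorem IsPacking.crossOverlap_zero {d : ℕ} {Λ : Submodule ℤ (Space d)} {ρ : ℝ} (h : IsPacking Λ ρ) :
    crossOverlap Λ ρ 0 = 0 :=
  crossOverlap_eq_zero (m := 2 * ρ) (fun _ hq h0 => h.two_mul_le_norm hq h0) (by simp)

theorem hasDerivAt_capTail (k : ℕ) (s : ℝ) : HasDerivAt (capTail k) (-capPow k s) s :=
  intervalIntegral.integral_hasDerivAt_left (intervalIntegrable_capPow k _ _)
    ((continuous_capPow k).stronglyMeasurableAtFilter _ _) (continuous_capPow k).continuousAt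

/-- Only the self-overlap contributes, as `capTail k` has derivative -1 at 0; the cross term is
O(t^(3/2)) along the ray. -/
theorem IsPacking.originSlope_eq {k : ℕ} (hk : k ≠ 0) {Λ : Submodule ℤ (Space (k + 1))}
    [DiscreteTopology Λ] {ρ : ℝ} (hρ : 0 < ρ) (h : IsPacking Λ ρ) (z : Space (k + 1)) :
    originSlope (fun z => overlap ρ z + crossOverlap Λ ρ z) z = -(ballVol k * ρ ^ k * ‖z‖) := by
  obtain ⟨c, r, hc, hr, hb⟩ := h.exists_crossOverlap_le hk hρ
  have hcross : HasDerivWithinAt (fun t : ℝ => crossOverlap Λ ρ (t • z)) 0 (Set.Ici 0) 0 := by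
    rw [hasDerivWithinAt_iff_isLittleO]
    simp only [sub_zero, smul_zero, zero_smul, h.crossOverlap_zero]
    have hO : (fun t : ℝ => crossOverlap Λ ρ (t • z)) =O[𝓝[Set.Ici 0] 0]
        fun t => t * (‖z‖ * √‖t • z‖) := by
      refine Asymptotics.IsBigO.of_bound c ?_
      have hev : ∀ᶠ t : ℝ in 𝓝[Set.Ici 0] 0, ‖t • z‖ < r := by
        refine nhdsWithin_le_nhds (((continuous_id.smul continuous_const).norm).continuousAt.eventually_lt
          continuousAt_const ?_)
        simpa using hr
      filter_upwards [hev, self_mem_nhdsWithin] with t ht ht0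
      have ht0 : 0 ≤ t := ht0
      rw [Real.norm_of_nonneg (crossOverlap_nonneg _ _ _), Real.norm_of_nonneg (by positivity)]
      refine (hb _ ht.le).trans_eq ?_
      rw [norm_smul, Real.norm_of_nonneg ht0]
      ring
    refine hO.trans_isLittleO ?_
    have hlim : (fun t : ℝ => ‖z‖ * √‖t • z‖) =o[𝓝[Set.Ici 0] 0] (fun _ : ℝ => (1 : ℝ)) := by
      rw [Asymptotics.isLittleO_one_iff]
      have : Continuous fun t : ℝ => ‖z‖ * √‖t • z‖ := by fun_prop
      have h0 := this.tendsto 0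
      simp only [zero_smul, norm_zero, Real.sqrt_zero, mul_zero] at h0
      exact h0.mono_left nhdsWithin_le_nhds
    simpa using (Asymptotics.isBigO_refl (fun t : ℝ => t) (𝓝[Set.Ici 0] 0)).mul_isLittleO hlim
  have hself : HasDerivWithinAt (fun t : ℝ => 2 * ρ * (ballVol k * ρ ^ k) * capTail k (t * (‖z‖ / (2 * ρ))))
      (2 * ρ * (ballVol k * ρ ^ k) * (-1 * (‖z‖ / (2 * ρ)))) (Set.Ici 0) 0 := by
    have h1 : HasDerivAt (fun t : ℝ => t * (‖z‖ / (2 * ρ))) (‖z‖ / (2 * ρ)) 0 := by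
      simpa using (hasDerivAt_id (0 : ℝ)).mul_const (‖z‖ / (2 * ρ))
    have h2 : HasDerivAt (capTail k) (-1) (0 * (‖z‖ / (2 * ρ))) := by
      rw [zero_mul]
      exact (hasDerivAt_capTail k 0).congr_deriv (by simp [capPow])
    exact ((h2.comp 0 h1).const_mul _).hasDerivWithinAt
  have heq : ∀ t ∈ Set.Ici (0 : ℝ), overlap ρ (t • z) + crossOverlap Λ ρ (t • z) =
      2 * ρ * (ballVol k * ρ ^ k) * capTail k (t * (‖z‖ / (2 * ρ))) + crossOverlap Λ ρ (t • z) := by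
    intro t ht
    rw [overlap_eq hk hρ, norm_smul, Real.norm_of_nonneg ht, mul_div_assoc]
  have hsum := ((hself.add hcross).congr heq (heq 0 (Set.mem_Ici.2 le_rfl))).derivWithin
    (uniqueDiffOn_Ici 0 0 (Set.mem_Ici.2 le_rfl))
  rw [originSlope, hsum]
  field_simp
  ring

theorem energy_latticeBalls {k : ℕ} (hk : k ≠ 0) {Λ : Submodule ℤ (Space (k + 1))}
    [DiscreteTopology Λ] [IsZLattice ℝ Λ] (hcov : ZLattice.covolume Λ = 1) {ρ : ℝ} (hρ : 0 < ρ)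
    (h : IsPacking Λ ρ) {a : ℝ} (ha : 0 < a) :
    setEnergy (latticeBalls (a • Λ) (a * ρ)) =
      ((a⁻¹ * ((k + 1) * ballVol (k + 1) * (ballVol k * ρ ^ k) * (capDefect k - 1 - Real.log (2 * ρ)) +
        crossIntegral Λ ρ - (k + 1) * ballVol (k + 1) * (ballVol k * ρ ^ k) * Real.log a) : ℝ) :
        EReal) := by
  have hau := (hasAutocorrelation_latticeBalls hcov h).scale ha
  have hset : (fun x : Space (k + 1) =>
      (latticeBalls Λ ρ).indicator (fun _ => (1 : ℝ)) (a⁻¹ • x)) =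
      (latticeBalls (a • Λ) (a * ρ)).indicator fun _ => (1 : ℝ) := by
    ext x
    exact Set.indicator_eq_indicator (mem_latticeBalls_smul ha).symm rfl
  rw [hset] at hau
  set κ := ballVol k * ρ ^ k with hκ
  set C : Space (k + 1) → ℝ := fun z => overlap ρ (a⁻¹ • z) + crossOverlap Λ ρ (a⁻¹ • z) with hC
  have hslope : ∀ z, originSlope C z = -(κ * a⁻¹ * ‖z‖) := fun z => by
    rw [hC, originSlope_scale (fun z : Space (k + 1) => overlap ρ z + crossOverlap Λ ρ z),
      h.originSlope_eq hk hρ, norm_smul, Real.norm_of_nonneg (inv_pos.2 ha).le, mul_assoc κ]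
  -- The diameter of the rescaled balls: the self-overlap is `capTail k` of ‖z‖/A, so the radial
  -- part is the regularized integral of `capTail k` scaled by A, and log A splits into log(2ρ) +
  -- log a.
  set A := 2 * ρ * a with hA
  have hA0 : 0 < A := by positivity
  obtain ⟨r1, r2⟩ := regIntegral_capTail hk
  obtain ⟨s1, s2⟩ := regIntegral_scale r1 hA0
  rw [r2, one_mul] at s2
  rw [one_mul] at s1
  set f : ℝ → ℝ := fun s => capTail k (A⁻¹ * s) with hf
  set g : ℝ → ℝ := fun s => 2 * ρ * κ * (regDensity f A⁻¹ s * (s ^ k)⁻¹) with hg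
  have hgs : ∀ y ∈ Set.Ioi (0 : ℝ), y ^ (k + 1 - 1) • g y = 2 * ρ * κ * regDensity f A⁻¹ y := by
    intro y hy
    have hy0 : y ≠ 0 := (Set.mem_Ioi.1 hy).ne'
    rw [hg, smul_eq_mul, Nat.add_sub_cancel]
    field_simp
  have g1 : Integrable fun z : Space (k + 1) => g ‖z‖ := by
    rw [integrable_fun_norm_addHaar, finrank_euclideanSpace_fin,
      integrableOn_congr_fun hgs measurableSet_Ioi]
    exact s1.const_mul _
  have g2 : ∫ z : Space (k + 1), g ‖z‖ =
      (k + 1) * ballVol (k + 1) * (2 * ρ * κ * regIntegral f A⁻¹) := by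
    rw [integral_fun_norm_addHaar, finrank_euclideanSpace_fin,
      setIntegral_congr_fun measurableSet_Ioi hgs, integral_const_mul, regIntegral]
    simp [ballVol, mul_assoc]
  have hx : ∀ z : Space (k + 1), crossOverlap Λ ρ (a⁻¹ • z) * (‖z‖ ^ (k + 2))⁻¹ =
      (a ^ (k + 2))⁻¹ * (crossOverlap Λ ρ (a⁻¹ • z) * (‖a⁻¹ • z‖ ^ (k + 2))⁻¹) := fun z => by
    rw [norm_smul, norm_inv, Real.norm_of_nonneg ha.le, mul_pow, mul_inv, inv_pow, inv_inv]
    field_simp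
  have x1 : Integrable fun z : Space (k + 1) => crossOverlap Λ ρ (a⁻¹ • z) * (‖z‖ ^ (k + 2))⁻¹ := by
    simp only [hx]
    exact ((h.integrable_crossOverlap hk hρ).comp_smul (inv_pos.2 ha).ne').const_mul _
  have x2 : ∫ z : Space (k + 1), crossOverlap Λ ρ (a⁻¹ • z) * (‖z‖ ^ (k + 2))⁻¹ =
      a⁻¹ * crossIntegral Λ ρ := by
    simp only [hx]
    rw [integral_const_mul, Measure.integral_comp_inv_smul_of_nonneg volume
      (fun z : Space (k + 1) => crossOverlap Λ ρ z * (‖z‖ ^ (k + 2))⁻¹) ha.le,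
      finrank_euclideanSpace_fin, smul_eq_mul, crossIntegral, ← mul_assoc]
    congr 1
    field_simp
    ring
  have hdens : energyDensity (kernel (k + 1)) C =ᵐ[volume] fun z => g ‖z‖ +
      crossOverlap Λ ρ (a⁻¹ • z) * (‖z‖ ^ (k + 2))⁻¹ := by
    have := nontrivial_space k.succ_ne_zero
    have hne : ∀ᵐ z : Space (k + 1), z ≠ 0 := by simp [ae_iff, measure_singleton]
    filter_upwards [hne] with z hz
    have hz0 : ‖z‖ ≠ 0 := norm_ne_zero_iff.2 hz
    have e1 : C z = 2 * ρ * κ * f ‖z‖ + crossOverlap Λ ρ (a⁻¹ • z) := by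
      rw [hC]
      simp only
      rw [overlap_eq hk hρ, norm_smul, norm_inv, Real.norm_of_nonneg ha.le, hf, hA]
      congr 3
      field_simp
    have e2 : C 0 = 2 * ρ * κ * f 0 := by
      rw [hC]
      simp only [smul_zero]
      rw [overlap_eq hk hρ, h.crossOverlap_zero, norm_zero, zero_div, hf, add_zero]
      simp only [mul_zero, hκ]
    have e3 : (Metric.ball (0 : Space (k + 1)) 1).indicator (originSlope C) z =
        -(2 * ρ * κ * (Set.Iio (1 : ℝ)).indicator (fun s => A⁻¹ * s) ‖z‖) := by
      simp only [Set.indicator, mem_ball_zero_iff, Set.mem_Iio, hslope, hA]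
      split_ifs
      · field_simp
      · simp
    rw [energyDensity, e1, e2, e3, kernel, hg]
    simp only [regDensity]
    field_simp
    ring
  have hi : Integrable (energyDensity (kernel (k + 1)) C) := (g1.add x1).congr hdens.symm
  rw [setEnergy, energy_of_integrable hau hi, integral_congr_ae hdens, integral_add g1 x1, x2, g2, s2]
  rw [hA, show 2 * ρ * a = (2 * ρ) * a by ring, Real.log_mul (by positivity) ha.ne']
  congr 1
  field_simp
  ring

/-! ### Minimization over the scale -/

/-- The critical scale is a = exp(1 + E/S); global minimality is the inequality x + 1 ≤ exp x. -/
theorem isLeast_scale (E : ℝ) {S : ℝ} (hS : 0 < S) :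
    IsLeast ((fun a => a⁻¹ * (E - S * Real.log a)) '' Set.Ioi 0) (-(S * Real.exp (-1 - E / S))) := by
  constructor
  · refine ⟨Real.exp (1 + E / S), Real.exp_pos _, ?_⟩
    simp only [Real.log_exp, ← Real.exp_neg]
    rw [show -(1 + E / S) = -1 - E / S by ring, mul_add, mul_div_cancel₀ _ hS.ne']
    ring
  · rintro _ ⟨a, ha, rfl⟩
    have ha : 0 < a := ha
    have h1 := Real.add_one_le_exp (Real.log a - E / S - 1)
    rw [show Real.log a - E / S - 1 = Real.log a + (-1 - E / S) by ring, Real.exp_add,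
      Real.exp_log ha] at h1
    have h2 : S * (Real.log a - E / S) ≤ S * (a * Real.exp (-1 - E / S)) :=
      mul_le_mul_of_nonneg_left (by linarith) hS.le
    rw [mul_sub, mul_div_cancel₀ _ hS.ne'] at h2
    simp only
    rw [inv_mul_eq_div, le_div_iff₀ ha]
    linarith

theorem isLeast_coe {s : Set ℝ} {x : ℝ} (h : IsLeast s x) :
    IsLeast ((fun y : ℝ => (y : EReal)) '' s) (x : EReal) :=
  ⟨⟨x, h.1, rfl⟩, by
    rintro _ ⟨y, hy, rfl⟩
    exact EReal.coe_le_coe_iff.2 (h.2 hy)⟩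

/-- The minimal energy of stripes of volume fraction `lam` in dimension `k + 1`. -/
noncomputable def stripeValue (k : ℕ) (lam : ℝ) : ℝ :=
  -(2 * ballVol k * Real.exp (capDefect k - 1 - regIntegral (stripeProfile lam) 1))

theorem isLeast_stripeEnergies {k : ℕ} (hk : k ≠ 0) {lam : ℝ} (h0 : 0 < lam) (h1 : lam < 1) :
    IsLeast (stripeEnergies (k + 1) lam) (stripeValue k lam : EReal) := by
  have hS : 0 < 2 * ballVol k := by have := ballVol_pos k; positivity
  have h := isLeast_coe (isLeast_scale
    (2 * ballVol k * (regIntegral (stripeProfile lam) 1 - capDefect k)) hS)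
  rw [mul_div_cancel_left₀ _ hS.ne'] at h
  have e : -1 - (regIntegral (stripeProfile lam) 1 - capDefect k) =
      capDefect k - 1 - regIntegral (stripeProfile lam) 1 := by ring
  rw [e] at h
  convert! h using 1
  ext x
  rw [Set.image_image]
  constructor
  · rintro ⟨d₀, d₁, hd₀, hd₁, hl, rfl⟩
    have hd : 0 < d₀ + d₁ := by positivity
    refine ⟨d₀ + d₁, hd, ?_⟩
    have e0 : (d₀ + d₁) * lam = d₀ := by rw [← hl]; field_simp
    have e1 : (d₀ + d₁) * (1 - lam) = d₁ := by rw [mul_sub, e0]; ring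
    simp only
    rw [← energy_stripes hk h0 h1 hd, e0, e1]
  · rintro ⟨a, ha, rfl⟩
    have ha : 0 < a := ha
    refine ⟨a * lam, a * (1 - lam), by positivity, mul_pos ha (by linarith), ?_,
      (energy_stripes hk h0 h1 ha).symm⟩
    rw [← mul_add, add_sub_cancel, mul_one, mul_div_cancel_left₀ _ ha.ne']

/-- The minimal energy of balls of volume fraction `lam` on rescalings of the lattice `Λ`, where
`ρ` is the radius of the balls at unit covolume. -/
noncomputable def ballValue {k : ℕ} (Λ : Submodule ℤ (Space (k + 1))) (ρ lam : ℝ) : ℝ :=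
  -(2 * (k + 1) * ballVol k * lam * Real.exp (-(capDefect k) -
    crossIntegral Λ ρ / ((k + 1) * ballVol (k + 1) * (ballVol k * ρ ^ k))))

/-- After division by the scale a, the volume fraction determines the radius uniquely, so the
admissible configurations form a one-parameter family in a. The factor 2ρ in `ballValue`'s prefactor
comes out of exp(log(2ρ)) and combines with ρ ^ k to lam. -/
theorem isLeast_ballEnergies {k : ℕ} (hk : k ≠ 0) {Λ : Submodule ℤ (Space (k + 1))}
    [DiscreteTopology Λ] [IsZLattice ℝ Λ] (hcov : ZLattice.covolume Λ = 1) {ρ : ℝ} (hρ : 0 < ρ)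
    (hp : IsPacking Λ ρ) {lam : ℝ} (hl : ρ ^ (k + 1) * ballVol (k + 1) = lam) :
    IsLeast (ballEnergies Λ lam) (ballValue Λ ρ lam : EReal) := by
  have hω := ballVol_pos k
  have hω' := ballVol_pos (k + 1)
  have hS : 0 < (k + 1) * ballVol (k + 1) * (ballVol k * ρ ^ k) := by positivity
  have h := isLeast_coe (isLeast_scale
    ((k + 1) * ballVol (k + 1) * (ballVol k * ρ ^ k) * (capDefect k - 1 - Real.log (2 * ρ)) +
        crossIntegral Λ ρ) hS)
  have e : -((k + 1) * ballVol (k + 1) * (ballVol k * ρ ^ k) * Real.exp (-1 -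
      ((k + 1) * ballVol (k + 1) * (ballVol k * ρ ^ k) * (capDefect k - 1 - Real.log (2 * ρ)) +
        crossIntegral Λ ρ) / ((k + 1) * ballVol (k + 1) * (ballVol k * ρ ^ k)))) =
      ballValue Λ ρ lam := by
    rw [ballValue, add_div, mul_div_cancel_left₀ _ hS.ne', ← hl, show ∀ x : ℝ,
      -1 - (capDefect k - 1 - Real.log (2 * ρ) + x) = Real.log (2 * ρ) + (-capDefect k - x) by
      intro x; ring, Real.exp_add, Real.exp_log (by positivity)]
    ring
  rw [e] at h
  have hvol : ∀ a : ℝ, 0 < a → ∀ r : ℝ, 0 ≤ r → volume.real (Metric.ball (0 : Space (k + 1)) (a * r)) /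
      ZLattice.covolume (a • Λ) = r ^ (k + 1) * ballVol (k + 1) := fun a ha r hr => by
    rw [covolume_smul Λ ha, hcov, volume_real_ball k.succ_ne_zero _ (by positivity)]
    field_simp
    exact mul_pow a r (k + 1)
  convert! h using 1
  ext x
  rw [Set.image_image]
  constructor
  · rintro ⟨a, r, ha, hr, hpack, hv, rfl⟩
    obtain ⟨s, rfl⟩ : ∃ s, r = a * s := ⟨r / a, by field_simp⟩
    have hs : 0 < s := pos_of_mul_pos_right hr ha.le
    rw [hvol a ha s hs.le, ← hl] at hv
    have hsr : s = ρ := by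
      have := mul_right_cancel₀ hω'.ne' hv
      exact (pow_left_inj₀ hs.le hρ.le k.succ_ne_zero).1 this
    refine ⟨a, ha, ?_⟩
    simp only
    rw [hsr, energy_latticeBalls hk hcov hρ hp ha]
  · rintro ⟨a, ha, rfl⟩
    have ha : 0 < a := ha
    exact ⟨a, a * ρ, ha, by positivity, (isPacking_smul ha).2 hp, (hvol a ha ρ hρ.le).trans hl,
      (energy_latticeBalls hk hcov hρ hp ha).symm⟩

theorem exists_isPacking_of_nonempty {k : ℕ} {Λ : Submodule ℤ (Space (k + 1))}
    [DiscreteTopology Λ] [IsZLattice ℝ Λ] (hcov : ZLattice.covolume Λ = 1) {lam : ℝ}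
    (h : (ballEnergies Λ lam).Nonempty) :
    ∃ ρ : ℝ, 0 < ρ ∧ IsPacking Λ ρ ∧ ρ ^ (k + 1) * ballVol (k + 1) = lam := by
  obtain ⟨_, a, r, ha, hr, hpack, hv, rfl⟩ := h
  obtain ⟨s, rfl⟩ : ∃ s, r = a * s := ⟨r / a, by field_simp⟩
  have hs : 0 < s := pos_of_mul_pos_right hr ha.le
  refine ⟨s, hs, (isPacking_smul ha).1 hpack, ?_⟩
  rw [← hv, covolume_smul Λ ha, hcov, volume_real_ball k.succ_ne_zero _ (by positivity), Nat.succ_eq_add_one,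
    mul_pow]
  field_simp

/-! ### Balls beat stripes at small volume fraction -/

/-- Forgetting all other stripes leaves the profile max(lam - s, 0), which is below the periodic one
with the same value at 0. It is a rescaled hinge, so its regularized integral is explicit. -/
theorem neg_one_sub_log_le_regIntegral_stripeProfile {lam : ℝ} (h0 : 0 < lam) (h1 : lam < 1) :
    -1 - Real.log lam ≤ regIntegral (stripeProfile lam) 1 := by
  obtain ⟨i1, e1⟩ := regIntegral_hinge
  obtain ⟨i2, e2⟩ := regIntegral_scale i1 h0
  have e3 := regIntegral_const_mul (fun s => max (1 - lam⁻¹ * s) 0) (1 * lam⁻¹) lam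
  rw [e2, e1, one_mul, one_mul, mul_inv_cancel_left₀ h0.ne', mul_inv_cancel₀ h0.ne'] at e3
  have i3 : IntegrableOn (regDensity (fun s => lam * max (1 - lam⁻¹ * s) 0) 1) (Set.Ioi 0) := by
    have h : (regDensity (fun s => lam * max (1 - lam⁻¹ * s) 0) 1) =
        fun s => lam * regDensity (fun s => max (1 - lam⁻¹ * s) 0) (1 * lam⁻¹) s := by
      ext s
      rw [← regDensity_const_mul, one_mul, mul_inv_cancel₀ h0.ne']
    rw [h]
    exact i2.const_mul lam
  rw [← e3]
  refine setIntegral_mono_on i3 (integrableOn_regDensity_stripeProfile h0 h1) measurableSet_Ioi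
    fun s hs => ?_
  have hs : 0 < s := hs
  have h2 : lam * max (1 - lam⁻¹ * s) 0 = max (lam - s) 0 := by
    rw [mul_max_of_nonneg _ _ h0.le, mul_sub, mul_inv_cancel_left₀ h0.ne', mul_one, mul_zero]
  have h3 := max_le_stripeProfile lam hs.le
  unfold regDensity
  simp only [h2, stripeProfile_zero h0 h1, mul_zero, sub_zero, max_eq_left zero_le_one, mul_one]
  gcongr

theorem exists_norm_le_of_mem {d : ℕ} (Λ : Submodule ℤ (Space d)) [DiscreteTopology Λ] :
    ∃ m : ℝ, 0 < m ∧ ∀ q ∈ Λ, q ≠ 0 → m ≤ ‖q‖ := by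
  have h : ({0} : Set Λ) ∈ 𝓝 (0 : Λ) := (isOpen_discrete _).mem_nhds rfl
  obtain ⟨m, hm, hsub⟩ := Metric.mem_nhds_iff.1 h
  refine ⟨m, hm, fun q hq h0 => le_of_not_gt fun hlt => h0 ?_⟩
  have : (⟨q, hq⟩ : Λ) ∈ Metric.ball (0 : Λ) m := by
    rw [mem_ball_zero_iff]
    exact hlt
  exact congrArg Subtype.val (hsub this)

theorem isPacking_of_le {d : ℕ} {Λ : Submodule ℤ (Space d)} {m ρ : ℝ}
    (hm : ∀ q ∈ Λ, q ≠ 0 → m ≤ ‖q‖) (h : 2 * ρ ≤ m) : IsPacking Λ ρ := by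
  intro p hp q hq hne
  have := hm _ (Λ.sub_mem hp hq) (sub_ne_zero.2 hne)
  rw [dist_eq_norm]
  linarith

/-- The cross overlap is at most the volume of one ball and vanishes for ‖z‖ ≤ m - 2ρ, so the kernel
is only integrated outside that radius. -/
theorem IsPacking.crossIntegral_le {k : ℕ} (hk : k ≠ 0) {Λ : Submodule ℤ (Space (k + 1))}
    [DiscreteTopology Λ] {ρ m : ℝ} (hρ : 0 < ρ) (hm : ∀ q ∈ Λ, q ≠ 0 → m ≤ ‖q‖)
    (h : 2 * ρ < m) : crossIntegral Λ ρ ≤ ρ ^ (k + 1) * ballVol (k + 1) *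
      ((k + 1) * ballVol (k + 1) * (m - 2 * ρ)⁻¹) := by
  have hr : 0 < m - 2 * ρ := by linarith
  obtain ⟨i, e⟩ := integrable_norm_pow_inv k.succ_ne_zero hr
  push_cast at e
  rw [← volume_real_ball k.succ_ne_zero (0 : Space (k + 1)) hρ.le, ← e, ← integral_const_mul]
  refine integral_mono ((isPacking_of_le hm h.le).integrable_crossOverlap hk hρ) (i.const_mul _)
    fun z => ?_
  rcases le_or_gt ‖z‖ (m - 2 * ρ) with hz | hz
  · simp only
    rw [crossOverlap_eq_zero hm hz, zero_mul]
    exact mul_nonneg measureReal_nonneg (Set.indicator_nonneg (fun s hs => by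
      have : 0 < s := hr.trans hs
      positivity) _)
  · simp only
    rw [Set.indicator_of_mem (Set.mem_Ioi.2 hz)]
    exact mul_le_mul_of_nonneg_right (crossOverlap_le _ _ _) (by positivity)

/-- The left side of `h5` bounds X/S, the cross term relative to the slope coefficient, once 4ρ ≤ m;
the right side is the gap left by `two_mul_capDefect_lt_log`. -/
theorem ballValue_lt_stripeValue {k : ℕ} (hk : k ≠ 0) {Λ : Submodule ℤ (Space (k + 1))}
    [DiscreteTopology Λ] {ρ m lam : ℝ} (hρ : 0 < ρ) (hm : ∀ q ∈ Λ, q ≠ 0 → m ≤ ‖q‖)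
    (h0 : 0 < lam) (h1 : lam < 1) (h4 : 4 * ρ ≤ m)
    (h5 : 2 * ρ * ballVol (k + 1) / (m * ballVol k) < Real.log (k + 1) - 2 * capDefect k) :
    ballValue Λ ρ lam < stripeValue k lam := by
  have hω := ballVol_pos k
  have hω' := ballVol_pos (k + 1)
  have hm0 : 0 < m := by linarith
  set S := (k + 1) * ballVol (k + 1) * (ballVol k * ρ ^ k) with hS
  have hS0 : 0 < S := by positivity
  have hX : crossIntegral Λ ρ / S ≤ 2 * ρ * ballVol (k + 1) / (m * ballVol k) := by
    rw [div_le_iff₀ hS0]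
    refine (IsPacking.crossIntegral_le hk hρ hm (by linarith)).trans ?_
    have hinv : (m - 2 * ρ)⁻¹ ≤ 2 * m⁻¹ := by
      rw [← div_eq_mul_inv, inv_le_comm₀ (by linarith) (by positivity), inv_div]
      linarith
    calc _ ≤ ρ ^ (k + 1) * ballVol (k + 1) * ((k + 1) * ballVol (k + 1) * (2 * m⁻¹)) := by gcongr
      _ = _ := by rw [hS, pow_succ']; field_simp
  have hH := neg_one_sub_log_le_regIntegral_stripeProfile h0 h1
  have e1 : Real.exp (capDefect k - 1 - regIntegral (stripeProfile lam) 1) ≤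
      lam * Real.exp (capDefect k) := by
    rw [← Real.exp_log h0, ← Real.exp_add, Real.exp_log h0]
    exact Real.exp_le_exp.2 (by linarith)
  have e2 : Real.exp (capDefect k) < (k + 1) * Real.exp (-capDefect k - crossIntegral Λ ρ / S) := by
    rw [← Real.exp_log (show (0 : ℝ) < k + 1 by positivity), ← Real.exp_add]
    exact Real.exp_lt_exp.2 (by linarith)
  rw [ballValue, stripeValue, neg_lt_neg_iff]
  calc 2 * ballVol k * Real.exp (capDefect k - 1 - regIntegral (stripeProfile lam) 1)
      ≤ 2 * ballVol k * (lam * Real.exp (capDefect k)) := by gcongr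
    _ < 2 * ballVol k * (lam * ((k + 1) * Real.exp (-capDefect k - crossIntegral Λ ρ / S))) := by
      gcongr
    _ = _ := by ring

theorem exists_balls_beat_stripes {k : ℕ} (hk : k ≠ 0) (Λ : Submodule ℤ (Space (k + 1)))
    [DiscreteTopology Λ] [IsZLattice ℝ Λ] (hcov : ZLattice.covolume Λ = 1) :
    ∃ lam₀ : ℝ, 0 < lam₀ ∧ ∀ lam : ℝ, 0 < lam → lam < lam₀ →
      eB Λ lam ∈ ballEnergies Λ lam ∧ eS (k + 1) lam ∈ stripeEnergies (k + 1) lam ∧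
      eB Λ lam < eS (k + 1) lam := by
  obtain ⟨m, hm0, hm⟩ := exists_norm_le_of_mem Λ
  have hω := ballVol_pos k
  have hω' := ballVol_pos (k + 1)
  have hgap : 0 < Real.log (k + 1) - 2 * capDefect k := by
    obtain ⟨j, rfl⟩ := Nat.exists_eq_succ_of_ne_zero hk
    have := two_mul_capDefect_lt_log j
    push_cast
    rw [Nat.succ_eq_add_one]
    linarith
  set g := Real.log (k + 1) - 2 * capDefect k with hg
  -- The first entry keeps the balls well separated, the second makes the relative cross term at
  -- most half of the gap g.
  set r := min (m / 4) (g * (m * ballVol k) / (4 * ballVol (k + 1))) with hr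
  have hr0 : 0 < r := lt_min (by positivity) (by positivity)
  refine ⟨min 1 (r ^ (k + 1) * ballVol (k + 1)), lt_min one_pos (by positivity),
    fun lam h0 hlt => ?_⟩
  have h1 : lam < 1 := hlt.trans_le (min_le_left _ _)
  have h2 : lam < r ^ (k + 1) * ballVol (k + 1) := hlt.trans_le (min_le_right _ _)
  set ρ := (lam / ballVol (k + 1)) ^ ((k + 1 : ℕ) : ℝ)⁻¹ with hρ
  have hρ0 : 0 < ρ := by positivity
  have hpow : ρ ^ (k + 1) = lam / ballVol (k + 1) :=
    Real.rpow_inv_natCast_pow (by positivity) k.succ_ne_zero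
  have hl : ρ ^ (k + 1) * ballVol (k + 1) = lam := by rw [hpow]; field_simp
  have hρr : ρ < r := by
    refine lt_of_pow_lt_pow_left₀ (k + 1) hr0.le ?_
    rw [hpow, div_lt_iff₀ hω']
    exact h2
  have hρ1 : ρ ≤ m / 4 := hρr.le.trans (min_le_left _ _)
  have hρ2 : ρ ≤ g * (m * ballVol k) / (4 * ballVol (k + 1)) := hρr.le.trans (min_le_right _ _)
  have hB := isLeast_ballEnergies hk hcov hρ0 (isPacking_of_le hm (by linarith)) hl
  have hS := isLeast_stripeEnergies hk h0 h1
  refine ⟨hB.csInf_mem, hS.csInf_mem, ?_⟩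
  rw [eB, eS, hB.csInf_eq, hS.csInf_eq, EReal.coe_lt_coe_iff]
  refine ballValue_lt_stripeValue hk hρ0 hm h0 h1 (by linarith) ?_
  rw [div_lt_iff₀ (by positivity)]
  rw [le_div_iff₀ (by positivity)] at hρ2
  have : 0 < g * (m * ballVol k) := by positivity
  linarith

/-! ### Stripes with volume fraction close to one half -/

theorem integral_affine_div_sq {a b : ℝ} (ha : 0 < a) (hab : a ≤ b) (c e : ℝ) :
    ∫ s in a..b, (c * s + e) / s ^ 2 = c * Real.log (b / a) + e * (a⁻¹ - b⁻¹) := by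
  have hpos : ∀ s ∈ Set.uIcc a b, 0 < s := fun s hs => by
    rw [Set.uIcc_of_le hab] at hs
    exact ha.trans_le hs.1
  rw [intervalIntegral.integral_eq_sub_of_hasDerivAt (f := fun s => c * Real.log s - e * s⁻¹)]
  · rw [Real.log_div (hpos b Set.right_mem_uIcc).ne' ha.ne']
    ring
  · intro s hs
    have h0 := (hpos s hs).ne'
    convert! ((Real.hasDerivAt_log h0).const_mul c).sub ((hasDerivAt_inv h0).const_mul e) using 1
    field_simp
    ring
  · refine ContinuousOn.intervalIntegrable fun s hs => ?_
    have h0 := (hpos s hs).ne'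
    exact ContinuousAt.continuousWithinAt (by fun_prop (disch := positivity))

theorem stripeProfile_half (s : ℝ) : stripeProfile (1 / 2) s = |Int.fract s - 1 / 2| := by
  rw [stripeProfile]
  rcases le_total (Int.fract s) (1 / 2) with h | h
  · rw [max_eq_left (by linarith), max_eq_right (by linarith), abs_of_nonpos (by linarith)]
    ring
  · rw [max_eq_right (by linarith), max_eq_left (by linarith), abs_of_nonneg (by linarith)]
    ring

/-- On [n, n + 1] the profile is a tent with its kink at n + 1/2. The reciprocal terms of the two
affine pieces cancel, leaving the logarithm of a factor of Wallis type. -/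
theorem integral_regDensity_stripeProfile_half_step {n : ℝ} (hn : ∃ j : ℤ, n = j) (h1 : 1 ≤ n) :
    ∫ s in n..(n + 1), regDensity (stripeProfile (1 / 2)) 1 s =
      Real.log (2 * n * (2 * n + 2) / (2 * n + 1) ^ 2) := by
  obtain ⟨j, hj⟩ := hn
  have hz : stripeProfile (1 / 2) 0 = 1 / 2 := stripeProfile_zero (by norm_num) (by norm_num)
  have hi : ∀ a b : ℝ, 0 ≤ a → a ≤ b →
      IntervalIntegrable (regDensity (stripeProfile (1 / 2)) 1) volume a b := fun a b ha hb => by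
    rw [intervalIntegrable_iff_integrableOn_Ioc_of_le hb]
    exact (integrableOn_regDensity_stripeProfile (by norm_num) (by norm_num)).mono_set
      fun x hx => Set.mem_Ioi.2 (ha.trans_lt hx.1)
  have hd : ∀ s ∈ Set.Ioo n (n + 1), regDensity (stripeProfile (1 / 2)) 1 s =
      (|s - n - 1 / 2| - 1 / 2) / s ^ 2 := by
    intro s hs
    have hfl : ⌊s⌋ = j := Int.floor_eq_iff.2 ⟨by rw [← hj]; exact hs.1.le, by rw [← hj]; exact hs.2⟩
    have hs1 : s ∉ Set.Iio (1 : ℝ) := fun h => by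
      have := Set.mem_Iio.1 h
      linarith [hs.1]
    rw [regDensity, hz, stripeProfile_half, Set.indicator_of_notMem hs1, Int.fract, hfl, ← hj, add_zero]
  rw [← intervalIntegral.integral_add_adjacent_intervals (b := n + 1 / 2)
    (hi _ _ (by linarith) (by linarith)) (hi _ _ (by linarith) (by linarith)),
    intervalIntegral.integral_congr_Ioo_of_le (g := fun s => (-1 * s + n) / s ^ 2) (by linarith),
    intervalIntegral.integral_congr_Ioo_of_le (a := n + 1 / 2) (g := fun s => (1 * s + (-(n + 1))) / s ^ 2) (by linarith),
    integral_affine_div_sq (by linarith) (by linarith),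
    integral_affine_div_sq (by linarith) (by linarith)]
  · have e : 2 * n * (2 * n + 2) / (2 * n + 1) ^ 2 = ((n + 1) / (n + 1 / 2)) / ((n + 1 / 2) / n) := by
      field_simp
    have e' : n * (n⁻¹ - (n + 1 / 2)⁻¹) + -(n + 1) * ((n + 1 / 2)⁻¹ - (n + 1)⁻¹) = 0 := by
      field_simp
      ring
    rw [e, Real.log_div (x := (n + 1) / (n + 1 / 2)) (by positivity) (by positivity)]
    linarith
  · intro s hs
    rw [hd s ⟨by linarith [hs.1], hs.2⟩, abs_of_nonneg (by linarith [hs.1])]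
    congr 1
    ring
  · intro s hs
    rw [hd s ⟨hs.1, by linarith [hs.2]⟩, abs_of_nonpos (by linarith [hs.2])]
    congr 1
    ring

/-- The product of the factors 2n(2n + 2)/(2n + 1)² is Wallis' product with numerators and
denominators grouped differently; the factor next to `Real.Wallis.W` accounts for the regrouping and
for the first period, which contributes log 4 - 1. -/
theorem integral_regDensity_stripeProfile_half (N : ℕ) :
    ∫ s in (0 : ℝ)..(N + 1), regDensity (stripeProfile (1 / 2)) 1 s =
      Real.log (Real.Wallis.W (N + 1) * (2 * ((2 * N + 3) / (2 * N + 2)))) - 1 := by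
  have hz : stripeProfile (1 / 2) 0 = 1 / 2 := stripeProfile_zero (by norm_num) (by norm_num)
  have hi : ∀ a b : ℝ, 0 ≤ a → a ≤ b →
      IntervalIntegrable (regDensity (stripeProfile (1 / 2)) 1) volume a b := fun a b ha hb => by
    rw [intervalIntegrable_iff_integrableOn_Ioc_of_le hb]
    exact (integrableOn_regDensity_stripeProfile (by norm_num) (by norm_num)).mono_set
      fun x hx => Set.mem_Ioi.2 (ha.trans_lt hx.1)
  induction N with
  | zero =>
    have hd : ∀ s ∈ Set.Ioo (0 : ℝ) 1, regDensity (stripeProfile (1 / 2)) 1 s =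
        (|s - 1 / 2| - 1 / 2 + s) / s ^ 2 := by
      intro s hs
      rw [regDensity, hz, stripeProfile_half, Set.indicator_of_mem (Set.mem_Iio.2 hs.2),
        Int.fract_eq_self.2 ⟨hs.1.le, hs.2⟩, one_mul]
    rw [Nat.cast_zero, zero_add, ← intervalIntegral.integral_add_adjacent_intervals (b := 1 / 2)
      (hi _ _ (by norm_num) (by norm_num)) (hi _ _ (by norm_num) (by norm_num)),
      intervalIntegral.integral_congr_Ioo_of_le (g := fun s => 0) (by norm_num),
      intervalIntegral.integral_congr_Ioo_of_le (a := 1 / 2) (g := fun s => (2 * s + (-1)) / s ^ 2) (by norm_num),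
      integral_affine_div_sq (by norm_num) (by norm_num), intervalIntegral.integral_zero]
    · have e : Real.Wallis.W (0 + 1) * (2 * ((2 * 0 + 3) / (2 * 0 + 2))) = 2 ^ 2 := by
        rw [Real.Wallis.W_succ]
        norm_num [Real.Wallis.W]
      rw [e, Real.log_pow]
      norm_num
      ring
    · intro s hs
      rw [hd s ⟨by linarith [hs.1], hs.2⟩, abs_of_nonneg (by linarith [hs.1])]
      congr 1
      ring
    · intro s hs
      rw [hd s ⟨hs.1, by linarith [hs.2]⟩, abs_of_nonpos (by linarith [hs.2])]
      ring
  | succ N ih =>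
    have hN : (0 : ℝ) ≤ N := N.cast_nonneg
    push_cast
    rw [← intervalIntegral.integral_add_adjacent_intervals (b := (N : ℝ) + 1)
      (hi _ _ le_rfl (by positivity)) (hi _ _ (by positivity) (by linarith)), ih,
      integral_regDensity_stripeProfile_half_step ⟨N + 1, by push_cast; rfl⟩ (by linarith),
      sub_add_eq_add_sub, ← Real.log_mul (mul_pos (Real.Wallis.W_pos _) (by positivity)).ne' (by positivity), Real.Wallis.W_succ (N + 1)]
    congr 2
    push_cast
    field_simp
    ring

/-- The density is nonpositive beyond N + 1, so every partial integral is an upper bound, and these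
tend to log(2 · π/2) - 1. -/
theorem regIntegral_stripeProfile_half_le :
    regIntegral (stripeProfile (1 / 2)) 1 ≤ Real.log Real.pi - 1 := by
  have hint := integrableOn_regDensity_stripeProfile (lam := 1 / 2) (by norm_num) (by norm_num)
  have hle : ∀ N : ℕ, regIntegral (stripeProfile (1 / 2)) 1 ≤
      Real.log (Real.Wallis.W (N + 1) * (2 * ((2 * N + 3) / (2 * N + 2)))) - 1 := fun N => by
    have hN : (0 : ℝ) ≤ N := N.cast_nonneg
    rw [← integral_regDensity_stripeProfile_half, intervalIntegral.integral_of_le (by positivity),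
      regIntegral, ← Set.Ioc_union_Ioi_eq_Ioi (show (0 : ℝ) ≤ N + 1 by positivity),
      setIntegral_union (Set.Ioc_disjoint_Ioi le_rfl) measurableSet_Ioi
      (hint.mono_set Set.Ioc_subset_Ioi_self)
      (hint.mono_set (Set.Ioi_subset_Ioi (show (0 : ℝ) ≤ N + 1 by positivity)))]
    refine add_le_of_nonpos_right (setIntegral_nonpos measurableSet_Ioi fun s hs => ?_)
    have hs : (N : ℝ) + 1 < s := hs
    rw [regDensity, Set.indicator_of_notMem (by rw [Set.mem_Iio, not_lt]; linarith), add_zero,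
      stripeProfile_zero (by norm_num) (by norm_num)]
    have := stripeProfile_le (lam := 1 / 2) (by norm_num) (by norm_num) s
    exact div_nonpos_of_nonpos_of_nonneg (by linarith) (sq_nonneg s)
  have h1 : Tendsto (fun N : ℕ => (2 * (N : ℝ) + 3) / (2 * N + 2)) atTop (𝓝 1) := by
    have e : (fun N : ℕ => (2 * (N : ℝ) + 3) / (2 * N + 2)) =
        fun N : ℕ => 1 + (1 / 2) * (1 / ((N : ℝ) + 1)) := by
      ext N
      have : (N : ℝ) + 1 ≠ 0 := by positivity
      field_simp
      ring
    rw [e]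
    simpa using (tendsto_one_div_add_atTop_nhds_zero_nat.const_mul (1 / 2 : ℝ)).const_add 1
  have h2 := (Real.Wallis.tendsto_W_nhds_pi_div_two.comp (tendsto_add_atTop_nat 1)).mul
    (h1.const_mul 2)
  rw [mul_one, div_mul_cancel₀ _ two_ne_zero] at h2
  exact ge_of_tendsto' (((Real.continuousAt_log Real.pi_ne_zero).tendsto.comp h2).sub_const 1) hle

/-- For s ≤ 1/4 both densities coincide. Beyond, each hinge term moves by at most δ = |lam - 1/2|
and so does the value at 0, which gives 3δ/s²; the integral of 1/s² over (1/4, ∞) is 4. -/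
theorem regIntegral_stripeProfile_le {lam : ℝ} (h : |lam - 1 / 2| < 1 / 4) :
    regIntegral (stripeProfile lam) 1 ≤ Real.log Real.pi - 1 + 12 * |lam - 1 / 2| := by
  have hb := abs_lt.1 h
  have h0 : 0 < lam := by linarith
  have h1 : lam < 1 := by linarith
  set δ := |lam - 1 / 2| with hδ
  obtain ⟨c1, c2⟩ := integral_inv_sq_Ioi (a := 1 / 4) (by norm_num)
  have hint := integrableOn_regDensity_stripeProfile h0 h1
  have hint' := integrableOn_regDensity_stripeProfile (lam := 1 / 2) (by norm_num) (by norm_num)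
  have hi : IntegrableOn ((Set.Ioi (1 / 4 : ℝ)).indicator fun s => 3 * δ * (s ^ 2)⁻¹) (Set.Ioi 0) := by
    rw [IntegrableOn, integrable_indicator_iff measurableSet_Ioi]
    exact (IntegrableOn.mono_set (c1.const_mul (3 * δ)) (Set.Subset.refl _)).mono_measure
      Measure.restrict_le_self
  have hval : ∫ s in Set.Ioi (0 : ℝ), (Set.Ioi (1 / 4 : ℝ)).indicator (fun s => 3 * δ * (s ^ 2)⁻¹) s =
      12 * δ := by
    rw [setIntegral_indicator measurableSet_Ioi, Set.Ioi_inter_Ioi, max_eq_right (by norm_num),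
      integral_const_mul, c2]
    ring
  have hpt : ∀ s ∈ Set.Ioi (0 : ℝ), regDensity (stripeProfile lam) 1 s ≤
      regDensity (stripeProfile (1 / 2)) 1 s +
        (Set.Ioi (1 / 4 : ℝ)).indicator (fun s => 3 * δ * (s ^ 2)⁻¹) s := by
    intro s hs
    have hs : 0 < s := hs
    unfold regDensity
    rw [stripeProfile_zero h0 h1, stripeProfile_zero (by norm_num) (by norm_num)]
    rcases le_or_gt s (1 / 4) with hs4 | hs4
    · rw [stripeProfile_of_lt hs.le (by linarith) (by linarith),
        stripeProfile_of_lt hs.le (by linarith) (by linarith)]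
      have : 0 ≤ (Set.Ioi (1 / 4 : ℝ)).indicator (fun s => 3 * δ * (s ^ 2)⁻¹) s :=
        Set.indicator_nonneg (fun s _ => by positivity) _
      have e : lam - s - lam = 1 / 2 - s - 1 / 2 := by ring
      rw [e]
      linarith
    · have hp : stripeProfile lam s ≤ stripeProfile (1 / 2) s + 2 * δ := by
        unfold stripeProfile
        have hd := le_abs_self (lam - 1 / 2)
        have m1 : max (lam - Int.fract s) 0 ≤ max (1 / 2 - Int.fract s) 0 + δ :=
          max_le (by linarith [le_max_left (1 / 2 - Int.fract s) 0])
            (by linarith [le_max_right (1 / 2 - Int.fract s) 0, abs_nonneg (lam - 1 / 2)])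
        have m2 : max (lam - 1 + Int.fract s) 0 ≤ max (1 / 2 - 1 + Int.fract s) 0 + δ :=
          max_le (by linarith [le_max_left (1 / 2 - 1 + Int.fract s) 0])
            (by linarith [le_max_right (1 / 2 - 1 + Int.fract s) 0, abs_nonneg (lam - 1 / 2)])
        linarith
      rw [Set.indicator_of_mem (Set.mem_Ioi.2 hs4), ← div_eq_mul_inv, ← add_div]
      refine div_le_div_of_nonneg_right ?_ (sq_nonneg s)
      linarith [neg_abs_le (lam - 1 / 2)]
  calc regIntegral (stripeProfile lam) 1 ≤ regIntegral (stripeProfile (1 / 2)) 1 + 12 * δ := by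
        rw [← hval, regIntegral, regIntegral, ← integral_add hint' hi]
        exact setIntegral_mono_on hint (hint'.add hi) measurableSet_Ioi hpt
    _ ≤ _ := by linarith [regIntegral_stripeProfile_half_le]

theorem stripeValue_one_le {lam : ℝ} (h : |lam - 1 / 2| < 1 / 4) :
    stripeValue 1 lam ≤ -(2 / Real.pi * Real.exp (1 - 12 * |lam - 1 / 2|)) := by
  have h1 := regIntegral_stripeProfile_le h
  rw [stripeValue, ballVol_one, capDefect_one, neg_le_neg_iff]
  calc 2 / Real.pi * Real.exp (1 - 12 * |lam - 1 / 2|)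
      = 2 * 2 * Real.exp (-Real.log 2 - Real.log Real.pi + (1 - 12 * |lam - 1 / 2|)) := by
        rw [Real.exp_add, Real.exp_sub (-Real.log 2), Real.exp_neg, Real.exp_log two_pos,
          Real.exp_log Real.pi_pos]
        ring
    _ ≤ _ := by
        gcongr
        linarith

/-! ### Circle averages of an inverse power of the distance -/

/-- One step of Parseval's identity: with f(z) = f(0) + z g(z), the mixed term is the real part of a
holomorphic function vanishing at 0, so its circle average is zero. -/
theorem circleAverage_norm_sq_dslope {f : ℂ → ℂ} {R r : ℝ}
    (hf : DifferentiableOn ℂ f (Metric.ball 0 R)) (hr : 0 ≤ r) (hrR : r < R) :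
    Real.circleAverage (fun z => ‖f z‖ ^ 2) 0 r =
      ‖f 0‖ ^ 2 + r ^ 2 * Real.circleAverage (fun z => ‖dslope f 0 z‖ ^ 2) 0 r := by
  have hg : DifferentiableOn ℂ (dslope f 0) (Metric.ball 0 R) :=
    (Complex.differentiableOn_dslope (Metric.ball_mem_nhds 0 (hr.trans_lt hrR))).2 hf
  have hsub : Metric.sphere (0 : ℂ) r ⊆ Metric.ball 0 R := fun z hz => by
    rw [mem_sphere_zero_iff_norm] at hz
    rwa [mem_ball_zero_iff, hz]
  set L : ℂ → ℂ := fun z => (starRingEnd ℂ) (f 0) * (z * dslope f 0 z) with hL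
  have hLd : DifferentiableOn ℂ L (Metric.ball 0 R) :=
    (differentiableOn_id.mul hg).const_mul _
  have hL0 : Real.circleAverage L 0 r = 0 := by
    have hcl : DiffContOnCl ℂ L (Metric.ball 0 |r|) := by
      rw [abs_of_nonneg hr]
      exact hLd.diffContOnCl_ball (Metric.closedBall_subset_ball hrR)
    rw [hcl.circleAverage, hL]
    simp
  have hLi : CircleIntegrable L 0 r := (hLd.continuousOn.mono hsub).circleIntegrable hr
  have hRe : Real.circleAverage (fun z => (L z).re) 0 r = 0 := by
    have h := ContinuousLinearMap.circleAverage_comp_comm Complex.reCLM hLi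
    rw [hL0, map_zero] at h
    exact h
  have hgi : CircleIntegrable (fun z => ‖dslope f 0 z‖ ^ 2) 0 r :=
    (((hg.continuousOn.mono hsub).norm).pow 2).circleIntegrable hr
  have hRi : CircleIntegrable (fun z => (L z).re) 0 r :=
    (Complex.continuous_re.comp_continuousOn (hLd.continuousOn.mono hsub)).circleIntegrable hr
  have heq : Set.EqOn (fun z => ‖f z‖ ^ 2)
      (fun z => (‖f 0‖ ^ 2 + r ^ 2 • ‖dslope f 0 z‖ ^ 2) + (2 : ℝ) • (L z).re)
      (Metric.sphere 0 |r|) := by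
    intro z hz
    rw [mem_sphere_zero_iff_norm, abs_of_nonneg hr] at hz
    have h1 : f z = f 0 + z * dslope f 0 z := by
      have := sub_smul_dslope f 0 z
      rw [sub_zero, smul_eq_mul] at this
      rw [this]
      ring
    simp only
    rw [h1, ← Complex.normSq_eq_norm_sq, Complex.normSq_add, Complex.normSq_eq_norm_sq,
      Complex.normSq_eq_norm_sq, norm_mul, hz, hL]
    simp only [smul_eq_mul, Complex.mul_re, Complex.mul_im, Complex.conj_re, Complex.conj_im, map_mul]
    ring
  have i1 : CircleIntegrable (fun z => r ^ 2 • ‖dslope f 0 z‖ ^ 2) 0 r := hgi.const_smul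
  have i2 : CircleIntegrable (fun z => (2 : ℝ) • (L z).re) 0 r := hRi.const_smul
  have i3 : CircleIntegrable (fun _ : ℂ => ‖f 0‖ ^ 2) 0 r := circleIntegrable_const _ _ _
  have i4 : CircleIntegrable (fun z => ‖f 0‖ ^ 2 + r ^ 2 • ‖dslope f 0 z‖ ^ 2) 0 r := i3.add i1
  rw [Real.circleAverage_congr_sphere heq, Real.circleAverage_fun_add i4 i2,
    Real.circleAverage_fun_add i3 i1, Real.circleAverage_fun_smul, Real.circleAverage_fun_smul, hRe,
    Real.circleAverage_const]
  simp

/-- Bessel's inequality on the circle: replacing f by its difference quotient at 0 shifts the Taylor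
coefficients by one, so induction on N applies. -/
theorem sum_le_circleAverage_norm_sq {R r : ℝ} (hr : 0 ≤ r) (hrR : r < R) (N : ℕ) :
    ∀ {f : ℂ → ℂ} {p : FormalMultilinearSeries ℂ ℂ ℂ},
      DifferentiableOn ℂ f (Metric.ball 0 R) → HasFPowerSeriesAt f p 0 →
      ∑ n ∈ Finset.range N, r ^ (2 * n) * ‖p.coeff n‖ ^ 2 ≤
        Real.circleAverage (fun z => ‖f z‖ ^ 2) 0 r := by
  induction N with
  | zero =>
    intro f p _ _
    rw [Finset.sum_range_zero]
    exact Real.circleAverage_nonneg_of_nonneg fun _ _ => sq_nonneg _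
  | succ N ih =>
    intro f p hf hp
    have hg : DifferentiableOn ℂ (dslope f 0) (Metric.ball 0 R) :=
      (Complex.differentiableOn_dslope (Metric.ball_mem_nhds 0 (hr.trans_lt hrR))).2 hf
    have h := ih hg hp.has_fpower_series_dslope_fslope
    have h0 : p.coeff 0 = f 0 := hp.coeff_zero 1
    rw [circleAverage_norm_sq_dslope hf hr hrR, Finset.sum_range_succ', h0, mul_zero, pow_zero,
      one_mul, add_comm]
    refine add_le_add le_rfl ((Finset.sum_le_sum fun n _ => le_of_eq ?_).trans
      ((Finset.mul_sum _ _ _).symm.trans_le (mul_le_mul_of_nonneg_left h (sq_nonneg r))))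
    rw [FormalMultilinearSeries.coeff_fslope]
    ring

theorem binomialSeries_coeff_neg_three_halves :
    (binomialSeries ℂ (((-3 / 2 : ℝ) : ℂ))).coeff 0 = 1 ∧
    (binomialSeries ℂ (((-3 / 2 : ℝ) : ℂ))).coeff 1 = -3 / 2 ∧
    (binomialSeries ℂ (((-3 / 2 : ℝ) : ℂ))).coeff 2 = 15 / 8 := by
  have hc : ∀ n, (binomialSeries ℂ (((-3 / 2 : ℝ) : ℂ))).coeff n =
      Ring.choose (((-3 / 2 : ℝ) : ℂ)) n := fun n => by
    rw [binomialSeries, FormalMultilinearSeries.coeff_ofScalars]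
  refine ⟨?_, ?_, ?_⟩
  · rw [hc, Ring.choose_zero_right]
  · rw [hc, Ring.choose_one_right]
    push_cast
    ring
  · have h := Ring.descPochhammer_eq_factorial_smul_choose (((-3 / 2 : ℝ) : ℂ)) 2
    rw [hc]
    have h2 : (descPochhammer ℤ 2).smeval (((-3 / 2 : ℝ) : ℂ)) = 15 / 4 := by
      simp [descPochhammer, Polynomial.smeval_mul, Polynomial.smeval_sub]
      norm_num
    rw [h2] at h
    rw [nsmul_eq_mul] at h
    norm_num only [Nat.factorial] at h ⊢
    linear_combination -h / 2

/-- The integrand is the squared modulus of (1 + z)^(-3/2), whose first Taylor coefficients are 1,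
-3/2, 15/8. All three are needed for the final numerical comparison. -/
theorem le_circleAverage_inv_norm_cube {r : ℝ} (hr : 0 ≤ r) (hr1 : r < 1) :
    1 + 9 / 4 * r ^ 2 + 225 / 64 * r ^ 4 ≤
      Real.circleAverage (fun z : ℂ => (‖1 + z‖ ^ 3)⁻¹) 0 r := by
  have hps := Complex.one_add_cpow_hasFPowerSeriesOnBall_zero (a := ((-3 / 2 : ℝ) : ℂ))
  have hd : DifferentiableOn ℂ (fun x : ℂ => (1 + x) ^ ((-3 / 2 : ℝ) : ℂ)) (Metric.ball 0 1) := by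
    have := hps.differentiableOn
    rwa [← ENNReal.ofReal_one, Metric.eball_ofReal] at this
  have h := sum_le_circleAverage_norm_sq hr hr1 3 hd hps.hasFPowerSeriesAt
  obtain ⟨c0, c1, c2⟩ := binomialSeries_coeff_neg_three_halves
  have e : (fun z : ℂ => ‖(1 + z) ^ ((-3 / 2 : ℝ) : ℂ)‖ ^ 2) = fun z => (‖1 + z‖ ^ 3)⁻¹ := by
    ext z
    rw [Complex.norm_cpow_real, ← Real.rpow_natCast, ← Real.rpow_mul (norm_nonneg _),
      ← Real.rpow_natCast, ← Real.rpow_neg (norm_nonneg _)]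
    norm_num
  rw [e, Finset.sum_range_succ, Finset.sum_range_succ, Finset.sum_range_one, c0, c1, c2] at h
  norm_num at h
  linarith

theorem le_integral_inv_norm_cube {s t : ℝ} (hs : 0 ≤ s) (hst : s < t) :
    2 * Real.pi * ((t ^ 3)⁻¹ + 9 / 4 * s ^ 2 * (t ^ 5)⁻¹ + 225 / 64 * s ^ 4 * (t ^ 7)⁻¹) ≤
      ∫ θ in -Real.pi..Real.pi,
        (‖(t : ℂ) + s * (Real.cos θ + Real.sin θ * Complex.I)‖ ^ 3)⁻¹ := by
  have ht : 0 < t := hs.trans_lt hst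
  have h := le_circleAverage_inv_norm_cube (r := s / t) (by positivity) ((div_lt_one ht).2 hst)
  rw [Real.circleAverage_eq_integral_add (-Real.pi), intervalIntegral.integral_comp_add_right
    (fun θ => (‖1 + circleMap 0 (s / t) θ‖ ^ 3)⁻¹), smul_eq_mul, ← div_eq_inv_mul,
    le_div_iff₀ (by positivity)] at h
  have e : ∀ θ : ℝ, (‖(t : ℂ) + s * (Real.cos θ + Real.sin θ * Complex.I)‖ ^ 3)⁻¹ =
      (t ^ 3)⁻¹ * (‖1 + circleMap 0 (s / t) θ‖ ^ 3)⁻¹ := fun θ => by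
    have e1 : (t : ℂ) + s * (Real.cos θ + Real.sin θ * Complex.I) =
        t * (1 + circleMap 0 (s / t) θ) := by
      rw [circleMap_zero, Complex.exp_mul_I]
      push_cast
      have : (t : ℂ) ≠ 0 := by exact_mod_cast ht.ne'
      field_simp
    rw [e1, norm_mul, mul_pow, mul_inv, Complex.norm_real, Real.norm_of_nonneg ht.le]
  simp only [e]
  rw [intervalIntegral.integral_const_mul, ← div_eq_inv_mul, le_div_iff₀ (by positivity)]
  rw [zero_add, show 2 * Real.pi + -Real.pi = Real.pi by ring] at h
  refine le_trans (le_of_eq ?_) h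
  field_simp

/-! ### Interaction of two disjoint discs -/

/-- Places q on the positive real axis, so that polar coordinates of ℂ are available. -/
theorem exists_isometry_complex (q : Space 2) :
    ∃ Φ : ℂ ≃ₗᵢ[ℝ] Space 2, Φ ((‖q‖ : ℝ) : ℂ) = q := by
  set T := Complex.orthonormalBasisOneI.repr
  rcases eq_or_ne q 0 with rfl | hq
  · exact ⟨T, by simp⟩
  · have hp : ‖T.symm q‖ = ‖q‖ := T.symm.norm_map q
    have hp0 : ‖T.symm q‖ ≠ 0 := by rw [hp]; exact norm_ne_zero_iff.2 hq
    set u : Circle := ⟨T.symm q / ‖T.symm q‖, by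
      rw [Submonoid.unitSphere, ← SetLike.mem_coe]
      simp [hq]⟩ with hu
    refine ⟨(rotation u).trans T, ?_⟩
    have : rotation u ((‖q‖ : ℝ) : ℂ) = T.symm q := by
      rw [rotation_apply, ← hp, hu]
      have : ((‖T.symm q‖ : ℝ) : ℂ) ≠ 0 := by exact_mod_cast hp0
      simp only
      field_simp
    rw [LinearIsometryEquiv.trans_apply, this, LinearIsometryEquiv.apply_symm_apply]

/-- In polar coordinates around 0, each circle of radius s < t is bounded below by the truncated
series; circles of radius s ≥ t carry no mass because V vanishes there. -/
theorem le_lintegral_radial_mul_inv_norm_cube {V : ℝ → ℝ} (hV : Continuous V) (hV0 : ∀ s, 0 ≤ V s)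
    {t : ℝ} (ht : 0 < t) (hVt : ∀ s, t ≤ s → V s = 0) {q : Space 2} (hq : ‖q‖ = t) :
    ENNReal.ofReal (∫ s in Set.Ioi (0 : ℝ), 2 * Real.pi * (s * V s) *
      ((t ^ 3)⁻¹ + 9 / 4 * s ^ 2 * (t ^ 5)⁻¹ + 225 / 64 * s ^ 4 * (t ^ 7)⁻¹)) ≤
    ∫⁻ w : Space 2, ENNReal.ofReal (V ‖w‖ * (‖q + w‖ ^ 3)⁻¹) := by
  obtain ⟨Φ, hΦ⟩ := exists_isometry_complex q
  set G : ℂ → ℝ := fun z => V ‖z‖ * (‖(t : ℂ) + z‖ ^ 3)⁻¹ with hG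
  have hGm : Measurable G := (hV.measurable.comp measurable_norm).mul (by fun_prop)
  have h1 : ∫⁻ w : Space 2, ENNReal.ofReal (V ‖w‖ * (‖q + w‖ ^ 3)⁻¹) =
      ∫⁻ z : ℂ, ENNReal.ofReal (G z) := by
    rw [← Φ.measurePreserving.lintegral_comp (by
      exact ((hV.measurable.comp measurable_norm).mul (by fun_prop)).ennreal_ofReal)]
    refine lintegral_congr fun z => ?_
    rw [← hΦ, ← map_add, Φ.norm_map, Φ.norm_map, hq]
  have hm2 : Measurable fun p : ℝ × ℝ => ENNReal.ofReal p.1 *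
      ENNReal.ofReal (G (p.1 * (Real.cos p.2 + Real.sin p.2 * Complex.I))) := by
    refine (measurable_fst.ennreal_ofReal).mul (hGm.comp ?_).ennreal_ofReal
    fun_prop
  set g : ℝ → ℝ := fun s => 2 * Real.pi * (s * V s) *
      ((t ^ 3)⁻¹ + 9 / 4 * s ^ 2 * (t ^ 5)⁻¹ + 225 / 64 * s ^ 4 * (t ^ 7)⁻¹) with hg
  have hgi : IntegrableOn g (Set.Ioi 0) := by
    have hc : Continuous g := by fun_prop
    refine IntegrableOn.of_forall_sdiff_eq_zero (s := Set.Icc 0 t) (hc.integrableOn_Icc)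
      measurableSet_Ioi fun s hs => ?_
    have : t ≤ s := le_of_not_ge fun h => hs.2 ⟨(Set.mem_Ioi.1 hs.1).le, h⟩
    rw [hg]
    simp only
    rw [hVt s this]
    ring
  have hg0 : ∀ s ∈ Set.Ioi (0 : ℝ), 0 ≤ g s := fun s hs => by
    have hs : 0 < s := hs
    have := hV0 s
    rw [hg]
    positivity
  rw [h1, ← Complex.lintegral_comp_polarCoord_symm, ofReal_integral_eq_lintegral_ofReal hgi
    ((ae_restrict_iff' measurableSet_Ioi).2 (ae_of_all _ hg0))]
  simp only [Complex.polarCoord_symm_apply, smul_eq_mul]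
  rw [polarCoord_target, Measure.volume_eq_prod, ← Measure.prod_restrict,
    lintegral_prod _ hm2.aemeasurable]
  refine setLIntegral_mono' measurableSet_Ioi fun s hs => ?_
  have hs : 0 < s := hs
  rcases le_or_gt t s with hts | hts
  · have : g s = 0 := by
      rw [hg]
      simp only
      rw [hVt s hts]
      ring
    rw [this, ENNReal.ofReal_zero]
    exact zero_le
  · have hk := le_integral_inv_norm_cube hs.le hts
    have hnorm : ∀ θ : ℝ, ‖(s : ℂ) * (Real.cos θ + Real.sin θ * Complex.I)‖ = s := fun θ => by
      rw [norm_mul, Complex.norm_real, Real.norm_of_nonneg hs.le, Complex.ofReal_cos,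
        Complex.ofReal_sin, Complex.norm_cos_add_sin_mul_I, mul_one]
    have hpos : ∀ θ : ℝ, 0 < ‖(t : ℂ) + s * (Real.cos θ + Real.sin θ * Complex.I)‖ := fun θ => by
      have h2 := norm_sub_le ((t : ℂ) + s * (Real.cos θ + Real.sin θ * Complex.I))
        (s * (Real.cos θ + Real.sin θ * Complex.I))
      rw [add_sub_cancel_right, Complex.norm_real, Real.norm_of_nonneg ht.le, hnorm] at h2
      linarith
    have hcont : Continuous fun θ : ℝ => (s * V s) *
        (‖(t : ℂ) + s * (Real.cos θ + Real.sin θ * Complex.I)‖ ^ 3)⁻¹ := by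
      refine continuous_const.mul (Continuous.inv₀ (by fun_prop) fun θ => (pow_pos (hpos θ) 3).ne')
    have e : ∀ θ : ℝ, ENNReal.ofReal s * ENNReal.ofReal
        (G (s * (Real.cos θ + Real.sin θ * Complex.I))) = ENNReal.ofReal ((s * V s) *
        (‖(t : ℂ) + s * (Real.cos θ + Real.sin θ * Complex.I)‖ ^ 3)⁻¹) := fun θ => by
      rw [← ENNReal.ofReal_mul hs.le, hG]
      simp only
      rw [hnorm, mul_assoc]
    simp only [e]
    rw [← ofReal_integral_eq_lintegral_ofReal
      ((hcont.integrableOn_Icc (a := -Real.pi) (b := Real.pi)).mono_set Set.Ioo_subset_Icc_self)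
      (ae_of_all _ fun θ => mul_nonneg (mul_nonneg hs.le (hV0 s)) (by positivity))]
    refine ENNReal.ofReal_le_ofReal ?_
    rw [integral_const_mul, ← integral_Ioc_eq_integral_Ioo, ← intervalIntegral.integral_of_le
      (by linarith [Real.pi_pos])]
    refine le_trans (le_of_eq ?_) (mul_le_mul_of_nonneg_left hk (mul_nonneg hs.le (hV0 s)))
    rw [hg]
    ring

/-- Integrate the derivative of s^(2m+1) (1 - s²)^(3/2), which vanishes at both ends. -/
theorem integral_pow_mul_sqrt_one_sub_sq (m : ℕ) :
    (2 * m + 4) * ∫ s in (0 : ℝ)..1, s ^ (2 * m + 2) * √(1 - s ^ 2) =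
      (2 * m + 1) * ∫ s in (0 : ℝ)..1, s ^ (2 * m) * √(1 - s ^ 2) := by
  have hi : ∀ n : ℕ, IntervalIntegrable (fun s : ℝ => s ^ n * √(1 - s ^ 2)) volume 0 1 := fun n =>
    Continuous.intervalIntegrable (by fun_prop) _ _
  have h := intervalIntegral.integral_eq_sub_of_hasDerivAt_of_le (a := 0) (b := 1)
    (f := fun s : ℝ => s ^ (2 * m + 1) * √(1 - s ^ 2) ^ 3)
    (f' := fun s => (2 * m + 1) * (s ^ (2 * m) * √(1 - s ^ 2)) -
      (2 * m + 4) * (s ^ (2 * m + 2) * √(1 - s ^ 2))) zero_le_one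
    (Continuous.continuousOn (by fun_prop)) (fun s hs => ?_)
    (((hi _).const_mul _).sub ((hi _).const_mul _))
  · rw [intervalIntegral.integral_sub ((hi _).const_mul _) ((hi _).const_mul _),
      intervalIntegral.integral_const_mul, intervalIntegral.integral_const_mul] at h
    norm_num at h
    linarith
  · refine ((hasDerivAt_pow (2 * m + 1) s).mul ((hasDerivAt_sqrt_one_sub_sq hs).pow 3)).congr_deriv ?_
    have h1 : 0 < 1 - s ^ 2 := by nlinarith [hs.1, hs.2]
    have h2 := Real.sq_sqrt h1.le
    have h3 := (Real.sqrt_pos.2 h1).ne'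
    rw [Pi.pow_apply, show √(1 - s ^ 2) ^ 3 = √(1 - s ^ 2) * (1 - s ^ 2) by rw [pow_succ', h2],
      show ((3 : ℕ) : ℝ) * √(1 - s ^ 2) ^ (3 - 1) * (-s / √(1 - s ^ 2)) = -(3 * s * √(1 - s ^ 2)) by
        push_cast
        field_simp]
    push_cast
    ring

theorem integral_sqrt_one_sub_sq_zero_one : ∫ s in (0 : ℝ)..1, √(1 - s ^ 2) = Real.pi / 4 := by
  have hi : ∀ a b : ℝ, IntervalIntegrable (fun s : ℝ => √(1 - s ^ 2)) volume a b := fun a b =>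
    Continuous.intervalIntegrable (by fun_prop) _ _
  have h := integral_sqrt_one_sub_sq
  rw [← intervalIntegral.integral_add_adjacent_intervals (hi (-1) 0) (hi 0 1)] at h
  have h2 := intervalIntegral.integral_comp_neg (a := 0) (b := 1) (fun s : ℝ => √(1 - s ^ 2))
  simp only [neg_sq, neg_zero] at h2
  linarith

theorem integral_pow_mul_capTail_one (n : ℕ) :
    ∫ s in Set.Ioi (0 : ℝ), s ^ (2 * n + 1) * capTail 1 s =
      (∫ s in (0 : ℝ)..1, s ^ (2 * n + 2) * √(1 - s ^ 2)) / (2 * n + 2) := by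
  have h1 : ∫ s in Set.Ioi (0 : ℝ), s ^ (2 * n + 1) * capTail 1 s =
      ∫ s in (0 : ℝ)..1, s ^ (2 * n + 1) * capTail 1 s := by
    rw [intervalIntegral.integral_of_le zero_le_one]
    refine setIntegral_eq_of_subset_of_forall_sdiff_eq_zero measurableSet_Ioi
      Set.Ioc_subset_Ioi_self fun s hs => ?_
    rw [capTail_of_one_le one_ne_zero (le_of_not_ge fun h => hs.2 ⟨hs.1, h⟩), mul_zero]
  have hn : (2 * (n : ℝ) + 2) ≠ 0 := by positivity
  have h := intervalIntegral.integral_mul_deriv_eq_deriv_mul_of_hasDerivAt (a := 0) (b := 1)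
    (u := capTail 1) (u' := fun s => -capPow 1 s) (v := fun s : ℝ => s ^ (2 * n + 2) / (2 * n + 2))
    (v' := fun s => s ^ (2 * n + 1)) (continuous_capTail 1).continuousOn
    (Continuous.continuousOn (by fun_prop)) (fun s _ => hasDerivAt_capTail 1 s)
    (fun s _ => ((hasDerivAt_pow (2 * n + 2) s).div_const _).congr_deriv (by
      push_cast
      field_simp))
    ((continuous_capPow 1).neg.intervalIntegrable _ _)
    (Continuous.intervalIntegrable (by fun_prop) _ _)
  rw [capTail_of_one_le one_ne_zero le_rfl, zero_pow (by omega), zero_div, mul_zero, zero_mul,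
    sub_zero, zero_sub, ← intervalIntegral.integral_neg] at h
  rw [h1, ← intervalIntegral.integral_div]
  simp only [mul_comm _ (capTail 1 _)]
  rw [h]
  refine intervalIntegral.integral_congr fun s _ => ?_
  simp only [capPow, pow_one]
  ring

theorem integral_pow_mul_capTail_one_values :
    ∫ s in Set.Ioi (0 : ℝ), s ^ 1 * capTail 1 s = Real.pi / 32 ∧
    ∫ s in Set.Ioi (0 : ℝ), s ^ 3 * capTail 1 s = Real.pi / 128 ∧
    ∫ s in Set.Ioi (0 : ℝ), s ^ 5 * capTail 1 s = 5 * Real.pi / 1536 := by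
  have b0 := integral_pow_mul_sqrt_one_sub_sq 0
  have b1 := integral_pow_mul_sqrt_one_sub_sq 1
  have b2 := integral_pow_mul_sqrt_one_sub_sq 2
  have c0 := integral_pow_mul_capTail_one 0
  have c1 := integral_pow_mul_capTail_one 1
  have c2 := integral_pow_mul_capTail_one 2
  have h := integral_sqrt_one_sub_sq_zero_one
  norm_num at b0 b1 b2 c0 c1 c2
  rw [h] at b0
  simp only [pow_one]
  refine ⟨?_, ?_, ?_⟩ <;> linarith

theorem integrableOn_pow_mul_capTail_one (n : ℕ) :
    IntegrableOn (fun s => s ^ n * capTail 1 s) (Set.Ioi 0) := by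
  have hc : Continuous fun s => s ^ n * capTail 1 s := by
    have := continuous_capTail 1
    fun_prop
  refine IntegrableOn.of_forall_sdiff_eq_zero (s := Set.Icc 0 1) hc.integrableOn_Icc
    measurableSet_Ioi fun s hs => ?_
  rw [capTail_of_one_le one_ne_zero (le_of_not_ge fun h => hs.2 ⟨(Set.mem_Ioi.1 hs.1).le, h⟩),
    mul_zero]

/-- A lower bound for the interaction of two discs of radius `ρ` at distance `t`. -/
noncomputable def discInteraction (ρ t : ℝ) : ℝ :=
  Real.pi ^ 2 * ρ ^ 4 * ((t ^ 3)⁻¹ + 9 / 4 * ρ ^ 2 * (t ^ 5)⁻¹ + 375 / 64 * ρ ^ 4 * (t ^ 7)⁻¹)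

/-- The substitution s ↦ 2ρs reduces the radial integrals to the moments of `capTail 1`. The leading
coefficient π²ρ⁴ is the square of the disc area, as for point masses; the other terms are
finite-size corrections. -/
theorem discInteraction_le_lintegral {ρ : ℝ} (hρ : 0 < ρ) {q : Space 2} (hq : 2 * ρ ≤ ‖q‖) :
    ENNReal.ofReal (discInteraction ρ ‖q‖) ≤
      ∫⁻ w : Space 2, ENNReal.ofReal (overlap ρ w * (‖q + w‖ ^ 3)⁻¹) := by
  set V : ℝ → ℝ := fun s => 4 * ρ ^ 2 * capTail 1 (s / (2 * ρ)) with hV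
  have hVc : Continuous V := by
    have := continuous_capTail 1
    fun_prop
  have hV0 : ∀ s, 0 ≤ V s := fun s => mul_nonneg (by positivity) (capTail_nonneg one_ne_zero _)
  have ht : 0 < ‖q‖ := by linarith
  have hVt : ∀ s, ‖q‖ ≤ s → V s = 0 := fun s hs => by
    rw [hV]
    simp only
    rw [capTail_of_one_le one_ne_zero, mul_zero]
    rw [le_div_iff₀ (by positivity)]
    linarith
  have hov : ∀ w : Space 2, overlap ρ w = V ‖w‖ := fun w => by
    rw [overlap_eq (k := 1) one_ne_zero hρ, ballVol_one, hV]
    ring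
  simp only [hov]
  refine le_trans (le_of_eq (congrArg _ ?_)) (le_lintegral_radial_mul_inv_norm_cube hVc hV0 ht hVt rfl)
  obtain ⟨m0, m1, m2⟩ := integral_pow_mul_capTail_one_values
  set t := ‖q‖
  have hsub := integral_comp_mul_left_Ioi (fun s => 2 * Real.pi * (s * V s) *
      ((t ^ 3)⁻¹ + 9 / 4 * s ^ 2 * (t ^ 5)⁻¹ + 225 / 64 * s ^ 4 * (t ^ 7)⁻¹)) 0
      (b := 2 * ρ) (by positivity)
  rw [mul_zero, smul_eq_mul, eq_inv_mul_iff_mul_eq₀ (by positivity)] at hsub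
  have e : ∀ s : ℝ, 2 * Real.pi * (2 * ρ * s * V (2 * ρ * s)) *
      ((t ^ 3)⁻¹ + 9 / 4 * (2 * ρ * s) ^ 2 * (t ^ 5)⁻¹ + 225 / 64 * (2 * ρ * s) ^ 4 * (t ^ 7)⁻¹) =
      16 * Real.pi * ρ ^ 3 * (t ^ 3)⁻¹ * (s ^ 1 * capTail 1 s) +
      144 * Real.pi * ρ ^ 5 * (t ^ 5)⁻¹ * (s ^ 3 * capTail 1 s) +
      900 * Real.pi * ρ ^ 7 * (t ^ 7)⁻¹ * (s ^ 5 * capTail 1 s) := fun s => by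
    rw [hV]
    simp only
    rw [mul_div_cancel_left₀ _ (by positivity)]
    ring
  rw [← hsub]
  simp only [e]
  have i0 := (integrableOn_pow_mul_capTail_one 1).const_mul (16 * Real.pi * ρ ^ 3 * (t ^ 3)⁻¹)
  have i1 := (integrableOn_pow_mul_capTail_one 3).const_mul (144 * Real.pi * ρ ^ 5 * (t ^ 5)⁻¹)
  have i2 := (integrableOn_pow_mul_capTail_one 5).const_mul (900 * Real.pi * ρ ^ 7 * (t ^ 7)⁻¹)
  have i01 : IntegrableOn (fun s => 16 * Real.pi * ρ ^ 3 * (t ^ 3)⁻¹ * (s ^ 1 * capTail 1 s) +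
      144 * Real.pi * ρ ^ 5 * (t ^ 5)⁻¹ * (s ^ 3 * capTail 1 s)) (Set.Ioi 0) := i0.add i1
  rw [integral_add i01 i2, integral_add i0 i1, integral_const_mul, integral_const_mul,
    integral_const_mul, m0, m1, m2, discInteraction]
  ring

/-! ### The interaction of distinct discs as a lattice sum -/

theorem ofReal_overlap {d : ℕ} (ρ : ℝ) (z : Space d) :
    ENNReal.ofReal (overlap ρ z) = volume (Metric.ball (0 : Space d) ρ ∩ Metric.ball z ρ) :=
  ENNReal.ofReal_toReal (measure_lt_top_of_subset Set.inter_subset_left measure_ball_lt_top.ne).ne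

theorem continuous_overlap {k : ℕ} (hk : k ≠ 0) {ρ : ℝ} (hρ : 0 < ρ) :
    Continuous fun z : Space (k + 1) => overlap ρ z := by
  have := continuous_capTail k
  simp only [overlap_eq hk hρ]
  fun_prop

theorem IsPacking.ofReal_crossOverlap {d : ℕ} {Λ : Submodule ℤ (Space d)} [Countable Λ] {ρ : ℝ}
    (h : IsPacking Λ ρ) (z : Space d) : ENNReal.ofReal (crossOverlap Λ ρ z) =
      ∑' q : ({0}ᶜ : Set Λ), ENNReal.ofReal (overlap ρ ((q : Space d) - z)) := by
  simp only [ofReal_overlap]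
  rw [crossOverlap, measureReal_def, ENNReal.ofReal_toReal
    (measure_lt_top_of_subset Set.inter_subset_left measure_ball_lt_top.ne).ne, ← measure_iUnion]
  · congr 1
    ext y
    simp only [Set.mem_inter_iff, Set.mem_ofPred_eq, Set.mem_iUnion, mem_puncturedBalls]
    constructor
    · rintro ⟨hy, q, hq, h0, hd⟩
      refine ⟨⟨⟨q, hq⟩, fun h' => h0 (congrArg Subtype.val h')⟩, hy, ?_⟩
      rw [mem_ball_iff_norm, sub_sub_eq_add_sub]
      rwa [dist_eq_norm] at hd
    · rintro ⟨q, hy, hd⟩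
      refine ⟨hy, q, q.1.2, fun h' => q.2 (Subtype.ext h'), ?_⟩
      rw [mem_ball_iff_norm, sub_sub_eq_add_sub] at hd
      rwa [dist_eq_norm]
  · intro p q hpq
    rw [Function.onFun, Set.disjoint_left]
    rintro y ⟨_, hp⟩ ⟨_, hq⟩
    rw [mem_ball_iff_norm, sub_sub_eq_add_sub, ← dist_eq_norm] at hp hq
    exact hpq (Subtype.ext (Subtype.ext (h.eq_of_dist_lt p.1.2 q.1.2 hp hq)))
  · exact fun q => measurableSet_ball.inter measurableSet_ball

/-- Since the balls are disjoint, the cross overlap is a sum over the nonzero lattice points; the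
shift z = q + w brings each summand into the form of the two-disc interaction. -/
theorem IsPacking.tsum_discInteraction_le {Λ : Submodule ℤ (Space 2)} [DiscreteTopology Λ]
    [IsZLattice ℝ Λ] {ρ : ℝ} (hρ : 0 < ρ) (h : IsPacking Λ ρ) :
    ∑' q : ({0}ᶜ : Set Λ), ENNReal.ofReal (discInteraction ρ ‖(q : Space 2)‖) ≤
      ENNReal.ofReal (crossIntegral Λ ρ) := by
  have hm : Measurable fun z : Space 2 => overlap ρ z := (continuous_overlap one_ne_zero hρ).measurable
  have hnn : ∀ z : Space 2, 0 ≤ crossOverlap Λ ρ z * (‖z‖ ^ 3)⁻¹ := fun z =>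
    mul_nonneg (crossOverlap_nonneg _ _ _) (by positivity)
  have h1 : ENNReal.ofReal (crossIntegral Λ ρ) = ∑' q : ({0}ᶜ : Set Λ), ∫⁻ z : Space 2,
      ENNReal.ofReal (overlap ρ ((q : Space 2) - z) * (‖z‖ ^ 3)⁻¹) := by
    rw [crossIntegral, ofReal_integral_eq_lintegral_ofReal
      (IsPacking.integrable_crossOverlap one_ne_zero hρ h) (ae_of_all _ hnn), ← lintegral_tsum]
    · refine lintegral_congr fun z => ?_
      rw [ENNReal.ofReal_mul (crossOverlap_nonneg _ _ _), h.ofReal_crossOverlap, ← ENNReal.tsum_mul_right]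
      refine tsum_congr fun q => ?_
      exact (ENNReal.ofReal_mul measureReal_nonneg).symm
    · exact fun q => ((hm.comp (by fun_prop)).mul (by fun_prop)).ennreal_ofReal.aemeasurable
  rw [h1]
  refine ENNReal.tsum_le_tsum fun q => ?_
  have hq := h.two_mul_le_norm q.1.2 fun h' => q.2 (Subtype.ext h')
  refine (discInteraction_le_lintegral hρ hq).trans_eq ?_
  rw [← lintegral_add_left_eq_self (fun z : Space 2 =>
    ENNReal.ofReal (overlap ρ ((q : Space 2) - z) * (‖z‖ ^ 3)⁻¹)) (q : Space 2)]
  refine lintegral_congr fun w => ?_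
  rw [sub_add_cancel_left, overlap_eq_of_norm_eq ρ (norm_neg w)]

/-! ### Periodization over a lattice -/

theorem integral_eq_setIntegral_tsum {d : ℕ} {Λ : Submodule ℤ (Space d)} [DiscreteTopology Λ]
    [IsZLattice ℝ Λ] {F : Set (Space d)} (hF : IsAddFundamentalDomain Λ F volume)
    {φ : Space d → ℝ} (hφ : Integrable φ) :
    ∫ y, φ y = ∫ y in F, ∑' q : Λ, φ (q + y) := by
  have : VAddInvariantMeasure Λ (Space d) volume :=
    (inferInstance : VAddInvariantMeasure Λ.toAddSubgroup (Space d) volume)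
  have : MeasurableConstVAdd Λ (Space d) :=
    (inferInstance : MeasurableConstVAdd Λ.toAddSubgroup (Space d))
  rw [integral_tsum, hF.integral_eq_tsum'' φ hφ]
  · rfl
  · exact fun q => (hφ.comp_add_left (q : Space d)).aestronglyMeasurable.restrict
  · have h := hF.lintegral_eq_tsum'' fun y => ‖φ y‖ₑ
    have h' : ∑' q : Λ, ∫⁻ y in F, ‖φ (q + y)‖ₑ = ∫⁻ y, ‖φ y‖ₑ := h.symm
    rw [h']
    exact hφ.2.ne

theorem sq_setIntegral_le {d : ℕ} {F : Set (Space d)} (hF : volume F = 1) {v : Space d → ℝ}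
    (h1 : IntegrableOn v F) (h2 : IntegrableOn (fun y => v y ^ 2) F) :
    (∫ y in F, v y) ^ 2 ≤ ∫ y in F, v y ^ 2 := by
  set c := ∫ y in F, v y with hc
  have hconst : IntegrableOn (fun _ : Space d => c ^ 2) F := integrableOn_const (by rw [hF]; simp)
  have h3 : 0 ≤ ∫ y in F, (v y - c) ^ 2 := integral_nonneg fun _ => sq_nonneg _
  have e : ∀ y, (v y - c) ^ 2 = v y ^ 2 - 2 * c * v y + c ^ 2 := fun y => by ring
  have i1 : IntegrableOn (fun y => v y ^ 2 - 2 * c * v y) F := h2.sub (h1.const_mul _)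
  simp only [e] at h3
  rw [integral_add i1 hconst, integral_sub h2 (h1.const_mul _), integral_const_mul, ← hc,
    setIntegral_const, measureReal_def, hF] at h3
  simp at h3
  linarith

/-- Let v be the periodization of h. Unfolding the integral of h v in two ways gives both the
right-hand side and the integral of v² over a cell, and on a cell of volume 1 this is at least the
square of the integral of v, i.e. of h. In Poisson's formula it amounts to keeping only the zero
frequency. -/
theorem sq_integral_le_tsum {d : ℕ} {Λ : Submodule ℤ (Space d)} [DiscreteTopology Λ]
    [IsZLattice ℝ Λ] (hcov : ZLattice.covolume Λ = 1) {h : Space d → ℝ} (hc : Measurable h)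
    (hi : Integrable h) {M : ℝ → ℝ}
    (hs : ∀ D y, ‖y‖ ≤ D → Summable (fun q : Λ => |h (q + y)|) ∧ ∑' q : Λ, |h (q + y)| ≤ M D) :
    (∫ y, h y) ^ 2 ≤ ∑' q : Λ, ∫ y, h y * h (q + y) := by
  obtain ⟨F, hF, hFm, D, hD⟩ := exists_isAddFundamentalDomain Λ
  have hvol : volume F = 1 := by
    have := ZLattice.covolume_eq_measure_fundamentalDomain Λ volume hF
    rw [hcov, measureReal_def, eq_comm, ENNReal.toReal_eq_one_iff] at this
    exact this
  set v : Space d → ℝ := fun y => ∑' q : Λ, h (q + y) with hv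
  have hsy : ∀ y : Space d, Summable fun q : Λ => |h (q + y)| := fun y => (hs _ y le_rfl).1
  have hvper : ∀ (q : Λ) y, v (q + y) = v y := fun q y => by
    rw [hv]
    simp only
    rw [← (Equiv.addRight q).tsum_eq (fun p : Λ => h (p + y))]
    refine tsum_congr fun p => ?_
    rw [Equiv.coe_addRight, Submodule.coe_add, add_assoc]
  have hvm : Measurable v := by
    refine measurable_of_tendsto_metrizable' (f := fun (s : Finset Λ) y => ∑ q ∈ s, h (q + y))
      atTop (fun s => ?_) ?_
    · exact Finset.measurable_fun_sum s fun q _ => hc.comp (measurable_const_add _)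
    · rw [tendsto_pi_nhds]
      exact fun y => (hsy y).of_abs.hasSum
  -- The bound on the cell extends to almost every y by periodicity, which makes h v integrable and
  -- justifies exchanging sum and integral.
  have habs : ∀ᵐ y, ∑' q : Λ, |h (q + y)| ≤ M D := by
    filter_upwards [hF.ae_covers] with y hy
    obtain ⟨g, hg' : (g : Space d) + y ∈ F⟩ := hy
    have h2 : ∑' q : Λ, |h (q + (g + y))| = ∑' q : Λ, |h (q + y)| := by
      rw [← (Equiv.addRight g).tsum_eq (fun p : Λ => |h (p + y)|)]
      refine tsum_congr fun p => ?_
      rw [Equiv.coe_addRight, Submodule.coe_add, add_assoc]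
    have h3 := (hs D _ (hD _ hg')).2
    rwa [h2] at h3
  have hvM : ∀ᵐ y, ‖v y‖ ≤ M D := by
    filter_upwards [habs] with y hy
    have h1 : ‖v y‖ ≤ ∑' q : Λ, |h (q + y)| :=
      norm_tsum_le_tsum_norm (f := fun q : Λ => h (q + y)) (hsy y)
    exact h1.trans hy
  have hhv : Integrable fun y => h y * v y :=
    hi.mul_bdd hvm.aestronglyMeasurable hvM
  have e1 : ∫ y, h y * v y = ∫ y in F, v y ^ 2 := by
    rw [integral_eq_setIntegral_tsum hF hhv]
    refine integral_congr_ae (ae_of_all _ fun y => ?_)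
    simp only [hvper]
    rw [tsum_mul_right, sq]
  have e2 : ∫ y, h y * v y = ∑' q : Λ, ∫ y, h y * h (q + y) := by
    rw [← integral_tsum]
    · simp only [tsum_mul_left, hv]
    · exact fun q => (hc.mul (hc.comp (measurable_const_add _))).aestronglyMeasurable
    · have hm : ∀ q : Λ, AEMeasurable (fun a => ‖h a * h (q + a)‖ₑ) := fun q =>
        (hc.mul (hc.comp (measurable_const_add _))).enorm.aemeasurable
      rw [← lintegral_tsum hm]
      refine ne_top_of_le_ne_top (ENNReal.mul_ne_top (ENNReal.ofReal_ne_top (r := M D)) hi.2.ne) ?_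
      rw [← lintegral_const_mul _ hc.enorm]
      refine lintegral_mono_ae ?_
      filter_upwards [habs] with y hy
      simp only [enorm_mul]
      rw [ENNReal.tsum_mul_left, mul_comm]
      gcongr
      simp only [← ofReal_norm, Real.norm_eq_abs]
      rw [← ENNReal.ofReal_tsum_of_nonneg (fun q => abs_nonneg _) (hsy y)]
      exact ENNReal.ofReal_le_ofReal hy
  have hfin : volume F ≠ ∞ := by simp [hvol]
  have i1 : IntegrableOn v F :=
    Measure.integrableOn_of_bounded hfin hvm.aestronglyMeasurable (ae_restrict_of_ae hvM)
  have i2 : IntegrableOn (fun y => v y ^ 2) F := by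
    refine Measure.integrableOn_of_bounded (M := M D ^ 2) hfin (hvm.pow_const 2).aestronglyMeasurable
      (ae_restrict_of_ae ?_)
    filter_upwards [hvM] with y hy
    rw [norm_pow]
    gcongr
  rw [integral_eq_setIntegral_tsum hF hi, ← e2, e1]
  exact sq_setIntegral_le hvol i1 i2

/-! ### Gaussian lattice sums -/

theorem summable_exp_neg_mul_sq {d : ℕ} (Λ : Submodule ℤ (Space d)) [DiscreteTopology Λ]
    [IsZLattice ℝ Λ] {a : ℝ} (ha : 0 < a) :
    Summable fun q : Λ => Real.exp (-a * ‖(q : Space d)‖ ^ 2) := by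
  have hr : Module.finrank ℤ Λ = d := by rw [ZLattice.rank ℝ Λ]; simp
  have hs := (ZLattice.summable_norm_pow_inv Λ (2 * (d + 1)) (by rw [hr]; omega)).mul_left
    ((d + 1).factorial / a ^ (d + 1) : ℝ)
  refine hs.of_norm_bounded_eventually ?_
  filter_upwards [(Set.finite_singleton (0 : Λ)).compl_mem_cofinite] with q hq
  have h0 : 0 < ‖q‖ := norm_pos_iff.2 hq
  rw [Real.norm_eq_abs, Real.abs_exp, neg_mul, Real.exp_neg]
  have h1 := Real.pow_div_factorial_le_exp (a * ‖q‖ ^ 2) (by positivity) (d + 1)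
  have h2 : ((d + 1).factorial / a ^ (d + 1) : ℝ) * ‖q‖⁻¹ ^ (2 * (d + 1)) =
      ((a * ‖q‖ ^ 2) ^ (d + 1) / (d + 1).factorial)⁻¹ := by
    rw [mul_pow, ← pow_mul, inv_pow]
    field_simp
  rw [h2]
  exact inv_anti₀ (by positivity) h1

theorem integral_exp_neg_mul_sq {b : ℝ} (hb : 0 < b) :
    ∫ y : Space 2, Real.exp (-b * ‖y‖ ^ 2) = Real.pi / b := by
  rw [GaussianFourier.integral_rexp_neg_mul_sq_norm hb]
  simp

theorem integrable_exp_neg_mul_sq_norm {d : ℕ} {b : ℝ} (hb : 0 < b) :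
    Integrable fun y : Space d => Real.exp (-b * ‖y‖ ^ 2) := by
  refine Integrable.of_integral_ne_zero ?_
  rw [GaussianFourier.integral_rexp_neg_mul_sq_norm hb]
  have := Real.pi_pos
  positivity

theorem norm_sq_le_two_mul {d : ℕ} (x y : Space d) : ‖x‖ ^ 2 ≤ 2 * ‖x + y‖ ^ 2 + 2 * ‖y‖ ^ 2 := by
  have h1 : ‖x‖ ≤ ‖x + y‖ + ‖y‖ := by simpa using norm_sub_le (x + y) y
  have h2 := norm_nonneg x
  nlinarith [sq_nonneg (‖x + y‖ - ‖y‖)]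

theorem sq_integral_le_tsum_of_le_exp {d : ℕ} {Λ : Submodule ℤ (Space d)} [DiscreteTopology Λ]
    [IsZLattice ℝ Λ] (hcov : ZLattice.covolume Λ = 1) {h : Space d → ℝ} (hc : Measurable h)
    {C a : ℝ} (hC : 0 ≤ C) (ha : 0 < a) (hb : ∀ y, |h y| ≤ C * Real.exp (-a * ‖y‖ ^ 2)) :
    (∀ q : Space d, Integrable fun y => h y * h (q + y)) ∧
      Summable (fun q : Λ => ∫ y, h y * h (q + y)) ∧
      (∫ y, h y) ^ 2 ≤ ∑' q : Λ, ∫ y, h y * h (q + y) := by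
  have hi : ∀ q : Space d, Integrable fun y : Space d => C ^ 2 * (Real.exp (-(a / 4) * ‖q‖ ^ 2) *
      Real.exp (-(a / 2) * ‖y‖ ^ 2)) := fun q =>
    ((integrable_exp_neg_mul_sq_norm (half_pos ha)).const_mul _).const_mul _
  have hle : ∀ q y : Space d, ‖h y * h (q + y)‖ ≤ C ^ 2 * (Real.exp (-(a / 4) * ‖q‖ ^ 2) *
      Real.exp (-(a / 2) * ‖y‖ ^ 2)) := fun q y => by
    rw [Real.norm_eq_abs, abs_mul]
    refine (mul_le_mul (hb y) (hb (q + y)) (abs_nonneg _) (by positivity)).trans ?_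
    rw [mul_mul_mul_comm, ← sq, ← Real.exp_add, ← Real.exp_add]
    have := norm_sq_le_two_mul q y
    exact mul_le_mul_of_nonneg_left (Real.exp_le_exp.2 (by nlinarith)) (sq_nonneg C)
  refine ⟨fun q => (hi q).mono' (hc.mul (hc.comp (measurable_const_add _))).aestronglyMeasurable
    (ae_of_all _ (hle q)), ?_, ?_⟩
  · have hs : Summable fun q : Λ => C ^ 2 * (Real.exp (-(a / 4) * ‖(q : Space d)‖ ^ 2) *
        ∫ y : Space d, Real.exp (-(a / 2) * ‖y‖ ^ 2)) :=
      ((summable_exp_neg_mul_sq Λ (show 0 < a / 4 by positivity)).mul_right _).mul_left _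
    refine hs.of_norm_bounded fun q => ?_
    rw [← integral_const_mul, ← integral_const_mul]
    exact norm_integral_le_of_norm_le (hi q) (ae_of_all _ (hle q))
  -- Uses ‖q‖² ≤ 2‖q + y‖² + 2‖y‖²: half of the decay rate is kept in q, and the cell radius D costs
  -- exp(a D²).
  · refine sq_integral_le_tsum hcov hc (M := fun D => C * (Real.exp (a * D ^ 2) *
      ∑' q : Λ, Real.exp (-(a / 2) * ‖(q : Space d)‖ ^ 2))) ?_ fun D y hy => ?_
    · exact ((integrable_exp_neg_mul_sq_norm ha).const_mul C).mono' hc.aestronglyMeasurable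
        (ae_of_all _ hb)
    · have hs := ((summable_exp_neg_mul_sq Λ (half_pos ha)).mul_left (Real.exp (a * D ^ 2))).mul_left C
      have hle : ∀ q : Λ, |h (q + y)| ≤ C * (Real.exp (a * D ^ 2) *
          Real.exp (-(a / 2) * ‖(q : Space d)‖ ^ 2)) := fun q => by
        refine (hb _).trans ?_
        rw [← Real.exp_add]
        have h1 := norm_sq_le_two_mul (q : Space d) y
        have h2 : ‖y‖ ^ 2 ≤ D ^ 2 := by gcongr
        gcongr
        nlinarith
      have hs' := Summable.of_nonneg_of_le (fun q : Λ => abs_nonneg (h ((q : Space d) + y))) hle hs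
      refine ⟨hs', ?_⟩
      rw [← tsum_mul_left, ← tsum_mul_left]
      exact hs'.tsum_le_tsum hle hs

theorem integral_mul_sq_exp_neg {b : ℝ} (hb : 0 < b) :
    ∫ y : Space 2, ‖y‖ ^ 2 * Real.exp (-b * ‖y‖ ^ 2) = Real.pi / b ^ 2 := by
  have h := integral_fun_norm_addHaar (volume : Measure (Space 2))
    (fun r : ℝ => r ^ 2 * Real.exp (-b * r ^ 2))
  rw [h]
  have e : ∀ r : ℝ, r ^ (Module.finrank ℝ (Space 2) - 1) • (r ^ 2 * Real.exp (-b * r ^ 2)) =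
      r ^ (3 : ℝ) * Real.exp (-b * r ^ (2 : ℝ)) := fun r => by
    rw [finrank_euclideanSpace_fin, smul_eq_mul]
    norm_cast
    ring
  simp only [e]
  rw [integral_rpow_mul_exp_neg_mul_rpow (by norm_num) (by norm_num) hb]
  have h2 : Real.Gamma ((3 + 1) / 2) = 1 := by norm_num [Real.Gamma_two]
  have h3 : b ^ (-(3 + 1) / 2 : ℝ) = (b ^ 2)⁻¹ := by
    rw [← Real.rpow_natCast, ← Real.rpow_neg hb.le]; norm_num
  have h4 : volume.real (Metric.ball (0 : Space 2) 1) = Real.pi := ballVol_two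
  rw [h2, h3, h4]
  simp
  field_simp

theorem integrable_mul_sq_exp_neg {b : ℝ} (hb : 0 < b) :
    Integrable fun y : Space 2 => ‖y‖ ^ 2 * Real.exp (-b * ‖y‖ ^ 2) := by
  refine Integrable.of_integral_ne_zero ?_
  rw [integral_mul_sq_exp_neg hb]
  have := Real.pi_pos
  positivity

section

variable {Λ : Submodule ℤ (Space 2)} [DiscreteTopology Λ] [IsZLattice ℝ Λ]

theorem norm_sq_add_norm_add_sq {d : ℕ} (q y : Space d) :
    ‖y‖ ^ 2 + ‖q + y‖ ^ 2 = 2 * ‖y + (1 / 2 : ℝ) • q‖ ^ 2 + 1 / 2 * ‖q‖ ^ 2 := by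
  rw [norm_add_sq_real, norm_add_sq_real, inner_smul_right, norm_smul, real_inner_comm]
  norm_num
  ring

/-- Apply the periodization inequality to the Gaussian with parameter 2a: completing the square, its
autocorrelation at q is exp(-a‖q‖²) times a constant. -/
theorem le_tsum_exp_neg_mul_sq (hcov : ZLattice.covolume Λ = 1) {a : ℝ} (ha : 0 < a) :
    Real.pi / a ≤ ∑' q : Λ, Real.exp (-a * ‖(q : Space 2)‖ ^ 2) := by
  have h := (sq_integral_le_tsum_of_le_exp hcov
    (h := fun y => Real.exp (-(2 * a) * ‖y‖ ^ 2)) (by fun_prop) zero_le_one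
    (show 0 < 2 * a by positivity) fun y => by rw [one_mul, Real.abs_exp]).2.2
  have e : ∀ q y : Space 2, Real.exp (-(2 * a) * ‖y‖ ^ 2) * Real.exp (-(2 * a) * ‖q + y‖ ^ 2) =
      Real.exp (-a * ‖q‖ ^ 2) * Real.exp (-(4 * a) * ‖y + (1 / 2 : ℝ) • q‖ ^ 2) := fun q y => by
    rw [← Real.exp_add, ← Real.exp_add]
    congr 1
    linear_combination -(2 * a) * norm_sq_add_norm_add_sq q y
  simp only [e, integral_const_mul] at h
  simp only [integral_add_right_eq_self (fun y : Space 2 => Real.exp (-(4 * a) * ‖y‖ ^ 2))] at h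
  rw [tsum_mul_right, integral_exp_neg_mul_sq (by positivity), integral_exp_neg_mul_sq (by positivity)] at h
  have := Real.pi_pos
  have h4 : (Real.pi / (2 * a)) ^ 2 = Real.pi / a * (Real.pi / (4 * a)) := by field_simp; norm_num
  rw [h4] at h
  exact le_of_mul_le_mul_right h (by positivity)

/-- Apply the periodization inequality to y_i exp(-2a‖y‖²) for both coordinates and add; the
autocorrelations sum to a positive multiple of the terms here. Formally, this is monotonicity of a
times the theta function in a. -/
theorem tsum_one_sub_mul_exp_nonneg (hcov : ZLattice.covolume Λ = 1) {a : ℝ} (ha : 0 < a) :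
    0 ≤ ∑' q : Λ, (1 - a * ‖(q : Space 2)‖ ^ 2) * Real.exp (-a * ‖(q : Space 2)‖ ^ 2) := by
  have key : ∀ i : Fin 2, (∀ q : Space 2, Integrable fun y : Space 2 =>
      (y i * Real.exp (-(2 * a) * ‖y‖ ^ 2)) * ((q + y) i * Real.exp (-(2 * a) * ‖q + y‖ ^ 2))) ∧
      Summable (fun q : Λ => ∫ y : Space 2, (y i * Real.exp (-(2 * a) * ‖y‖ ^ 2)) *
      (((q : Space 2) + y) i * Real.exp (-(2 * a) * ‖(q : Space 2) + y‖ ^ 2))) ∧ 0 ≤ ∑' q : Λ,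
      ∫ y : Space 2, (y i * Real.exp (-(2 * a) * ‖y‖ ^ 2)) *
      (((q : Space 2) + y) i * Real.exp (-(2 * a) * ‖(q : Space 2) + y‖ ^ 2)) := fun i => by
    have h := sq_integral_le_tsum_of_le_exp hcov
      (h := fun y => y i * Real.exp (-(2 * a) * ‖y‖ ^ 2)) (by fun_prop) (C := 1 + a⁻¹) (by positivity)
      ha fun y => by
        rw [abs_mul, Real.abs_exp]
        have h1 : |y i| ≤ ‖y‖ := by simpa using PiLp.norm_apply_le y i
        have h2 : a * ‖y‖ ^ 2 + 1 ≤ Real.exp (a * ‖y‖ ^ 2) := Real.add_one_le_exp _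
        have h3 : ‖y‖ ≤ (1 + a⁻¹) * (a * ‖y‖ ^ 2 + 1) := by
          have : (1 + a⁻¹) * (a * ‖y‖ ^ 2 + 1) = a * ‖y‖ ^ 2 + 1 + ‖y‖ ^ 2 + a⁻¹ := by
            field_simp
            ring
          rw [this]
          have : 0 ≤ a⁻¹ := by positivity
          nlinarith [sq_nonneg (‖y‖ - 1), mul_nonneg ha.le (sq_nonneg ‖y‖), norm_nonneg y]
        calc |y i| * Real.exp (-(2 * a) * ‖y‖ ^ 2)
            ≤ (1 + a⁻¹) * Real.exp (a * ‖y‖ ^ 2) * Real.exp (-(2 * a) * ‖y‖ ^ 2) := by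
              gcongr
              refine h1.trans (h3.trans ?_)
              gcongr
          _ = _ := by
              rw [mul_assoc, ← Real.exp_add]
              ring_nf
    exact ⟨h.1, h.2.1, (sq_nonneg _).trans h.2.2⟩
  have h := add_nonneg (key 0).2.2 (key 1).2.2
  rw [← (key 0).2.1.tsum_add (key 1).2.1] at h
  have e : ∀ q y : Space 2, (y 0 * Real.exp (-(2 * a) * ‖y‖ ^ 2)) *
      ((q + y) 0 * Real.exp (-(2 * a) * ‖q + y‖ ^ 2)) + (y 1 * Real.exp (-(2 * a) * ‖y‖ ^ 2)) *
      ((q + y) 1 * Real.exp (-(2 * a) * ‖q + y‖ ^ 2)) = Real.exp (-a * ‖q‖ ^ 2) *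
      (‖y + (1 / 2 : ℝ) • q‖ ^ 2 * Real.exp (-(4 * a) * ‖y + (1 / 2 : ℝ) • q‖ ^ 2) -
        ‖q‖ ^ 2 / 4 * Real.exp (-(4 * a) * ‖y + (1 / 2 : ℝ) • q‖ ^ 2)) := fun q y => by
    have h1 : Real.exp (-(2 * a) * ‖y‖ ^ 2) * Real.exp (-(2 * a) * ‖q + y‖ ^ 2) =
        Real.exp (-a * ‖q‖ ^ 2) * Real.exp (-(4 * a) * ‖y + (1 / 2 : ℝ) • q‖ ^ 2) := by
      rw [← Real.exp_add, ← Real.exp_add]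
      congr 1
      linear_combination -(2 * a) * norm_sq_add_norm_add_sq q y
    have h2 : y 0 * (q + y) 0 + y 1 * (q + y) 1 = ‖y + (1 / 2 : ℝ) • q‖ ^ 2 - ‖q‖ ^ 2 / 4 := by
      simp only [EuclideanSpace.real_norm_sq_eq, Fin.sum_univ_two, PiLp.add_apply, PiLp.smul_apply,
        smul_eq_mul]
      ring
    linear_combination (y 0 * (q + y) 0 + y 1 * (q + y) 1) * h1 + Real.exp (-a * ‖q‖ ^ 2) *
      Real.exp (-(4 * a) * ‖y + (1 / 2 : ℝ) • q‖ ^ 2) * h2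
  have h4 : 0 < 4 * a := by positivity
  have hint : ∀ q : Space 2, (∫ y : Space 2, (y 0 * Real.exp (-(2 * a) * ‖y‖ ^ 2)) *
      ((q + y) 0 * Real.exp (-(2 * a) * ‖q + y‖ ^ 2))) +
      (∫ y : Space 2, (y 1 * Real.exp (-(2 * a) * ‖y‖ ^ 2)) *
      ((q + y) 1 * Real.exp (-(2 * a) * ‖q + y‖ ^ 2))) =
      Real.pi / (16 * a ^ 2) * ((1 - a * ‖q‖ ^ 2) * Real.exp (-a * ‖q‖ ^ 2)) := fun q => by
    rw [← integral_add ((key 0).1 q) ((key 1).1 q)]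
    simp only [e q, integral_const_mul]
    rw [integral_add_right_eq_self (fun y : Space 2 => ‖y‖ ^ 2 * Real.exp (-(4 * a) * ‖y‖ ^ 2) -
      ‖q‖ ^ 2 / 4 * Real.exp (-(4 * a) * ‖y‖ ^ 2)), integral_sub (integrable_mul_sq_exp_neg h4)
      ((integrable_exp_neg_mul_sq_norm h4).const_mul _), integral_const_mul,
      integral_exp_neg_mul_sq h4, integral_mul_sq_exp_neg h4]
    field_simp
    ring
  simp only [hint, tsum_mul_left] at h
  have := Real.pi_pos
  exact nonneg_of_mul_nonneg_right h (by positivity)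

end

section

variable {Λ : Submodule ℤ (Space 2)} [DiscreteTopology Λ] [IsZLattice ℝ Λ]

theorem summable_norm_sq_mul_exp {d : ℕ} (Λ : Submodule ℤ (Space d)) [DiscreteTopology Λ]
    [IsZLattice ℝ Λ] {a : ℝ} (ha : 0 < a) :
    Summable fun q : Λ => ‖(q : Space d)‖ ^ 2 * Real.exp (-a * ‖(q : Space d)‖ ^ 2) := by
  refine Summable.of_nonneg_of_le (fun q => by positivity) (fun q => ?_)
    ((summable_exp_neg_mul_sq Λ (half_pos ha)).mul_left (2 / a))
  set x := ‖(q : Space d)‖ ^ 2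
  have h1 : a / 2 * x ≤ Real.exp (a / 2 * x) := by linarith [Real.add_one_le_exp (a / 2 * x)]
  have h2 : Real.exp (-(a / 2) * x) = Real.exp (a / 2 * x) * Real.exp (-a * x) := by
    rw [← Real.exp_add]
    ring_nf
  rw [h2, ← mul_assoc]
  gcongr
  rw [div_mul_eq_mul_div, le_div_iff₀ ha]
  linarith

/-- Comparison of the theta function with an exponential, by the tangent line at `π / 2`. -/
theorem one_add_exp_le_tsum (hcov : ZLattice.covolume Λ = 1) {b : ℝ} (hb : 1 / 2 ≤ b) :
    1 + Real.exp (-(4 * b - 2)) ≤ ∑' q : Λ, Real.exp (-(Real.pi * b) * ‖(q : Space 2)‖ ^ 2) := by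
  have hpi := Real.pi_pos
  set a := Real.pi / 2 with ha
  have ha0 : 0 < a := by positivity
  set β := Real.pi * b - a with hβ
  have hβ0 : 0 ≤ β := by rw [hβ, ha]; nlinarith
  set E := Real.exp (-(4 * b - 2)) with hE
  have hE0 : 0 < E := Real.exp_pos _
  have hx1 : β * (2 / a) = 4 * b - 2 := by rw [hβ, ha]; field_simp; ring
  have s0 := summable_exp_neg_mul_sq Λ ha0
  have s1 := summable_norm_sq_mul_exp Λ ha0
  have sb := summable_exp_neg_mul_sq Λ (show 0 < Real.pi * b by positivity)
  set S := ∑' q : Λ, Real.exp (-a * ‖(q : Space 2)‖ ^ 2) with hS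
  set T := ∑' q : Λ, ‖(q : Space 2)‖ ^ 2 * Real.exp (-a * ‖(q : Space 2)‖ ^ 2) with hT
  have hS2 : 2 ≤ S := by
    have := le_tsum_exp_neg_mul_sq hcov ha0
    rwa [show Real.pi / a = 2 by rw [ha]; field_simp] at this
  have hTS : a * T ≤ S := by
    have := tsum_one_sub_mul_exp_nonneg hcov ha0
    simp only [sub_mul, one_mul, mul_assoc] at this
    rw [s0.tsum_sub (s1.mul_left a), tsum_mul_left] at this
    linarith
  have sg := (s0.mul_left (E * (1 + (4 * b - 2)))).sub (s1.mul_left (E * β))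
  -- Tangent line of exp(-βx) at x = 2/a, where βx = 4b - 2. This is the mean of ‖q‖² over nonzero
  -- q, weighted by exp(-a‖q‖²), in the extremal case S = 2, aT = S.
  have hg : ∀ q : Λ, 0 ≤ Real.exp (-(Real.pi * b) * ‖(q : Space 2)‖ ^ 2) -
      (E * (1 + (4 * b - 2)) * Real.exp (-a * ‖(q : Space 2)‖ ^ 2) -
        E * β * (‖(q : Space 2)‖ ^ 2 * Real.exp (-a * ‖(q : Space 2)‖ ^ 2))) := fun q => by
    set x := ‖(q : Space 2)‖ ^ 2
    have h1 := Real.add_one_le_exp (4 * b - 2 - β * x)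
    have h2 : Real.exp (-(Real.pi * b) * x) =
        E * Real.exp (-a * x) * Real.exp (4 * b - 2 - β * x) := by
      rw [hE, ← Real.exp_add, ← Real.exp_add, hβ]
      ring_nf
    rw [h2]
    have h3 : 0 < E * Real.exp (-a * x) := by positivity
    nlinarith
  -- The tangent line is used for q ≠ 0 only: the exact difference at q = 0 is retained, which
  -- yields the summand 1.
  have h := (sb.sub sg).le_tsum 0 fun q _ => hg q
  rw [sb.tsum_sub sg, (s0.mul_left _).tsum_sub (s1.mul_left _), tsum_mul_left, tsum_mul_left,
    ← hS, ← hT] at h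
  simp only [ZeroMemClass.coe_zero, norm_zero, zero_pow two_ne_zero, mul_zero,
    Real.exp_zero, mul_one, sub_zero] at h
  have h5 : β * T ≤ (2 * b - 1) * S := by
    have : β = (2 * b - 1) * a := by rw [hβ, ha]; ring
    rw [this, mul_assoc]
    exact mul_le_mul_of_nonneg_left hTS (by linarith)
  have h6 : 0 ≤ E * ((2 * b - 1) * S - β * T) := mul_nonneg hE0.le (by linarith)
  have h7 : 0 ≤ E * ((2 * b - 1) * (S - 2)) :=
    mul_nonneg hE0.le (mul_nonneg (by linarith) (by linarith))
  have h8 : 0 ≤ E * (S - 2) := mul_nonneg hE0.le (by linarith)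
  nlinarith

theorem tsum_compl_exp_eq {a : ℝ} (ha : 0 < a) :
    ∑' q : ({0}ᶜ : Set Λ), ENNReal.ofReal (Real.exp (-a * ‖(q : Space 2)‖ ^ 2)) =
      ENNReal.ofReal (∑' q : Λ, Real.exp (-a * ‖(q : Space 2)‖ ^ 2) - 1) := by
  have s := summable_exp_neg_mul_sq Λ ha
  have h : ENNReal.ofReal (∑' q : ({0}ᶜ : Set Λ), Real.exp (-a * ‖(q : Space 2)‖ ^ 2)) =
      ∑' q : ({0}ᶜ : Set Λ), ENNReal.ofReal (Real.exp (-a * ‖(q : Space 2)‖ ^ 2)) :=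
    ENNReal.ofReal_tsum_of_nonneg (fun _ => (Real.exp_pos _).le) (s.subtype ({0}ᶜ : Set Λ))
  rw [← h, ← s.tsum_subtype_add_tsum_subtype_compl {0},
    tsum_singleton (0 : Λ) fun q : Λ => Real.exp (-a * ‖(q : Space 2)‖ ^ 2)]
  simp

end

/-! ### Lattice sums of inverse powers as Mellin transforms of the theta function -/

theorem integrableOn_pow_mul_exp (m : ℕ) :
    IntegrableOn (fun b : ℝ => b ^ m * Real.exp (-(4 * b - 2))) (Set.Ioi (1 / 2)) := by
  have h := integrableOn_rpow_mul_exp_neg_mul_rpow (s := m) (p := 1) (b := 4)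
    (by have : (0 : ℝ) ≤ m := m.cast_nonneg
        linarith) one_pos (by norm_num)
  have h' : IntegrableOn (fun b : ℝ => Real.exp 2 * (b ^ (m : ℝ) * Real.exp (-4 * b ^ (1 : ℝ))))
      (Set.Ioi (1 / 2)) :=
    (h.mono_set (Set.Ioi_subset_Ioi (by norm_num : (0 : ℝ) ≤ 1 / 2))).const_mul _
  refine h'.congr_fun (fun b _ => ?_) measurableSet_Ioi
  simp only [Real.rpow_one, Real.rpow_natCast]
  rw [mul_left_comm, ← Real.exp_add]
  ring_nf

theorem tendsto_pow_mul_exp (m : ℕ) :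
    Tendsto (fun b : ℝ => b ^ m * Real.exp (-(4 * b - 2))) atTop (𝓝 0) := by
  have h := (tendsto_rpow_mul_exp_neg_mul_atTop_nhds_zero m 4 (by norm_num)).const_mul (Real.exp 2)
  rw [mul_zero] at h
  refine h.congr fun b => ?_
  rw [Real.rpow_natCast, mul_left_comm, ← Real.exp_add]
  ring_nf

theorem hasDerivAt_exp_neg_four (b : ℝ) :
    HasDerivAt (fun b : ℝ => Real.exp (-(4 * b - 2))) (-4 * Real.exp (-(4 * b - 2))) b := by
  have h : HasDerivAt (fun b : ℝ => -(4 * b - 2)) (-4) b := by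
    have := (((hasDerivAt_id b).const_mul 4).sub_const 2).neg
    rw [mul_one] at this
    exact this
  rw [mul_comm]
  exact h.exp

theorem integral_exp_neg_four : ∫ b in Set.Ioi (1 / 2 : ℝ), Real.exp (-(4 * b - 2)) = 1 / 4 := by
  have h := integral_Ioi_of_hasDerivAt_of_tendsto' (a := 1 / 2) (m := 0)
    (f := fun b : ℝ => -(1 / 4) * Real.exp (-(4 * b - 2))) (f' := fun b => Real.exp (-(4 * b - 2)))
    (fun b _ => by
      convert! (hasDerivAt_exp_neg_four b).const_mul (-(1 / 4)) using 1
      ring) (by simpa using integrableOn_pow_mul_exp 0)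
    (by simpa only [pow_zero, one_mul, mul_zero] using (tendsto_pow_mul_exp 0).const_mul (-(1 / 4)))
  rw [h]
  norm_num

theorem integral_pow_succ_mul_exp (m : ℕ) :
    ∫ b in Set.Ioi (1 / 2 : ℝ), b ^ (m + 1) * Real.exp (-(4 * b - 2)) = (1 / 2) ^ (m + 1) / 4 +
      (m + 1) / 4 * ∫ b in Set.Ioi (1 / 2 : ℝ), b ^ m * Real.exp (-(4 * b - 2)) := by
  have i1 := integrableOn_pow_mul_exp (m + 1)
  have i2 := (integrableOn_pow_mul_exp m).const_mul ((m + 1) / 4)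
  have h := integral_Ioi_of_hasDerivAt_of_tendsto' (a := 1 / 2) (m := 0)
    (f := fun b : ℝ => -(1 / 4) * (b ^ (m + 1) * Real.exp (-(4 * b - 2))))
    (f' := fun b => b ^ (m + 1) * Real.exp (-(4 * b - 2)) -
      (m + 1) / 4 * (b ^ m * Real.exp (-(4 * b - 2))))
    (fun b _ => by
      convert! ((hasDerivAt_pow (m + 1) b).mul (hasDerivAt_exp_neg_four b)).const_mul (-(1 / 4)) using 1
      push_cast
      ring) (i1.sub i2) (by
      simpa only [mul_zero] using (tendsto_pow_mul_exp (m + 1)).const_mul (-(1 / 4)))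
  rw [integral_sub i1 i2, integral_const_mul] at h
  rw [show -(4 * (1 / 2) - 2 : ℝ) = 0 by norm_num, Real.exp_zero] at h
  linarith

/-- Holds without integrability because the Bochner integral then defaults to 0. -/
theorem ofReal_integral_le_lintegral {α : Type*} [MeasurableSpace α] {μ : Measure α} (f : α → ℝ) :
    ENNReal.ofReal (∫ x, f x ∂μ) ≤ ∫⁻ x, ENNReal.ofReal (f x) ∂μ := by
  by_cases hf : Integrable f μ
  · rw [integral_eq_lintegral_pos_part_sub_lintegral_neg_part hf]
    exact (ENNReal.ofReal_le_ofReal (sub_le_self _ ENNReal.toReal_nonneg)).trans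
      ENNReal.ofReal_toReal_le
  · simp [integral_undef hf]

/-- A lower bound for `Γ (n + 3 / 2) π ^ (-n - 3 / 2)` times the lattice sum of
`‖q‖ ^ (-2 n - 3)`. -/
noncomputable def latticeSumBound (n : ℕ) : ℝ :=
  (∫ b in Set.Ioc (0 : ℝ) (1 / 2), (b ^ (n - 1 / 2 : ℝ) - b ^ (n + 1 / 2 : ℝ))) +
    ∫ b in Set.Ioi (1 / 2 : ℝ),
      (3 / 2 * (b ^ (n + 1) * Real.exp (-(4 * b - 2))) -
        1 / 2 * (b ^ (n + 2) * Real.exp (-(4 * b - 2))))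

/-- A polynomial minorant that meets √b at 0 and touches it at 1; it turns the integrals over (1/2,
∞) into rational numbers. -/
theorem le_sqrt_of_pos {b : ℝ} (hb : 0 < b) : 3 / 2 * b - 1 / 2 * b ^ 2 ≤ √b := by
  have h1 := Real.sq_sqrt hb.le
  have h2 := Real.sqrt_pos.2 hb
  set s := √b
  rw [← h1]
  have : s - (3 / 2 * s ^ 2 - 1 / 2 * (s ^ 2) ^ 2) = s * (s - 1) ^ 2 * (s + 2) / 2 := by ring
  have : 0 ≤ s * (s - 1) ^ 2 * (s + 2) / 2 := by positivity
  linarith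

theorem lintegral_rpow_mul_exp_norm {q : Space 2} (hq : q ≠ 0) (n : ℕ) :
    ∫⁻ b in Set.Ioi (0 : ℝ), ENNReal.ofReal (b ^ (n + 1 / 2 : ℝ)) *
      ENNReal.ofReal (Real.exp (-(Real.pi * b) * ‖q‖ ^ 2)) =
      ENNReal.ofReal (Real.Gamma (n + 3 / 2) / Real.pi ^ (n + 3 / 2 : ℝ) *
        (‖q‖ ^ (2 * n + 3))⁻¹) := by
  have hpi := Real.pi_pos
  have hq0 : 0 < ‖q‖ := norm_pos_iff.2 hq
  have ha : (0 : ℝ) < n + 3 / 2 := by positivity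
  have hr : 0 < Real.pi * ‖q‖ ^ 2 := by positivity
  have h := Real.integral_rpow_mul_exp_neg_mul_Ioi ha hr
  have hv : (1 / (Real.pi * ‖q‖ ^ 2)) ^ (n + 3 / 2 : ℝ) * Real.Gamma (n + 3 / 2) =
      Real.Gamma (n + 3 / 2) / Real.pi ^ (n + 3 / 2 : ℝ) * (‖q‖ ^ (2 * n + 3))⁻¹ := by
    rw [one_div, Real.inv_rpow hr.le, Real.mul_rpow hpi.le (by positivity), ← Real.rpow_natCast ‖q‖ 2,
      ← Real.rpow_mul hq0.le, ← Real.rpow_natCast ‖q‖ (2 * n + 3)]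
    have : ((2 : ℕ) : ℝ) * (n + 3 / 2) = ((2 * n + 3 : ℕ) : ℝ) := by push_cast; ring
    rw [this, mul_inv, div_eq_mul_inv]
    ring
  have hpos : 0 < Real.Gamma (n + 3 / 2) / Real.pi ^ (n + 3 / 2 : ℝ) * (‖q‖ ^ (2 * n + 3))⁻¹ := by
    have := Real.Gamma_pos_of_pos ha
    positivity
  rw [← hv, ← h, ofReal_integral_eq_lintegral_ofReal]
  · refine setLIntegral_congr_fun measurableSet_Ioi fun b hb => ?_
    have hb' : 0 < b := hb
    rw [← ENNReal.ofReal_mul (by positivity)]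
    congr 2
    · congr 1
      ring
    · ring_nf
  · refine Integrable.of_integral_ne_zero ?_
    rw [h, hv]
    exact hpos.ne'
  · filter_upwards [ae_restrict_mem measurableSet_Ioi] with b hb
    have hb' : 0 < b := hb
    simp only [Pi.zero_apply]
    positivity

variable {Λ : Submodule ℤ (Space 2)} [DiscreteTopology Λ] [IsZLattice ℝ Λ]

/-- Summing the Mellin representation over q ≠ 0 gives the integral of b^(n+1/2) (θ(b) - 1), θ being
the theta function. Below 1/2 the bound θ(b) ≥ 1/b is used, above 1/2 the bound θ(b) ≥ 1 + exp(-(4b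
- 2)); both equal 2 at b = 1/2. -/
theorem latticeSumBound_le (hcov : ZLattice.covolume Λ = 1) (n : ℕ) :
    ENNReal.ofReal (latticeSumBound n) ≤ ∑' q : ({0}ᶜ : Set Λ),
      ENNReal.ofReal (Real.Gamma (n + 3 / 2) / Real.pi ^ (n + 3 / 2 : ℝ) *
        (‖(q : Space 2)‖ ^ (2 * n + 3))⁻¹) := by
  have hpi := Real.pi_pos
  have hm : ∀ q : ({0}ᶜ : Set Λ), AEMeasurable (fun b : ℝ => ENNReal.ofReal (b ^ (n + 1 / 2 : ℝ)) *
      ENNReal.ofReal (Real.exp (-(Real.pi * b) * ‖(q : Space 2)‖ ^ 2)))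
      (volume.restrict (Set.Ioi 0)) := fun q =>
    ((by fun_prop : Measurable fun b : ℝ => b ^ (n + 1 / 2 : ℝ)).ennreal_ofReal.mul
      (by fun_prop : Measurable fun b : ℝ =>
        Real.exp (-(Real.pi * b) * ‖(q : Space 2)‖ ^ 2)).ennreal_ofReal).aemeasurable
  have e : ∑' q : ({0}ᶜ : Set Λ), ENNReal.ofReal (Real.Gamma (n + 3 / 2) /
      Real.pi ^ (n + 3 / 2 : ℝ) * (‖(q : Space 2)‖ ^ (2 * n + 3))⁻¹) =
      ∫⁻ b in Set.Ioi (0 : ℝ), ENNReal.ofReal (b ^ (n + 1 / 2 : ℝ)) *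
        ENNReal.ofReal (∑' q : Λ, Real.exp (-(Real.pi * b) * ‖(q : Space 2)‖ ^ 2) - 1) := by
    have e1 : ∀ q : ({0}ᶜ : Set Λ), ENNReal.ofReal (Real.Gamma (n + 3 / 2) /
      Real.pi ^ (n + 3 / 2 : ℝ) * (‖(q : Space 2)‖ ^ (2 * n + 3))⁻¹) = _ := fun q =>
      (lintegral_rpow_mul_exp_norm (fun h => q.2 (Subtype.ext h)) n).symm
    simp only [e1]
    rw [← lintegral_tsum hm]
    refine setLIntegral_congr_fun measurableSet_Ioi fun b hb => ?_
    have hb' : 0 < b := hb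
    rw [ENNReal.tsum_mul_left, tsum_compl_exp_eq (by positivity)]
  rw [e, ← Set.Ioc_union_Ioi_eq_Ioi (show (0 : ℝ) ≤ 1 / 2 by norm_num),
    lintegral_union measurableSet_Ioi (Set.Ioc_disjoint_Ioi le_rfl), latticeSumBound]
  refine ENNReal.ofReal_add_le.trans (add_le_add ?_ ?_)
  · refine (ofReal_integral_le_lintegral _).trans (setLIntegral_mono' measurableSet_Ioc fun b hb => ?_)
    have hb0 : 0 < b := hb.1
    rw [← ENNReal.ofReal_mul (by positivity)]
    refine ENNReal.ofReal_le_ofReal ?_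
    have h1 := le_tsum_exp_neg_mul_sq hcov (show 0 < Real.pi * b by positivity)
    have h2 : Real.pi / (Real.pi * b) = b⁻¹ := by field_simp
    have h3 : b ^ (n - 1 / 2 : ℝ) = b ^ (n + 1 / 2 : ℝ) * b⁻¹ := by
      rw [← Real.rpow_neg_one, ← Real.rpow_add hb0]
      ring_nf
    rw [h2] at h1
    rw [h3, ← mul_sub_one]
    gcongr
  · refine (ofReal_integral_le_lintegral _).trans (setLIntegral_mono' measurableSet_Ioi fun b hb => ?_)
    have hb1 : 1 / 2 < b := hb
    have hb0 : 0 < b := by linarith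
    rw [← ENNReal.ofReal_mul (by positivity)]
    refine ENNReal.ofReal_le_ofReal ?_
    have h1 := one_add_exp_le_tsum hcov hb1.le
    have h2 : b ^ (n + 1 / 2 : ℝ) = b ^ n * √b := by
      rw [Real.rpow_add hb0, Real.rpow_natCast, Real.sqrt_eq_rpow]
    calc _ = b ^ n * (3 / 2 * b - 1 / 2 * b ^ 2) * Real.exp (-(4 * b - 2)) := by ring
      _ ≤ b ^ n * √b * Real.exp (-(4 * b - 2)) := by
        gcongr
        exact le_sqrt_of_pos hb0
      _ ≤ _ := by
        rw [h2]
        gcongr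
        linarith

/-! ### Explicit values of the lattice-sum bounds -/

theorem latticeSumBound_eq (n : ℕ) : latticeSumBound n =
    (1 / 2) ^ n * √(1 / 2) * ((n + 1 / 2 : ℝ)⁻¹ - 1 / 2 * (n + 3 / 2 : ℝ)⁻¹) +
    (3 / 2 * (∫ b in Set.Ioi (1 / 2 : ℝ), b ^ (n + 1) * Real.exp (-(4 * b - 2))) -
      1 / 2 * ∫ b in Set.Ioi (1 / 2 : ℝ), b ^ (n + 2) * Real.exp (-(4 * b - 2))) := by
  have hn : (0 : ℝ) ≤ n := n.cast_nonneg
  rw [latticeSumBound, integral_sub ((integrableOn_pow_mul_exp _).const_mul _)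
    ((integrableOn_pow_mul_exp _).const_mul _), integral_const_mul, integral_const_mul,
    ← intervalIntegral.integral_of_le (by norm_num), intervalIntegral.integral_sub
    (intervalIntegral.intervalIntegrable_rpow' (by linarith))
    (intervalIntegral.intervalIntegrable_rpow' (by linarith)),
    integral_rpow (Or.inl (by linarith)), integral_rpow (Or.inl (by linarith))]
  congr 1
  have h1 : (n - 1 / 2 + 1 : ℝ) = n + 1 / 2 := by ring
  have h2 : (n + 1 / 2 + 1 : ℝ) = n + 3 / 2 := by ring
  have h3 : (n + 3 / 2 : ℝ) = (n + 1 : ℕ) + 1 / 2 := by push_cast; ring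
  have h4 : (1 / 2 : ℝ) ^ (n + 1 / 2 : ℝ) = (1 / 2) ^ n * √(1 / 2) := by
    rw [Real.rpow_add (by norm_num), Real.rpow_natCast, Real.sqrt_eq_rpow]
  have h5 : (1 / 2 : ℝ) ^ (n + 3 / 2 : ℝ) = (1 / 2) ^ (n + 1) * √(1 / 2) := by
    rw [h3, Real.rpow_add (by norm_num), Real.rpow_natCast, Real.sqrt_eq_rpow]
  rw [h1, h2, h4, h5, Real.zero_rpow (by positivity), Real.zero_rpow (by positivity)]
  rw [pow_succ]
  ring

theorem integral_pow_mul_exp_values :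
    (∫ b in Set.Ioi (1 / 2 : ℝ), b ^ 1 * Real.exp (-(4 * b - 2))) = 3 / 16 ∧
    (∫ b in Set.Ioi (1 / 2 : ℝ), b ^ 2 * Real.exp (-(4 * b - 2))) = 5 / 32 ∧
    (∫ b in Set.Ioi (1 / 2 : ℝ), b ^ 3 * Real.exp (-(4 * b - 2))) = 19 / 128 ∧
    (∫ b in Set.Ioi (1 / 2 : ℝ), b ^ 4 * Real.exp (-(4 * b - 2))) = 21 / 128 := by
  have h1 : (∫ b in Set.Ioi (1 / 2 : ℝ), b ^ 1 * Real.exp (-(4 * b - 2))) = 3 / 16 := by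
    rw [integral_pow_succ_mul_exp 0]
    simp only [pow_zero, one_mul, integral_exp_neg_four]
    norm_num
  have h2 : (∫ b in Set.Ioi (1 / 2 : ℝ), b ^ 2 * Real.exp (-(4 * b - 2))) = 5 / 32 := by
    rw [integral_pow_succ_mul_exp 1, h1]
    norm_num
  have h3 : (∫ b in Set.Ioi (1 / 2 : ℝ), b ^ 3 * Real.exp (-(4 * b - 2))) = 19 / 128 := by
    rw [integral_pow_succ_mul_exp 2, h2]
    norm_num
  refine ⟨h1, h2, h3, ?_⟩
  rw [integral_pow_succ_mul_exp 3, h3]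
  norm_num

theorem latticeSumBound_zero : latticeSumBound 0 = √(1 / 2) * (5 / 3) + 13 / 64 := by
  obtain ⟨h1, h2, -, -⟩ := integral_pow_mul_exp_values
  rw [latticeSumBound_eq, h1, h2]
  norm_num

theorem latticeSumBound_one : latticeSumBound 1 = √(1 / 2) * (7 / 30) + 41 / 256 := by
  obtain ⟨-, h2, h3, -⟩ := integral_pow_mul_exp_values
  rw [latticeSumBound_eq, h2, h3]
  norm_num
  ring

theorem latticeSumBound_two : latticeSumBound 2 = √(1 / 2) * (9 / 140) + 9 / 64 := by
  obtain ⟨-, -, h3, h4⟩ := integral_pow_mul_exp_values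
  rw [latticeSumBound_eq, h3, h4]
  norm_num
  ring

theorem gamma_div_pi_pow_values :
    Real.Gamma ((0 : ℕ) + 3 / 2) / Real.pi ^ ((0 : ℕ) + 3 / 2 : ℝ) = (2 * Real.pi)⁻¹ ∧
    Real.Gamma ((1 : ℕ) + 3 / 2) / Real.pi ^ ((1 : ℕ) + 3 / 2 : ℝ) = (4 / 3 * Real.pi ^ 2)⁻¹ ∧
    Real.Gamma ((2 : ℕ) + 3 / 2) / Real.pi ^ ((2 : ℕ) + 3 / 2 : ℝ) = (8 / 15 * Real.pi ^ 3)⁻¹ := by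
  have hpi := Real.pi_pos
  have hs := Real.sqrt_pos.2 hpi
  have g0 : Real.Gamma (3 / 2) = √Real.pi / 2 := by
    rw [show (3 / 2 : ℝ) = 1 / 2 + 1 by norm_num, Real.Gamma_add_one (by norm_num),
      Real.Gamma_one_half_eq]
    ring
  have g1 : Real.Gamma (5 / 2) = 3 / 4 * √Real.pi := by
    rw [show (5 / 2 : ℝ) = 3 / 2 + 1 by norm_num, Real.Gamma_add_one (by norm_num), g0]
    ring
  have g2 : Real.Gamma (7 / 2) = 15 / 8 * √Real.pi := by
    rw [show (7 / 2 : ℝ) = 5 / 2 + 1 by norm_num, Real.Gamma_add_one (by norm_num), g1]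
    ring
  have hp : ∀ n : ℕ, Real.pi ^ (n + 3 / 2 : ℝ) = Real.pi ^ (n + 1) * √Real.pi := fun n => by
    rw [show (n + 3 / 2 : ℝ) = (n + 1 : ℕ) + 1 / 2 by push_cast; ring, Real.rpow_add hpi,
      Real.rpow_natCast, Real.sqrt_eq_rpow]
  refine ⟨?_, ?_, ?_⟩
  · rw [hp, show ((0 : ℕ) + 3 / 2 : ℝ) = 3 / 2 by norm_num, g0]
    field_simp
    norm_num
  · rw [hp, show ((1 : ℕ) + 3 / 2 : ℝ) = 5 / 2 by norm_num, g1]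
    field_simp
  · rw [hp, show ((2 : ℕ) + 3 / 2 : ℝ) = 7 / 2 by norm_num, g2]
    field_simp

theorem crossIntegral_nonneg {d : ℕ} (Λ : Submodule ℤ (Space d)) (ρ : ℝ) :
    0 ≤ crossIntegral Λ ρ :=
  integral_nonneg fun z => mul_nonneg (crossOverlap_nonneg _ _ _) (by positivity)

theorem latticeSumBound_nonneg (n : ℕ) (hn : n < 3) : 0 ≤ latticeSumBound n := by
  interval_cases n
  · rw [latticeSumBound_zero]
    positivity
  · rw [latticeSumBound_one]
    positivity
  · rw [latticeSumBound_two]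
    positivity

/-- Each power of the two-disc bound is divided by its Gamma factor: the coefficients 9/4 · 4/3 = 3
and 375/64 · 8/15 = 25/8 arise in this way. -/
theorem IsPacking.le_crossIntegral (hcov : ZLattice.covolume Λ = 1) {ρ : ℝ} (hρ : 0 < ρ)
    (h : IsPacking Λ ρ) :
    Real.pi ^ 2 * ρ ^ 4 * (2 * Real.pi * latticeSumBound 0 +
      3 * Real.pi ^ 2 * ρ ^ 2 * latticeSumBound 1 +
      25 / 8 * Real.pi ^ 3 * ρ ^ 4 * latticeSumBound 2) ≤ crossIntegral Λ ρ := by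
  have hpi := Real.pi_pos
  obtain ⟨k0, k1, k2⟩ := gamma_div_pi_pow_values
  have l0 := latticeSumBound_le hcov 0
  have l1 := latticeSumBound_le hcov 1
  have l2 := latticeSumBound_le hcov 2
  have p0 := latticeSumBound_nonneg 0 (by norm_num)
  have p1 := latticeSumBound_nonneg 1 (by norm_num)
  have p2 := latticeSumBound_nonneg 2 (by norm_num)
  rw [k0] at l0
  rw [k1] at l1
  rw [k2] at l2
  have e : ∀ q : ({0}ᶜ : Set Λ), ENNReal.ofReal (discInteraction ρ ‖(q : Space 2)‖) =
      ENNReal.ofReal (Real.pi ^ 2 * ρ ^ 4 * (2 * Real.pi)) *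
        ENNReal.ofReal ((2 * Real.pi)⁻¹ * (‖(q : Space 2)‖ ^ (2 * 0 + 3))⁻¹) +
      ENNReal.ofReal (Real.pi ^ 2 * ρ ^ 4 * (3 * Real.pi ^ 2 * ρ ^ 2)) *
        ENNReal.ofReal ((4 / 3 * Real.pi ^ 2)⁻¹ * (‖(q : Space 2)‖ ^ (2 * 1 + 3))⁻¹) +
      ENNReal.ofReal (Real.pi ^ 2 * ρ ^ 4 * (25 / 8 * Real.pi ^ 3 * ρ ^ 4)) *
        ENNReal.ofReal ((8 / 15 * Real.pi ^ 3)⁻¹ * (‖(q : Space 2)‖ ^ (2 * 2 + 3))⁻¹) := fun q => by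
    rw [← ENNReal.ofReal_mul (by positivity), ← ENNReal.ofReal_mul (by positivity),
      ← ENNReal.ofReal_mul (by positivity), ← ENNReal.ofReal_add (by positivity) (by positivity),
      ← ENNReal.ofReal_add (by positivity) (by positivity), discInteraction]
    congr 1
    simp only [Nat.reduceMul, Nat.reduceAdd]
    generalize (‖(q : Space 2)‖ ^ 3)⁻¹ = x
    generalize (‖(q : Space 2)‖ ^ 5)⁻¹ = y
    generalize (‖(q : Space 2)‖ ^ 7)⁻¹ = z
    field_simp
    ring
  have key := h.tsum_discInteraction_le hρ
  simp only [e] at key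
  rw [ENNReal.tsum_add, ENNReal.tsum_add, ENNReal.tsum_mul_left, ENNReal.tsum_mul_left,
    ENNReal.tsum_mul_left] at key
  rw [← ENNReal.ofReal_le_ofReal_iff (crossIntegral_nonneg Λ ρ)]
  refine le_trans ?_ ((add_le_add (add_le_add (mul_le_mul_right l0 _) (mul_le_mul_right l1 _))
    (mul_le_mul_right l2 _)).trans key)
  rw [← ENNReal.ofReal_mul (by positivity), ← ENNReal.ofReal_mul (by positivity),
    ← ENNReal.ofReal_mul (by positivity), ← ENNReal.ofReal_add (by positivity) (by positivity),
    ← ENNReal.ofReal_add (by positivity) (by positivity)]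
  refine ENNReal.ofReal_le_ofReal (le_of_eq ?_)
  ring

/-! ### Stripes beat balls in the plane at volume fraction one half -/

/-- A lower bound for the relative interaction energy of disjoint discs of volume fraction `lam`
centred at the points of a planar lattice. -/
noncomputable def discBound (lam : ℝ) : ℝ :=
  Real.pi ^ 2 * √(lam / Real.pi) ^ 3 / 4 * (2 * latticeSumBound 0 +
    3 * lam * latticeSumBound 1 + 25 / 8 * lam ^ 2 * latticeSumBound 2)

theorem continuous_discBound : Continuous discBound := by
  unfold discBound
  fun_prop

theorem log_four_pi_lt : Real.log (4 * Real.pi) < 2.532 := by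
  have hpi := Real.pi_pos
  have h1 : Real.log Real.pi < 1.1457 := by
    rw [Real.log_lt_iff_lt_exp hpi]
    have h2 := Real.quadratic_le_exp_of_nonneg (show (0 : ℝ) ≤ 0.1457 by norm_num)
    have h3 := Real.exp_one_gt_d9
    have h4 := Real.pi_lt_d4
    rw [show (1.1457 : ℝ) = 1 + 0.1457 by norm_num, Real.exp_add]
    have h5 : (2.7182818283 : ℝ) * (1 + 0.1457 + 0.1457 ^ 2 / 2) ≤
        Real.exp 1 * Real.exp 0.1457 := by gcongr
    norm_num at h4 h5 ⊢
    linarith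
  have h6 : Real.log 4 = 2 * Real.log 2 := by
    rw [show (4 : ℝ) = 2 ^ 2 by norm_num, Real.log_pow]
    norm_num
  have h7 := Real.log_two_lt_d9
  rw [Real.log_mul (by norm_num) hpi.ne', h6]
  norm_num at h1 h7 ⊢
  linarith

/-- The decisive numerical inequality, about 0.5310 < 0.5321. The margin is thin: omitting the term
with `latticeSumBound 2` would lose about 0.023, and the decimals for √π and √(1/2) are sharp enough
to stay above 0.532. -/
theorem log_four_pi_sub_two_lt_discBound : Real.log (4 * Real.pi) - 2 < discBound (1 / 2) := by
  have hpi := Real.pi_pos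
  have hp : (1.772453 : ℝ) ≤ √Real.pi := by
    refine Real.le_sqrt_of_sq_le ?_
    have := Real.pi_gt_d6
    norm_num at this ⊢
    linarith
  have hr : (0.7071067 : ℝ) ≤ √(1 / 2) := Real.le_sqrt_of_sq_le (by norm_num)
  have hr2 : √(1 / 2) ^ 2 = (1 / 2 : ℝ) := Real.sq_sqrt (by norm_num)
  have hp2 : √Real.pi ^ 2 = Real.pi := Real.sq_sqrt hpi.le
  have h : discBound (1 / 2) = √Real.pi / 8 * ((10 / 3 + 7 / 20 + 45 / 896) / 2 +
      (13 / 32 + 123 / 512 + 225 / 2048) * √(1 / 2)) := by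
    have hp0 := Real.sqrt_pos.2 hpi
    rw [discBound, latticeSumBound_zero, latticeSumBound_one, latticeSumBound_two,
      Real.sqrt_div (by norm_num)]
    nth_rw 1 [← hp2]
    set p := √Real.pi
    set r := √(1 / 2 : ℝ)
    have e : (p ^ 2) ^ 2 * (r / p) ^ 3 / 4 = p * r / 8 := by
      rw [div_pow, show r ^ 3 = r ^ 2 * r by ring, hr2]
      field_simp
      norm_num
    rw [e]
    linear_combination p / 8 * (10 / 3 + 7 / 20 + 45 / 896) * hr2
  have h1 : (1.772453 : ℝ) / 8 * ((10 / 3 + 7 / 20 + 45 / 896) / 2 +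
      (13 / 32 + 123 / 512 + 225 / 2048) * 0.7071067) ≤ discBound (1 / 2) := by
    rw [h]
    gcongr
  have h2 := log_four_pi_lt
  norm_num at h1 h2 ⊢
  linarith

theorem ballValue_le_neg {Λ : Submodule ℤ (Space 2)} [DiscreteTopology Λ]
    [IsZLattice ℝ Λ] (hcov : ZLattice.covolume Λ = 1) {ρ : ℝ} (hρ : 0 < ρ) (h : IsPacking Λ ρ)
    {lam : ℝ} (hl : ρ ^ 2 * Real.pi = lam) :
    -(16 * lam * Real.exp (-1 - discBound lam)) ≤ ballValue (k := 1) Λ ρ lam := by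
  have hpi := Real.pi_pos
  have h0 : 0 < lam := by rw [← hl]; positivity
  have hX := h.le_crossIntegral hcov hρ
  have hr : √(lam / Real.pi) = ρ := by
    rw [← hl, mul_div_cancel_right₀ _ hpi.ne', Real.sqrt_sq hρ.le]
  have hB : discBound lam ≤
      crossIntegral Λ ρ / (((1 : ℕ) + 1) * ballVol (1 + 1) * (ballVol 1 * ρ ^ 1)) := by
    rw [ballVol_one, ballVol_two, le_div_iff₀ (by positivity)]
    refine le_trans (le_of_eq ?_) hX
    rw [discBound, hr, ← hl]
    push_cast
    ring
  rw [ballValue, neg_le_neg_iff, capDefect_one, ballVol_one]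
  rw [ballVol_one] at hB
  calc _ ≤ 2 * ((1 : ℕ) + 1) * 2 * lam * Real.exp (-(1 - Real.log 2) - discBound lam) := by
        gcongr
    _ = _ := by
        rw [show -(1 - Real.log 2) - discBound lam = Real.log 2 + (-1 - discBound lam) by ring,
          Real.exp_add, Real.exp_log two_pos]
        push_cast
        ring

/-- **Stripes beat balls at volume fraction close to one half.** -/
theorem exists_stripes_beat_balls : ∃ δ₀ : ℝ, 0 < δ₀ ∧
    ∀ (Λ : Submodule ℤ (Space 2)) [DiscreteTopology Λ] [IsZLattice ℝ Λ],
      ZLattice.covolume Λ = 1 → ∀ lam : ℝ, |lam - 1 / 2| < δ₀ →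
        ((ballEnergies Λ lam).Nonempty → eB Λ lam ∈ ballEnergies Λ lam) ∧
        eS 2 lam ∈ stripeEnergies 2 lam ∧ eS 2 lam < eB Λ lam := by
  have hpi := Real.pi_pos
  -- The logarithm of the ratio of the stripe and ball bounds. It is continuous, positive at 1/2 and
  -- does not involve the lattice, so δ₀ can be chosen uniformly.
  have hev : ∀ᶠ lam : ℝ in 𝓝 (1 / 2),
      0 < discBound lam - Real.log (8 * Real.pi * lam) + 2 - 12 * |lam - 1 / 2| := by
    refine Tendsto.eventually_const_lt (f := fun lam : ℝ => discBound lam -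
      Real.log (8 * Real.pi * lam) + 2 - 12 * |lam - 1 / 2|)
      (v := discBound (1 / 2) - Real.log (8 * Real.pi * (1 / 2)) + 2 - 12 * |1 / 2 - 1 / 2|) ?_ ?_
    · have := log_four_pi_sub_two_lt_discBound
      rw [sub_self, abs_zero, show 8 * Real.pi * (1 / 2) = 4 * Real.pi by ring]
      linarith
    · have h1 := continuous_discBound.continuousAt (x := (1 / 2 : ℝ))
      have h2 : ContinuousAt (fun lam : ℝ => Real.log (8 * Real.pi * lam)) (1 / 2) :=
        ContinuousAt.log (by fun_prop) (by positivity)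
      have h3 : ContinuousAt (fun lam : ℝ => discBound lam - Real.log (8 * Real.pi * lam) + 2 -
        12 * |lam - 1 / 2|) (1 / 2) := by fun_prop
      exact h3
  obtain ⟨ε, hε, hball⟩ := Metric.eventually_nhds_iff.1 hev
  refine ⟨min ε (1 / 4), lt_min hε (by norm_num), fun Λ _ _ hcov lam hlam => ?_⟩
  have hq : |lam - 1 / 2| < 1 / 4 := hlam.trans_le (min_le_right _ _)
  have hG := hball (y := lam) (hlam.trans_le (min_le_left _ _))
  obtain ⟨h0, h1⟩ : 0 < lam ∧ lam < 1 := by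
    rw [abs_lt] at hq
    constructor <;> linarith
  have hS := isLeast_stripeEnergies (k := 1) one_ne_zero h0 h1
  have hS' : eS 2 lam = (stripeValue 1 lam : EReal) := hS.csInf_eq
  have hmem : eS 2 lam ∈ stripeEnergies 2 lam := hS.csInf_mem
  by_cases hne : (ballEnergies Λ lam).Nonempty
  · obtain ⟨ρ, hρ, hpack, hl⟩ := exists_isPacking_of_nonempty (k := 1) hcov hne
    have hB := isLeast_ballEnergies (k := 1) one_ne_zero hcov hρ hpack hl
    have hB' : eB Λ lam = (ballValue (k := 1) Λ ρ lam : EReal) := hB.csInf_eq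
    refine ⟨fun _ => hB.csInf_mem, hmem, ?_⟩
    rw [hS', hB', EReal.coe_lt_coe_iff]
    rw [ballVol_two] at hl
    refine (stripeValue_one_le hq).trans_lt (lt_of_lt_of_le ?_ (ballValue_le_neg hcov hρ hpack hl))
    rw [neg_lt_neg_iff]
    have e1 : 16 * lam * Real.exp (-1 - discBound lam) =
        2 / Real.pi * Real.exp (Real.log (8 * Real.pi * lam) + (-1 - discBound lam)) := by
      rw [Real.exp_add, Real.exp_log (by positivity)]
      field_simp
      norm_num
    rw [e1]
    gcongr
    linarith
  · refine ⟨fun h => absurd h hne, hmem, ?_⟩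
    rw [hS', eB, Set.not_nonempty_iff_eq_empty.1 hne, sInf_empty]
    exact EReal.coe_lt_top _

end StripesBalls

theorem mainTheorem4 :
    (∀ (d : ℕ) [NeZero d], 2 ≤ d →
      ∀ (Λ₀ : Submodule ℤ (StripesBalls.Space d)) [DiscreteTopology Λ₀] [IsZLattice ℝ Λ₀],
        ZLattice.covolume Λ₀ = 1 →
        ∃ lam₀ : ℝ, 0 < lam₀ ∧ ∀ lam : ℝ, 0 < lam → lam < lam₀ →
          StripesBalls.eB Λ₀ lam ∈ StripesBalls.ballEnergies Λ₀ lam ∧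
          StripesBalls.eS d lam ∈ StripesBalls.stripeEnergies d lam ∧
          StripesBalls.eB Λ₀ lam < StripesBalls.eS d lam) ∧
    (∃ δ₀ : ℝ, 0 < δ₀ ∧
      ∀ (Λ₀ : Submodule ℤ (StripesBalls.Space 2)) [DiscreteTopology Λ₀] [IsZLattice ℝ Λ₀],
        ZLattice.covolume Λ₀ = 1 →
        ∀ lam : ℝ, |lam - 1 / 2| < δ₀ →
          ((StripesBalls.ballEnergies Λ₀ lam).Nonempty →
            StripesBalls.eB Λ₀ lam ∈ StripesBalls.ballEnergies Λ₀ lam) ∧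
          StripesBalls.eS 2 lam ∈ StripesBalls.stripeEnergies 2 lam ∧
          StripesBalls.eS 2 lam < StripesBalls.eB Λ₀ lam) := by
  refine ⟨fun d _ hd Λ₀ _ _ hcov => ?_, StripesBalls.exists_stripes_beat_balls⟩
  -- Here k is the dimension of the hyperplane slices; d ≥ 2 becomes k ≠ 0.
  obtain ⟨k, rfl⟩ : ∃ k, d = k + 1 := ⟨d - 1, by omega⟩
  exact StripesBalls.exists_balls_beat_stripes (by omega) Λ₀ hcov
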